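/- Let $d \ge 1$ and write points of $\mathbb{R}^{d+1}$ as $(t,x)$ with $t\in\mathbb{R}$, $x=(x^1,\dots,x^d)\in\mathbb{R}^d$. Let $\delta\in(0,1)$ and let $a^{jk}=a^{kj}$, $j,k=1,\dots,d$, be real-valued measurable functions of $(t,x^1)\in\mathbb{R}^2$ only such that $$\delta|\vartheta|^2\le\sum_{j,k=1}^d a^{jk}(t,x^1)\vartheta^j\vartheta^k\le\delta^{-1}|\vartheta|^2\qquad\text{for all }(t,x^1)\in\mathbb{R}^2,\ \vartheta\in\mathbb{R}^d .$$ Set $L_0u(t,x)=u_t(t,x)+\sum_{j,k=1}^d a^{jk}(t,x^1)u_{x^jx^k}(t,x)$, and let $W^{1,2}_2(\mathbb{R}^{d+1})$ be the space of real-valued $u\in L_2(\mathbb{R}^{d+1})$ whose weak derivatives $u_t$, $u_{x^j}$, $u_{x^jx^k}$ ($1\le j,k\le d$) belong to $L_2(\mathbb{R}^{d+1})$. Then for every $\lambda>0$ and every real-valued $f\in L_2(\mathbb{R}^{d+1})$ the equation $L_0u-\lambda u=f$ (almost everywhere in $\mathbb{R}^{d+1}$) has a unique solution $u\in W^{1,2}_2(\mathbb{R}^{d+1})$.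 Furthermore, there is a constant $N=N(\delta)$, depending only on $\delta$ (in particular not on $d$, $a$ or $\lambda$), such that for all $\lambda\ge0$ and all $u\in W^{1,2}_2(\mathbb{R}^{d+1})$, $$\|u_t\|+\|u_{xx}\|+\sqrt{\lambda}\,\|u_x\|+\lambda\|u\|\le N\|L_0u-\lambda u\|,$$ where $\|\cdot\|$ is the norm of $L_2(\mathbb{R}^{d+1})$, and $\|u_x\|$, $\|u_{xx}\|$ are the $L_2$-norms of $\big(\sum_k|u_{x^k}|^2\big)^{1/2}$ and $\big(\sum_{j,k}|u_{x^jx^k}|^2\big)^{1/2}$, respectively. -/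

import Mathlib

open MeasureTheory
open scoped ContDiff NNReal ENNReal

/-- Space-time `ℝ × ℝ^d`; a point is `z = (t, x)`, with `z.1 = t` and `z.2 = x`. Its `volume` is
the Lebesgue measure of `ℝ^{d+1}`. -/
abbrev SpaceTime (d : ℕ) : Type := ℝ × EuclideanSpace ℝ (Fin d)

/-- The real space `L₂(ℝ^{d+1})`. -/
abbrev L2 (d : ℕ) : Type := Lp ℝ 2 (volume : Measure (SpaceTime d))

/-- The time direction in space-time. -/
noncomputable def timeDir (d : ℕ) : SpaceTime d := (1, 0)

/-- The direction of the `k`-th space coordinate in space-time. -/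
noncomputable def spaceDir {d : ℕ} (k : Fin d) : SpaceTime d := (0, EuclideanSpace.single k 1)

/-- `g` is the weak (distributional) derivative of `u` in the direction `v`, both being in `L₂`. -/
def IsWeakDeriv {d : ℕ} (v : SpaceTime d) (u g : L2 d) : Prop :=
  ∀ φ : SpaceTime d → ℝ, ContDiff ℝ ∞ φ → HasCompactSupport φ →
    ∫ z, u z * fderiv ℝ φ z v = -∫ z, g z * φ z

/-- `u ∈ W^{1,2}_2(ℝ^{d+1})`, with weak derivatives `u_t = ut`, `u_{x^j} = ux j` and
`u_{x^j x^k} = uxx j k`, all of them in `L₂(ℝ^{d+1})`. -/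
structure IsW12With {d : ℕ} (u ut : L2 d) (ux : Fin d → L2 d) (uxx : Fin d → Fin d → L2 d) :
    Prop where
  time : IsWeakDeriv (timeDir d) u ut
  space : ∀ j, IsWeakDeriv (spaceDir j) u (ux j)
  space_space : ∀ j k, IsWeakDeriv (spaceDir k) (ux j) (uxx j k)

/-- The coefficients `a^{jk}(t, x^1)`: Lebesgue measurable (which for real functions is the same
as being almost everywhere equal to a Borel function), symmetric and uniformly elliptic. -/
structure IsAdmissible {d : ℕ} (δ : ℝ) (a : ℝ → ℝ → Matrix (Fin d) (Fin d) ℝ) : Prop where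
  measurable : ∀ j k, AEMeasurable (fun p : ℝ × ℝ => a p.1 p.2 j k) volume
  symmetric : ∀ t s j k, a t s j k = a t s k j
  lower : ∀ t s (ϑ : Fin d → ℝ), δ * ∑ j, ϑ j ^ 2 ≤ ∑ j, ∑ k, a t s j k * ϑ j * ϑ k
  upper : ∀ t s (ϑ : Fin d → ℝ), ∑ j, ∑ k, a t s j k * ϑ j * ϑ k ≤ δ⁻¹ * ∑ j, ϑ j ^ 2

/-- The function `L₀u - λu = u_t + a^{jk}(t, x^1) u_{x^j x^k} - λu`, in terms of `u` and its weak
derivatives; the coordinate `x^1` of the point `z = (t, x)` is `z.2 0`. -/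
noncomputable def parabolicOp {d : ℕ} [NeZero d] (a : ℝ → ℝ → Matrix (Fin d) (Fin d) ℝ) (lam : ℝ)
    (u ut : L2 d) (uxx : Fin d → Fin d → L2 d) (z : SpaceTime d) : ℝ :=
  ut z + ∑ j, ∑ k, a z.1 (z.2 0) j k * uxx j k z - lam * u z

/-- `u ∈ W^{1,2}_2(ℝ^{d+1})` and `L₀u - λu = f` almost everywhere. -/
def IsSolution {d : ℕ} [NeZero d] (a : ℝ → ℝ → Matrix (Fin d) (Fin d) ℝ) (lam : ℝ)
    (f u : L2 d) : Prop :=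
  ∃ (ut : L2 d) (ux : Fin d → L2 d) (uxx : Fin d → Fin d → L2 d),
    IsW12With u ut ux uxx ∧ ∀ᵐ z, parabolicOp a lam u ut uxx z = f z

/-- The `L₂(ℝ^{d+1})` norm of a function. -/
noncomputable def normL2 {d : ℕ} (g : SpaceTime d → ℝ) : ℝ≥0∞ := eLpNorm g 2 volume

/-! The coefficients depend on `(t, x¹)` only, so a Fourier transform in the other space variables
turns `L₀ - λ`, at a frequency `ζ` with `κ = |ζ|`, into the complex operator `v_t + a v_xx + 2iβ v_x
- (γ + λ) v` in `(t, x¹)`, where `a = a¹¹`, `β = ∑ a^{1k} ζ_k` and `γ = ∑ a^{jk} ζ_j ζ_k`. By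
Plancherel it suffices to estimate this operator uniformly in `ζ`. Only `κ` and `δ` enter there,
which is why the constant does not see the dimension.

The decisive point is the zeroth order bound `(δκ² + λ) ‖v‖ ≤ N ‖f‖`. Testing with `v` is useless,
since `a` is merely measurable and the operator is not in divergence form. Instead a Kato inequality
(`kato_pointwise`) is used: ellipticity in the direction `(θ, ζ)` with `θ = Im(v̄ v_x)/|v|²` shows
that `φ = |v|`, suitably regularised, satisfies `μφ - φ_t - aφ_xx ≤ |Re f| + |Im f|` with `μ = δκ² +
λ`. For the real operator in one space dimension `L²` theory is elementary: pairing with `φ_xx`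
bounds `φ_xx`, and after `aφ_xx` is moved to the source, pairing with `φ` bounds `μφ`.

To pass from solutions to nonnegative subsolutions a comparison principle is needed. It is proved
for finite differences, where the operator is `s - Q` with `Q` bounded and positive on `L²`: the
energy estimate makes the resolvent of `Q` exist and be positive down to the critical `s`
(`exists_nonneg_resolvent`, `norm_le_of_discrete_subsolution`). Since `φ` is a fixed regular
function, the mesh can then be sent to zero (`HasParabolicDerivs.rnorm_le_of_subsolution`).

With `κ²‖v‖` and `λ‖v‖` controlled, the terms in `β`, `γ`, `λ` become a source, and interpolation
absorbs `κ‖v_x‖` (`absorb_bounds`, `exists_frequency_estimate`). Integrating over frequencies gives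
the estimate for test functions (`exists_smooth_estimate`), and density of test functions gives it
on `W^{1,2}_2` (`exists_weak_estimate`).

For `λ > 0` the estimate gives uniqueness and closed range. Solvability for the heat operator
follows from triviality of the orthogonal complement of its range (`mollify_eq_zero_of_orthogonal`).
The method of continuity carries it to general coefficients, because admissible coefficients form a
convex set containing the identity. -/

open Filter Topology

/-! ### Positive resolvents and comparison in a Banach lattice. -/

section PositiveResolvent

variable {E : Type*} [NormedAddCommGroup E] [Lattice E] [HasSolidNorm E] [IsOrderedAddMonoid E]
  [NormedSpace ℝ E] [CompleteSpace E] [PosSMulMono ℝ E]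

/-- If `s - Q` has positive solutions, so does `s' - Q` for `s'` slightly below `s`. -/
theorem exists_nonneg_resolvent_of_close {Q : E →L[ℝ] E} {s s' K : ℝ}
    (hK : ∀ g : E, ‖g‖ ≤ K * ‖s • g - Q g‖) (hs : s' ≤ s) (hc : K * (s - s') ≤ 1 / 2)
    (h : ∀ F : E, 0 ≤ F → ∃ g : E, 0 ≤ g ∧ s • g - Q g = F) (F : E) (hF : 0 ≤ F) :
    ∃ g : E, 0 ≤ g ∧ s' • g - Q g = F := by
  choose R hR0 hR using h
  let X := {g : E // 0 ≤ g}
  have hcl : IsClosed {g : E | 0 ≤ g} := isClosed_nonneg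
  have : CompleteSpace X := hcl.completeSpace_coe
  have : Nonempty X := ⟨⟨0, le_refl _⟩⟩
  have hpos : ∀ g : X, 0 ≤ F + (s - s') • (g : E) := fun g =>
    add_nonneg hF (smul_nonneg (sub_nonneg.2 hs) g.2)
  -- The equation `s' g - Q g = F` is the fixed point equation `s g - Q g = F + (s - s') g`. Since
  -- `s' ≤ s`, the right side stays in the positive cone, so the iteration never leaves it.
  let T : X → X := fun g => ⟨R _ (hpos g), hR0 _ (hpos g)⟩
  have hT : ContractingWith (1 / 2 : ℝ≥0) T := by
    refine ⟨by
      rw [← NNReal.coe_lt_coe]; norm_num, LipschitzWith.of_dist_le_mul fun x y => ?_⟩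
    have h1 : dist (T x) (T y) = ‖(T x : E) - T y‖ := by rw [Subtype.dist_eq, dist_eq_norm]
    have h2 : dist x y = ‖(x : E) - y‖ := by rw [Subtype.dist_eq, dist_eq_norm]
    have h3 : s • ((T x : E) - T y) - Q ((T x : E) - T y) = (s - s') • ((x : E) - y) := by
      have hx := hR _ (hpos x)
      have hy := hR _ (hpos y)
      have : s • ((T x : E) - T y) - Q ((T x : E) - T y)
          = (s • (T x : E) - Q (T x : E)) - (s • (T y : E) - Q (T y : E)) := by
        rw [map_sub, smul_sub]; abel
      rw [this]
      change (s • R _ (hpos x) - Q (R _ (hpos x))) - (s • R _ (hpos y) - Q (R _ (hpos y))) = _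
      rw [hx, hy, smul_sub]; abel
    have h4 := hK ((T x : E) - T y)
    rw [h3, norm_smul, Real.norm_of_nonneg (sub_nonneg.2 hs), ← mul_assoc] at h4
    rw [h1, h2]
    refine h4.trans ?_
    push_cast
    exact mul_le_mul_of_nonneg_right hc (norm_nonneg _)
  let g := hT.fixedPoint T
  have hg : T g = g := hT.fixedPoint_isFixedPt
  refine ⟨g, g.2, ?_⟩
  have h1 := hR _ (hpos g)
  have h2 : R _ (hpos g) = (g : E) := congrArg Subtype.val hg
  rw [h2, sub_smul] at h1
  have : s' • (g : E) - Q g = s • (g : E) - Q g - (s • (g : E) - s' • (g : E)) := by abel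
  rw [this, h1]; abel

/-- A positive operator `Q` with `(s - M) ‖g‖ ≤ N ‖s g - Q g‖` for `s > M` has a positive resolvent
on `(M, ∞)`. -/
theorem exists_nonneg_resolvent {Q : E →L[ℝ] E} (hQ : ∀ g, 0 ≤ g → 0 ≤ Q g) {M N : ℝ}
    (hN : 1 ≤ N) (hM : ∀ s, M < s → ∀ g : E, (s - M) * ‖g‖ ≤ N * ‖s • g - Q g‖)
    {s : ℝ} (hs : M < s) (F : E) (hF : 0 ≤ F) : ∃ g : E, 0 ≤ g ∧ s • g - Q g = F := by
  have hK : ∀ s, M < s → ∀ g : E, ‖g‖ ≤ N / (s - M) * ‖s • g - Q g‖ := fun s hs g => by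
    rw [div_mul_eq_mul_div, le_div_iff₀ (sub_pos.2 hs), mul_comm]; exact hM s hs g
  -- Starting point of the continuation: for `s` this large, `g ↦ s⁻¹ (F + Q g)` contracts the cone
  -- with factor `1/2`.
  have big : ∀ s, M < s → 2 * ‖Q‖ + 1 ≤ s →
      ∀ F : E, 0 ≤ F → ∃ g : E, 0 ≤ g ∧ s • g - Q g = F := by
    intro s hs hb F hF
    have hs0 : 0 < s := by have := norm_nonneg Q; linarith
    let X := {g : E // 0 ≤ g}
    have hcl : IsClosed {g : E | 0 ≤ g} := isClosed_nonneg
    have : CompleteSpace X := hcl.completeSpace_coe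
    have : Nonempty X := ⟨⟨0, le_refl _⟩⟩
    let T : X → X := fun g =>
      ⟨s⁻¹ • (F + Q g), smul_nonneg (inv_nonneg.2 hs0.le) (add_nonneg hF (hQ _ g.2))⟩
    have hT : ContractingWith (1 / 2 : ℝ≥0) T := by
      refine ⟨by rw [← NNReal.coe_lt_coe]; norm_num, LipschitzWith.of_dist_le_mul fun x y => ?_⟩
      rw [Subtype.dist_eq, dist_eq_norm, Subtype.dist_eq, dist_eq_norm]
      change ‖s⁻¹ • (F + Q x) - s⁻¹ • (F + Q y)‖ ≤ _
      rw [← smul_sub, add_sub_add_left_eq_sub, ← map_sub, norm_smul,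
        Real.norm_of_nonneg (inv_nonneg.2 hs0.le)]
      have h1 := Q.le_opNorm ((x : E) - y)
      push_cast
      rw [inv_mul_le_iff₀ hs0]
      have := norm_nonneg ((x : E) - y)
      nlinarith
    let p : X := hT.fixedPoint T
    have hg : T p = p := hT.fixedPoint_isFixedPt
    refine ⟨p, p.2, ?_⟩
    have h2 : s⁻¹ • (F + Q p) = (p : E) := congrArg Subtype.val hg
    have h3 : F + Q p = s • (p : E) := by
      rw [← h2, smul_smul, mul_inv_cancel₀ hs0.ne', one_smul, h2]
    rw [← h3]; abel
  set S : ℝ := max (M + 1) (2 * ‖Q‖ + 1) with hS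
  have hSM : M < S := lt_of_lt_of_le (by linarith) (le_max_left _ _)
  -- The a priori constant at `s` is `N / (s - M)`, so a step down by `(s - M) / (2N)` is allowed.
  -- Each step multiplies the distance to `M` by `q`, hence every `s > M` is reached in finitely
  -- many steps although the constant blows up at `M`.
  set q : ℝ := 1 - 1 / (2 * N) with hq
  have hq1 : q < 1 := by rw [hq]; have : 0 < 1 / (2 * N) := by positivity
                         linarith
  have hq0 : 0 < q := by
    rw [hq, sub_pos, div_lt_one (by positivity)]; linarith
  have step : ∀ n : ℕ, ∀ s, M + q ^ n * (S - M) ≤ s →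
      ∀ F : E, 0 ≤ F → ∃ g : E, 0 ≤ g ∧ s • g - Q g = F := by
    intro n
    induction n with
    | zero =>
      intro s hs
      have : S ≤ s := by simpa using hs
      exact big s (lt_of_lt_of_le hSM this) ((le_max_right _ _).trans this)
    | succ n ih =>
      intro s hs F hF
      by_cases hc : M + q ^ n * (S - M) ≤ s
      · exact ih s hc F hF
      · push Not at hc
        have hp : 0 < q ^ n * (S - M) := mul_pos (pow_pos hq0 n) (sub_pos.2 hSM)
        refine exists_nonneg_resolvent_of_close (hK (M + q ^ n * (S - M)) (by linarith)) hc.le ?_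
          (ih _ le_rfl) F hF
        have e : q ^ (n + 1) * (S - M) = q ^ n * (S - M) - 1 / (2 * N) * (q ^ n * (S - M)) := by
          rw [pow_succ, hq]; ring
        rw [e] at hs
        rw [add_sub_cancel_left, div_mul_eq_mul_div, div_le_iff₀ hp]
        have : M + q ^ n * (S - M) - s ≤ 1 / (2 * N) * (q ^ n * (S - M)) := by linarith
        calc N * (M + q ^ n * (S - M) - s) ≤ N * (1 / (2 * N) * (q ^ n * (S - M))) := by gcongr
          _ = 1 / 2 * (q ^ n * (S - M)) := by field_simp
  obtain ⟨n, hn⟩ := exists_pow_lt_of_lt_one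
    (div_pos (sub_pos.2 hs) (sub_pos.2 hSM)) hq1
  rw [lt_div_iff₀ (sub_pos.2 hSM)] at hn
  exact step n s (by linarith) F hF

/-- Comparison principle for `s - Q`, in the form of a norm bound for nonnegative subsolutions. -/
theorem norm_le_of_subsolution {Q : E →L[ℝ] E} (hQ : ∀ g, 0 ≤ g → 0 ≤ Q g) {M N : ℝ}
    (hN : 1 ≤ N) (hM : ∀ s, M < s → ∀ g : E, (s - M) * ‖g‖ ≤ N * ‖s • g - Q g‖)
    {s : ℝ} (hs : M < s) {φ F : E} (hφ : 0 ≤ φ) (hF : 0 ≤ F) (h : s • φ - Q φ ≤ F) :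
    (s - M) * ‖φ‖ ≤ N * ‖F‖ := by
  obtain ⟨g, hg0, hg⟩ := exists_nonneg_resolvent hQ hN hM hs F hF
  -- The defect `F - (sφ - Qφ)` is nonnegative, so it has a nonnegative solution `w`. Uniqueness
  -- identifies `w` with `g - φ`, which gives `φ ≤ g`.
  obtain ⟨w, hw0, hw⟩ := exists_nonneg_resolvent hQ hN hM hs _ (sub_nonneg.2 h)
  have hwg : g - φ = w := by
    have h1 := hM s hs (g - φ - w)
    have h2 : s • (g - φ - w) - Q (g - φ - w) = 0 := by
      have : s • (g - φ - w) - Q (g - φ - w)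
          = (s • g - Q g) - (s • φ - Q φ) - (s • w - Q w) := by
        simp only [map_sub, smul_sub]; abel
      rw [this, hg, hw]; abel
    rw [h2, norm_zero, mul_zero] at h1
    have h3 : ‖g - φ - w‖ ≤ 0 := by
      by_contra hc
      push Not at hc
      have := mul_pos (sub_pos.2 hs) hc
      linarith
    exact sub_eq_zero.1 (norm_le_zero_iff.1 h3)
  have hle : φ ≤ g := by rw [← sub_nonneg, hwg]; exact hw0
  have h5 : ‖φ‖ ≤ ‖g‖ := norm_le_norm_of_abs_le_abs (by rwa [abs_of_nonneg hφ, abs_of_nonneg hg0])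
  have h6 := hM s hs g
  rw [hg] at h6
  exact (mul_le_mul_of_nonneg_left h5 (sub_pos.2 hs).le).trans h6

end PositiveResolvent

/-! ### Energy estimates for the implicit finite difference operator. -/

section DiscreteEnergy

variable {H : Type*} [NormedAddCommGroup H] [InnerProductSpace ℝ H]

/-- Energy estimate for `-(V - 1)/k + A (2 - U - U⁻¹)/h²`; here `τ = 1/k` and `σ = 1/h²`. -/
theorem norm_discreteLaplacian_le {δ μ τ σ : ℝ} (hμ : 0 ≤ μ) (hτ : 0 ≤ τ) (hσ : 0 ≤ σ)
    (U : H ≃ₗᵢ[ℝ] H) (V : H →ₗᵢ[ℝ] H) (hUV : ∀ g, U (V g) = V (U g)) (A : H →L[ℝ] H)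
    (hA : ∀ g, δ * ‖g‖ ^ 2 ≤ inner ℝ (A g) g) (g : H) :
    δ * ‖σ • (g + g - U g - U.symm g)‖ ≤
      ‖μ • g - τ • (V g - g) + A (σ • (g + g - U g - U.symm g))‖ := by
  set w := U g - g with hw
  -- Summation by parts in space.
  have key : ∀ f : H, inner ℝ f (g + g - U g - U.symm g) = inner ℝ (U f - f) w := by
    intro f
    have h1 : inner ℝ (U f) (U g) = inner ℝ f g := U.inner_map_map f g
    have h2 : inner ℝ (U f) g = inner ℝ f (U.symm g) := by
      rw [← U.inner_map_map f (U.symm g), U.apply_symm_apply]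
    rw [hw]
    simp only [inner_add_right, inner_sub_right, inner_sub_left, h1, h2]
    ring
  set l := σ • (g + g - U g - U.symm g) with hl
  have k1 : 0 ≤ inner ℝ (μ • g) l := by
    rw [hl, inner_smul_left, inner_smul_right, key, real_inner_self_eq_norm_sq]
    simp only [conj_trivial]; positivity
  -- Because `V` commutes with `U`, summation by parts turns this pairing into `⟨V w - w, w⟩`, which
  -- is nonpositive for an isometry `V`.
  have k2 : inner ℝ (τ • (V g - g)) l ≤ 0 := by
    have e : U (V g - g) - (V g - g) = V w - w := by
      rw [hw, map_sub, map_sub, hUV]; abel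
    have : inner ℝ (V w) w ≤ ‖w‖ * ‖w‖ := by
      have := real_inner_le_norm (V w) w
      rwa [V.norm_map] at this
    rw [hl, inner_smul_left, inner_smul_right, key, e, inner_sub_left,
      real_inner_self_eq_norm_mul_norm]
    simp only [conj_trivial]
    have h3 : 0 ≤ τ * (σ * (‖w‖ * ‖w‖ - inner ℝ (V w) w)) :=
      mul_nonneg hτ (mul_nonneg hσ (by linarith))
    linarith
  have k3 := hA l
  have k4 : inner ℝ (μ • g - τ • (V g - g) + A l) l
      = inner ℝ (μ • g) l - inner ℝ (τ • (V g - g)) l + inner ℝ (A l) l := by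
    rw [inner_add_left, inner_sub_left]
  have k5 := real_inner_le_norm (μ • g - τ • (V g - g) + A l) l
  by_cases h0 : ‖l‖ = 0
  · rw [h0, mul_zero]; exact norm_nonneg _
  · have : 0 < ‖l‖ := lt_of_le_of_ne (norm_nonneg _) (Ne.symm h0)
    refine le_of_mul_le_mul_right ?_ this
    nlinarith

/-- The pairing of `A l` with `g` has no sign, so `A l` is moved to the source: the preceding
estimate bounds it by `δ⁻²` times the full right side. Testing what remains with `g` uses only that
`V` is an isometry. This is where the constant `1 + δ⁻²` arises. -/
theorem norm_le_discrete {δ μ τ σ : ℝ} (hδ : 0 < δ) (hμ : 0 ≤ μ) (hτ : 0 ≤ τ) (hσ : 0 ≤ σ)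
    (U : H ≃ₗᵢ[ℝ] H) (V : H →ₗᵢ[ℝ] H) (hUV : ∀ g, U (V g) = V (U g)) (A : H →L[ℝ] H)
    (hA : ∀ g, δ * ‖g‖ ^ 2 ≤ inner ℝ (A g) g) (hA' : ∀ g, ‖A g‖ ≤ δ⁻¹ * ‖g‖) (g : H) :
    μ * ‖g‖ ≤ (1 + δ⁻¹ ^ 2) *
      ‖μ • g - τ • (V g - g) + A (σ • (g + g - U g - U.symm g))‖ := by
  have h1 := norm_discreteLaplacian_le hμ hτ hσ U V hUV A hA g
  set l := σ • (g + g - U g - U.symm g) with hl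
  set f := μ • g - τ • (V g - g) + A l with hf
  have h2 : ‖A l‖ ≤ δ⁻¹ ^ 2 * ‖f‖ := by
    refine (hA' l).trans ?_
    rw [pow_two, mul_assoc]
    gcongr
    rw [inv_mul_eq_div, le_div_iff₀ hδ, mul_comm]; exact h1
  have h3 : inner ℝ (V g) g ≤ ‖g‖ * ‖g‖ := by
    have := real_inner_le_norm (V g) g
    rwa [V.norm_map] at this
  have h4 : μ * (‖g‖ * ‖g‖) ≤ inner ℝ (f - A l) g := by
    have : f - A l = μ • g - τ • (V g - g) := by rw [hf]; abel
    rw [this, inner_sub_left, inner_smul_left, inner_smul_left, inner_sub_left,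
      real_inner_self_eq_norm_mul_norm]
    simp only [conj_trivial]
    nlinarith
  have h5 := real_inner_le_norm (f - A l) g
  have h6 : ‖f - A l‖ ≤ ‖f‖ + ‖A l‖ := norm_sub_le _ _
  by_cases h0 : ‖g‖ = 0
  · rw [h0, mul_zero]; positivity
  · have : 0 < ‖g‖ := lt_of_le_of_ne (norm_nonneg _) (Ne.symm h0)
    refine le_of_mul_le_mul_right ?_ this
    nlinarith

end DiscreteEnergy

/-! ### Multiplication by bounded functions on `L²`. -/

section Multiplication

variable {α : Type*} [MeasurableSpace α] {ν : Measure α}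

instance Lp.posSMulMono : PosSMulMono ℝ (Lp ℝ 2 ν) where
  smul_le_smul_of_nonneg_left c hc f g hfg := by
    rw [← Lp.coeFn_le] at hfg ⊢
    filter_upwards [Lp.coeFn_smul c f, Lp.coeFn_smul c g, hfg] with z h1 h2 h3
    rw [h1, h2]
    exact mul_le_mul_of_nonneg_left h3 hc

theorem memLp_bounded_mul {b : α → ℝ} (hb : AEStronglyMeasurable b ν) {C : ℝ}
    (hC : ∀ z, |b z| ≤ C) {g : α → ℝ} (hg : MemLp g 2 ν) : MemLp (fun z => b z * g z) 2 ν :=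
  hg.of_le_mul (c := C) (hb.mul hg.1) (Eventually.of_forall fun z => by
    rw [norm_mul]; exact mul_le_mul_of_nonneg_right (hC z) (norm_nonneg _))

/-- Multiplication by a bounded function, as an operator on `L²`. -/
noncomputable def mulL2 (b : α → ℝ) (hb : AEStronglyMeasurable b ν) (C : ℝ)
    (hC : ∀ z, |b z| ≤ C) : Lp ℝ 2 ν →L[ℝ] Lp ℝ 2 ν :=
  LinearMap.mkContinuous
    { toFun := fun g => (memLp_bounded_mul hb hC (Lp.memLp g)).toLp _
      map_add' := fun f g => by
        rw [← MemLp.toLp_add]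
        refine MemLp.toLp_congr _ _ ?_
        filter_upwards [Lp.coeFn_add f g] with z hz
        change b z * (f + g : Lp ℝ 2 ν) z = b z * f z + b z * g z
        rw [hz, Pi.add_apply, mul_add]
      map_smul' := fun c g => by
        rw [RingHom.id_apply, ← MemLp.toLp_const_smul]
        refine MemLp.toLp_congr _ _ ?_
        filter_upwards [Lp.coeFn_smul c g] with z hz
        change b z * (c • g : Lp ℝ 2 ν) z = c • (b z * g z)
        rw [hz, Pi.smul_apply, smul_eq_mul, smul_eq_mul, mul_left_comm] }
    C (fun g => by
      refine Lp.norm_le_mul_norm_of_ae_le_mul ?_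
      filter_upwards [MemLp.coeFn_toLp (memLp_bounded_mul hb hC (Lp.memLp g))] with z hz
      simp only [LinearMap.coe_mk, AddHom.coe_mk, hz, norm_mul]
      exact mul_le_mul_of_nonneg_right (hC z) (norm_nonneg _))

theorem coeFn_mulL2 {b : α → ℝ} (hb : AEStronglyMeasurable b ν) {C : ℝ}
    (hC : ∀ z, |b z| ≤ C) (g : Lp ℝ 2 ν) :
    mulL2 b hb C hC g =ᵐ[ν] fun z => b z * g z :=
  MemLp.coeFn_toLp (memLp_bounded_mul hb hC (Lp.memLp g))

theorem norm_mulL2_le {b : α → ℝ} (hb : AEStronglyMeasurable b ν) {C : ℝ}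
    (hC : ∀ z, |b z| ≤ C) (g : Lp ℝ 2 ν) : ‖mulL2 b hb C hC g‖ ≤ C * ‖g‖ := by
  refine Lp.norm_le_mul_norm_of_ae_le_mul ?_
  filter_upwards [coeFn_mulL2 hb hC g] with z hz
  rw [hz, norm_mul]
  exact mul_le_mul_of_nonneg_right (hC z) (norm_nonneg _)

theorem mulL2_nonneg {b : α → ℝ} (hb : AEStronglyMeasurable b ν) {C : ℝ}
    (hC : ∀ z, |b z| ≤ C) (h0 : ∀ z, 0 ≤ b z) {g : Lp ℝ 2 ν} (hg : 0 ≤ g) :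
    0 ≤ mulL2 b hb C hC g := by
  rw [← Lp.coeFn_nonneg] at hg ⊢
  filter_upwards [coeFn_mulL2 hb hC g, hg] with z hz h
  rw [hz]
  exact mul_nonneg (h0 z) h

theorem le_inner_mulL2 {b : α → ℝ} (hb : AEStronglyMeasurable b ν) {C : ℝ}
    (hC : ∀ z, |b z| ≤ C) {δ : ℝ} (hδ : ∀ z, δ ≤ b z) (g : Lp ℝ 2 ν) :
    δ * ‖g‖ ^ 2 ≤ inner ℝ (mulL2 b hb C hC g) g := by
  have h1 : (inner ℝ (mulL2 b hb C hC g) g : ℝ) = ∫ z, b z * g z * g z ∂ν := by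
    rw [L2.inner_def]
    refine integral_congr_ae ?_
    filter_upwards [coeFn_mulL2 hb hC g] with z hz
    rw [hz]; simp [mul_comm]
  have h2 : ‖g‖ ^ 2 = ∫ z, g z * g z ∂ν := by
    rw [← real_inner_self_eq_norm_sq, L2.inner_def]
    simp [pow_two]
  have i1 : Integrable (fun z => g z * g z) ν := (Lp.memLp g).integrable_mul (Lp.memLp g)
  have i2 : Integrable (fun z => b z * g z * g z) ν :=
    (memLp_bounded_mul hb hC (Lp.memLp g)).integrable_mul (Lp.memLp g)
  rw [h1, h2, ← integral_const_mul]
  refine integral_mono (i1.const_mul δ) i2 fun z => ?_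
  change δ * (g z * g z) ≤ b z * g z * g z
  rw [mul_assoc]
  exact mul_le_mul_of_nonneg_right (hδ z) (mul_self_nonneg _)

end Multiplication

/-! ### Translations on `L²` and the discrete comparison principle. -/

section Translation

variable {α : Type*} [MeasurableSpace α] [AddCommGroup α] [MeasurableAdd α] {ν : Measure α}
  [ν.IsAddRightInvariant]

/-- The translation `g ↦ g(· + w)` on `L²`. -/
noncomputable def transL2 (ν : Measure α) [ν.IsAddRightInvariant] (w : α) :
    Lp ℝ 2 ν →ₗᵢ[ℝ] Lp ℝ 2 ν :=
  Lp.compMeasurePreservingₗᵢ ℝ _ (measurePreserving_add_right ν w)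

theorem coeFn_transL2 (w : α) (g : Lp ℝ 2 ν) : transL2 ν w g =ᵐ[ν] fun z => g (z + w) :=
  Lp.coeFn_compMeasurePreserving g (measurePreserving_add_right ν w)

theorem transL2_comp (v w : α) (g : Lp ℝ 2 ν) :
    transL2 ν v (transL2 ν w g) = transL2 ν (v + w) g := by
  refine Lp.ext ?_
  have h := (measurePreserving_add_right ν v).quasiMeasurePreserving.ae_eq_comp
    (coeFn_transL2 w g)
  filter_upwards [coeFn_transL2 v (transL2 ν w g), coeFn_transL2 (v + w) g, h] with z h1 h2 h3
  simp only [Function.comp_apply] at h3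
  rw [h1, h2, h3, add_assoc]

theorem transL2_zero (g : Lp ℝ 2 ν) : transL2 ν 0 g = g := by
  refine Lp.ext ?_
  filter_upwards [coeFn_transL2 0 g] with z h1
  rw [h1, add_zero]

/-- Translation as an isometric equivalence. -/
noncomputable def transEquivL2 (ν : Measure α) [ν.IsAddRightInvariant] (w : α) :
    Lp ℝ 2 ν ≃ₗᵢ[ℝ] Lp ℝ 2 ν where
  toLinearEquiv := LinearEquiv.ofLinearMap (transL2 ν w).toLinearMap (transL2 ν (-w)).toLinearMap
    (by ext1 g; simp [transL2_comp, transL2_zero]) (by ext1 g; simp [transL2_comp, transL2_zero])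
  norm_map' := (transL2 ν w).norm_map

theorem transEquivL2_apply (w : α) (g : Lp ℝ 2 ν) : transEquivL2 ν w g = transL2 ν w g := rfl

theorem transL2_nonneg (w : α) {g : Lp ℝ 2 ν} (hg : 0 ≤ g) : 0 ≤ transL2 ν w g := by
  rw [← Lp.coeFn_nonneg] at hg ⊢
  have h := (measurePreserving_add_right ν w).quasiMeasurePreserving.ae hg
  filter_upwards [coeFn_transL2 w g, h] with z h1 h2
  rw [h1]; exact h2

/-- The negative second difference quotient of `g` in the direction `w`, with `σ = |w|⁻²`. -/
noncomputable def negLapL2 (ν : Measure α) [ν.IsAddRightInvariant] (σ : ℝ) (w : α)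
    (g : Lp ℝ 2 ν) : Lp ℝ 2 ν :=
  σ • (g + g - transL2 ν w g - transL2 ν (-w) g)

theorem norm_negLapL2_le {δ μ τ σ : ℝ} (hμ : 0 ≤ μ) (hτ : 0 ≤ τ) (hσ : 0 ≤ σ) (v w : α)
    {b : α → ℝ} (hb : AEStronglyMeasurable b ν) (hδ : ∀ z, δ ≤ b z) {C : ℝ} (hC : ∀ z, |b z| ≤ C)
    (g : Lp ℝ 2 ν) :
    δ * ‖negLapL2 ν σ w g‖ ≤
      ‖μ • g - τ • (transL2 ν v g - g) + mulL2 b hb C hC (negLapL2 ν σ w g)‖ :=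
  norm_discreteLaplacian_le hμ hτ hσ (transEquivL2 ν w) (transL2 ν v)
    (fun g => by rw [transEquivL2_apply, transEquivL2_apply, transL2_comp, transL2_comp, add_comm])
    (mulL2 b hb C hC) (le_inner_mulL2 hb hC hδ) g

/-- The scheme has the form `(μ + M) - Q` with `Q` positive, so the abstract comparison applies; its
resolvent bound is exactly the energy estimate. No relation between the time and space steps is
required. -/
theorem norm_le_of_discrete_subsolution {δ μ τ σ : ℝ} (hδ0 : 0 < δ) (hμ : 0 < μ) (hτ : 0 ≤ τ)
    (hσ : 0 ≤ σ) (v w : α) {b : α → ℝ} (hb : AEStronglyMeasurable b ν) (hδ : ∀ z, δ ≤ b z)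
    (hC : ∀ z, |b z| ≤ δ⁻¹) {φ F : Lp ℝ 2 ν} (hφ : 0 ≤ φ) (hF : 0 ≤ F)
    (h : μ • φ - τ • (transL2 ν v φ - φ) + mulL2 b hb δ⁻¹ hC (negLapL2 ν σ w φ) ≤ F) :
    μ * ‖φ‖ ≤ (1 + δ⁻¹ ^ 2) * ‖F‖ := by
  have hb' : AEStronglyMeasurable (fun z => δ⁻¹ - b z) ν := aestronglyMeasurable_const.sub hb
  have hb0 : ∀ z, 0 ≤ b z := fun z => hδ0.le.trans (hδ z)
  have hC' : ∀ z, |δ⁻¹ - b z| ≤ δ⁻¹ := fun z => by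
    have h1 := hC z
    rw [abs_of_nonneg (hb0 z)] at h1
    rw [abs_of_nonneg (sub_nonneg.2 h1)]
    linarith [hb0 z]
  set A := mulL2 b hb δ⁻¹ hC with hA
  set A' := mulL2 (fun z => δ⁻¹ - b z) hb' δ⁻¹ hC' with hA'
  have hAA : ∀ g, A' g = δ⁻¹ • g - A g := fun g => by
    refine Lp.ext ?_
    filter_upwards [coeFn_mulL2 hb hC g, coeFn_mulL2 hb' hC' g, Lp.coeFn_sub (δ⁻¹ • g) (A g),
      Lp.coeFn_smul δ⁻¹ g] with z h1 h2 h3 h4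
    rw [h2, h3, Pi.sub_apply, h1, h4]
    simp; ring
  set V := (transL2 ν v).toContinuousLinearMap with hV
  set U := (transL2 ν w).toContinuousLinearMap with hU
  set U' := (transL2 ν (-w)).toContinuousLinearMap with hU'
  -- The neighbours enter with nonnegative weights, but the diagonal term `-2σA` does not. Adding
  -- `2σδ⁻¹` to it gives multiplication by `2σ(δ⁻¹ - b) ≥ 0`, and this shift together with `τ` is
  -- the number `M`.
  let Q : Lp ℝ 2 ν →L[ℝ] Lp ℝ 2 ν := τ • V + σ • (A.comp (U + U')) + (2 * σ) • A'
  set M : ℝ := τ + 2 * δ⁻¹ * σ with hMdef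
  have e : ∀ s g, s • g - Q g =
      (s - M) • g - τ • (transL2 ν v g - g) + A (negLapL2 ν σ w g) := fun s g => by
    have e1 : Q g = τ • transL2 ν v g + σ • (A (transL2 ν w g) + A (transL2 ν (-w) g))
        + (2 * σ) • (δ⁻¹ • g - A g) := by
      rw [← hAA, ← map_add]; rfl
    rw [e1, negLapL2, map_smul, map_sub, map_sub, map_add, hMdef]
    module
  have hQ : ∀ g, 0 ≤ g → 0 ≤ Q g := fun g hg => by
    have h1 : 0 ≤ A (transL2 ν w g + transL2 ν (-w) g) :=
      mulL2_nonneg hb hC hb0 (add_nonneg (transL2_nonneg w hg) (transL2_nonneg (-w) hg))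
    have h2 : 0 ≤ A' g := mulL2_nonneg hb' hC' (fun z => by
      have h1 := hC z
      rw [abs_of_nonneg (hb0 z)] at h1
      exact sub_nonneg.2 h1) hg
    have h3 : Q g = τ • transL2 ν v g + σ • A (transL2 ν w g + transL2 ν (-w) g)
        + (2 * σ) • A' g := rfl
    rw [h3]
    exact add_nonneg (add_nonneg (smul_nonneg hτ (transL2_nonneg v hg)) (smul_nonneg hσ h1))
      (smul_nonneg (by positivity) h2)
  have hN : (1 : ℝ) ≤ 1 + δ⁻¹ ^ 2 := by have : 0 ≤ δ⁻¹ ^ 2 := by positivity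
                                        linarith
  have hb1 : ∀ s, M < s → ∀ g : Lp ℝ 2 ν, (s - M) * ‖g‖ ≤ (1 + δ⁻¹ ^ 2) * ‖s • g - Q g‖ := by
    intro s hs g
    rw [e]
    exact norm_le_discrete hδ0 (sub_pos.2 hs).le hτ hσ (transEquivL2 ν w) (transL2 ν v)
      (fun g => by
        rw [transEquivL2_apply, transEquivL2_apply, transL2_comp, transL2_comp, add_comm])
      A (le_inner_mulL2 hb hC hδ) (norm_mulL2_le hb hC) g
  have := norm_le_of_subsolution hQ hN hb1 (s := μ + M) (by linarith) hφ hF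
    (by rw [e, add_sub_cancel_right]; exact h)
  rwa [add_sub_cancel_right] at this

/-- Summation by parts followed by Cauchy–Schwarz; this is the discrete form of `‖φ_x‖² ≤ ‖φ_xx‖
‖φ‖`. -/
theorem norm_difference_sq_le (σ : ℝ) (w : α) (g : Lp ℝ 2 ν) :
    ‖σ • (transL2 ν w g - g)‖ ^ 2 ≤ ‖negLapL2 ν (σ ^ 2) w g‖ * ‖g‖ := by
  set U := transEquivL2 ν w with hU
  have h1 : inner ℝ (U g) (U g) = inner ℝ g g := U.inner_map_map g g
  have h2 : inner ℝ (U g) g = inner ℝ (U.symm g) g := by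
    rw [← U.inner_map_map (U.symm g) g, U.apply_symm_apply, real_inner_comm]
  have h3 : ‖σ • (U g - g)‖ ^ 2 = inner ℝ (σ ^ 2 • (g + g - U g - U.symm g)) g := by
    rw [← real_inner_self_eq_norm_sq]
    simp only [inner_smul_left, inner_smul_right, inner_add_left, inner_sub_left, inner_sub_right,
      h1, ← h2, conj_trivial, real_inner_comm g (U g)]
    ring
  exact h3.trans_le (real_inner_le_norm _ _)

end Translation

/-! ### Convergence of difference quotients in `L²`. -/

theorem exists_uniform_modulus {α : Type*} [NormedAddCommGroup α] {ψ : α → ℝ} (hc : Continuous ψ) (hs : HasCompactSupport ψ) {ε : ℝ}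
    (hε : 0 < ε) : ∃ η > 0, ∀ z w, ‖w‖ ≤ η → |ψ (z + w) - ψ z| ≤ ε := by
  have := hs.uniformContinuous_of_continuous hc
  rw [Metric.uniformContinuous_iff] at this
  obtain ⟨η, hη, h⟩ := this ε hε
  refine ⟨η / 2, by positivity, fun z w hw => ?_⟩
  have := h (a := z + w) (b := z) (by rw [dist_eq_norm, add_sub_cancel_left]; linarith)
  exact this.le

theorem exists_norm_bound_support {α : Type*} [NormedAddCommGroup α] {ψ : α → ℝ} (hs : HasCompactSupport ψ) :
    ∃ R : ℝ, ∀ z, R < ‖z‖ → ψ z = 0 := by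
  obtain ⟨R, hR⟩ := hs.isCompact.isBounded.exists_norm_le
  refine ⟨R, fun z hz => image_eq_zero_of_notMem_tsupport fun hmem => ?_⟩
  exact absurd (hR z hmem) (not_le.2 hz)

theorem Continuous.memLp_two {α E : Type*} [TopologicalSpace α] [MeasurableSpace α]
    [OpensMeasurableSpace α] {ν : Measure α} [IsFiniteMeasureOnCompacts ν] [NormedAddCommGroup E]
    [SecondCountableTopologyEither α E] {ψ : α → E} (hc : Continuous ψ)
    (hs : HasCompactSupport ψ) : MemLp ψ 2 ν := hc.memLp_of_hasCompactSupport hs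

section DifferenceQuotients

variable {α : Type*} [NormedAddCommGroup α] [NormedSpace ℝ α] {ψ ψ' ψ'' : α → ℝ} {e : α}

theorem exists_difference_eq (he : ‖e‖ ≤ 1)
    (hd : ∀ z (s : ℝ), HasDerivAt (fun s : ℝ => ψ (z + s • e)) (ψ' (z + s • e)) s) {h : ℝ}
    (hh : 0 < h) (z : α) : ∃ w : α, ‖w‖ ≤ h ∧ h⁻¹ * (ψ (z + h • e) - ψ z) = ψ' (z + w) := by
  obtain ⟨c, hc, hc'⟩ := exists_hasDerivAt_eq_slope (fun s : ℝ => ψ (z + s • e))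
    (fun s => ψ' (z + s • e)) hh (fun s _ => (hd z s).continuousAt.continuousWithinAt)
    (fun s _ => hd z s)
  refine ⟨c • e, ?_, ?_⟩
  · rw [norm_smul, Real.norm_of_nonneg hc.1.le]
    nlinarith [hc.1, hc.2, norm_nonneg e]
  · rw [hc']; simp [div_eq_inv_mul]

theorem exists_second_difference_eq (he : ‖e‖ ≤ 1)
    (hd : ∀ z (s : ℝ), HasDerivAt (fun s : ℝ => ψ (z + s • e)) (ψ' (z + s • e)) s)
    (hd' : ∀ z (s : ℝ), HasDerivAt (fun s : ℝ => ψ' (z + s • e)) (ψ'' (z + s • e)) s) {h : ℝ}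
    (hh : 0 < h) (z : α) : ∃ w : α, ‖w‖ ≤ h ∧
      h⁻¹ ^ 2 * (ψ z + ψ z - ψ (z + h • e) - ψ (z + -(h • e))) = -ψ'' (z + w) := by
  have hdneg : ∀ s : ℝ, HasDerivAt (fun s : ℝ => ψ (z + (-s) • e)) (-ψ' (z + (-s) • e)) s :=
    fun s => by
      have := (hd z (-s)).scomp s (hasDerivAt_neg s)
      rw [neg_one_smul] at this
      exact this
  have hdneg' : ∀ s : ℝ, HasDerivAt (fun s : ℝ => ψ' (z + (-s) • e)) (-ψ'' (z + (-s) • e)) s :=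
    fun s => by
      have := (hd' z (-s)).scomp s (hasDerivAt_neg s)
      rw [neg_one_smul] at this
      exact this
  have hG : ∀ s : ℝ, HasDerivAt (fun s : ℝ => ψ (z + s • e) + ψ (z + (-s) • e))
      (ψ' (z + s • e) - ψ' (z + (-s) • e)) s := fun s => by
    rw [sub_eq_add_neg]
    exact (hd z s).add (hdneg s)
  -- Cauchy's mean value theorem compares the even function `ψ(z + se) + ψ(z - se)` with `s²`. The
  -- ordinary mean value theorem for `ψ'` on `[-c, c]` then produces a value of `ψ''`.
  obtain ⟨c, hc, hc'⟩ := exists_ratio_hasDerivAt_eq_ratio_slope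
    (fun s : ℝ => ψ (z + s • e) + ψ (z + (-s) • e))
    (fun s => ψ' (z + s • e) - ψ' (z + (-s) • e)) hh
    (fun s _ => (hG s).continuousAt.continuousWithinAt) (fun s _ => hG s)
    (fun s : ℝ => s ^ 2) (fun s => 2 * s) (by fun_prop) (fun s _ => by simpa using hasDerivAt_pow 2 s)
  have hc0 : 0 < c := hc.1
  obtain ⟨b, hb, hb'⟩ := exists_hasDerivAt_eq_slope (fun s : ℝ => ψ' (z + s • e))
    (fun s => ψ'' (z + s • e)) (show -c < c by linarith)
    (fun s _ => (hd' z s).continuousAt.continuousWithinAt) (fun s _ => hd' z s)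
  refine ⟨b • e, ?_, ?_⟩
  · rw [norm_smul]
    have h1 : ‖b‖ ≤ h := by
      rw [Real.norm_eq_abs, abs_le]; constructor <;> linarith [hb.1, hb.2, hc.2]
    nlinarith [norm_nonneg e, norm_nonneg b]
  · have h1 : ψ' (z + c • e) - ψ' (z + (-c) • e) = ψ'' (z + b • e) * (2 * c) := by
      rw [hb']; field_simp; ring
    rw [h1] at hc'
    have h2 : (ψ (z + h • e) + ψ (z + (-h) • e)) - (ψ z + ψ z) = h ^ 2 * ψ'' (z + b • e) := by
      have h3 : (2 * c) * ((ψ (z + h • e) + ψ (z + (-h) • e)) - (ψ z + ψ z))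
          = (2 * c) * (h ^ 2 * ψ'' (z + b • e)) := by
        simp only [neg_zero, zero_smul, add_zero] at hc'
        linarith
      exact mul_left_cancel₀ (by positivity) h3
    rw [← neg_smul]
    have h4 : ψ z + ψ z - ψ (z + h • e) - ψ (z + (-h) • e) = -(h ^ 2 * ψ'' (z + b • e)) := by
      rw [← h2]; ring
    rw [h4]; field_simp

variable [MeasurableSpace α] [BorelSpace α] {ν : Measure α} [IsFiniteMeasureOnCompacts ν]

variable [ProperSpace α]

/-- All differences vanish off one ball of finite measure, so a uniform bound `ε` costs at most `ε`
times the norm of the indicator of that ball. -/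
theorem tendsto_L2_of_uniform {g : ℝ → Lp ℝ 2 ν} {g₀ : Lp ℝ 2 ν} (R : ℝ)
    (h : ∀ ε > 0, ∀ᶠ s in 𝓝[>] (0 : ℝ), ∀ᵐ z ∂ν,
      |g s z - g₀ z| ≤ ε ∧ (R < ‖z‖ → g s z - g₀ z = 0)) :
    Tendsto g (𝓝[>] 0) (𝓝 g₀) := by
  have hK : ν (Metric.closedBall (0 : α) R) ≠ ⊤ := (isCompact_closedBall 0 R).measure_ne_top
  set χ : Lp ℝ 2 ν := indicatorConstLp 2 (Metric.isClosed_closedBall.measurableSet) hK 1 with hχ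
  rw [tendsto_iff_norm_sub_tendsto_zero, Metric.tendsto_nhds]
  intro ε hε
  have hpos : 0 < ε / (‖χ‖ + 1) := by positivity
  filter_upwards [h _ hpos] with s hs
  have h1 : ‖g s - g₀‖ ≤ ε / (‖χ‖ + 1) * ‖χ‖ := by
    refine Lp.norm_le_mul_norm_of_ae_le_mul ?_
    filter_upwards [hs, Lp.coeFn_sub (g s) g₀,
      indicatorConstLp_coeFn (p := 2) (hs := Metric.isClosed_closedBall.measurableSet)
        (hμs := hK) (c := (1 : ℝ))] with z hz h2 h3
    rw [h2, h3, Pi.sub_apply, Real.norm_eq_abs]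
    by_cases hz' : R < ‖z‖
    · rw [hz.2 hz', abs_zero]; positivity
    · rw [Set.indicator_of_mem (by simpa using hz')]
      simpa using hz.1
  rw [Real.dist_eq, sub_zero, abs_of_nonneg (norm_nonneg _)]
  refine h1.trans_lt ?_
  rw [div_mul_eq_mul_div, div_lt_iff₀ (by positivity)]
  nlinarith

variable [ν.IsAddRightInvariant] [SecondCountableTopologyEither α ℝ]

theorem tendsto_difference_L2 (he : ‖e‖ ≤ 1) (hc : Continuous ψ) (hs : HasCompactSupport ψ)
    (hc' : Continuous ψ') (hs' : HasCompactSupport ψ')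
    (hd : ∀ z (s : ℝ), HasDerivAt (fun s : ℝ => ψ (z + s • e)) (ψ' (z + s • e)) s) :
    Tendsto (fun h : ℝ => h⁻¹ • (transL2 ν (h • e) ((hc.memLp_two hs).toLp ψ)
      - (hc.memLp_two hs).toLp ψ)) (𝓝[>] 0) (𝓝 ((hc'.memLp_two hs').toLp ψ')) := by
  obtain ⟨R, hR⟩ := exists_norm_bound_support hs
  obtain ⟨R', hR'⟩ := exists_norm_bound_support hs'
  -- The extra `1` leaves room for the shift of the mean value point, which has norm at most `h ≤
  -- 1`.
  refine tendsto_L2_of_uniform (max R R' + 1) fun ε hε => ?_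
  obtain ⟨η, hη, hmod⟩ := exists_uniform_modulus hc' hs' hε
  filter_upwards [Ioc_mem_nhdsGT (lt_min hη one_pos)] with h hh
  have hh0 : 0 < h := hh.1
  have hhη : h ≤ η := hh.2.trans (min_le_left _ _)
  have hh1 : h ≤ 1 := hh.2.trans (min_le_right _ _)
  set Ψ := (hc.memLp_two (ν := ν) hs).toLp ψ with hΨ
  have a1 := (measurePreserving_add_right ν (h • e)).quasiMeasurePreserving.ae_eq_comp
    (hc.memLp_two (ν := ν) hs).coeFn_toLp
  filter_upwards [Lp.coeFn_smul h⁻¹ (transL2 ν (h • e) Ψ - Ψ), Lp.coeFn_sub (transL2 ν (h • e) Ψ) Ψ,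
    coeFn_transL2 (ν := ν) (h • e) Ψ, (hc.memLp_two (ν := ν) hs).coeFn_toLp,
    (hc'.memLp_two (ν := ν) hs').coeFn_toLp, a1] with z h1 h2 h3 h4 h5 h6
  simp only [Function.comp_apply] at h6
  obtain ⟨w, hw, hw'⟩ := exists_difference_eq he hd hh0 z
  rw [h1, Pi.smul_apply, h2, Pi.sub_apply, h3, hΨ, h6, h4, h5, smul_eq_mul, hw']
  refine ⟨hmod z w (hw.trans hhη), fun hz => ?_⟩
  have hn : ‖z‖ ≤ ‖z + w‖ + ‖w‖ := by simpa using norm_sub_le (z + w) w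
  rw [hR' z (by linarith [le_max_right R R']), hR' (z + w) (by linarith [le_max_right R R']),
    sub_zero]

theorem tendsto_second_difference_L2 (he : ‖e‖ ≤ 1) (hc : Continuous ψ) (hs : HasCompactSupport ψ)
    (hc' : Continuous ψ'') (hs' : HasCompactSupport ψ'')
    (hd : ∀ z (s : ℝ), HasDerivAt (fun s : ℝ => ψ (z + s • e)) (ψ' (z + s • e)) s)
    (hd' : ∀ z (s : ℝ), HasDerivAt (fun s : ℝ => ψ' (z + s • e)) (ψ'' (z + s • e)) s) :
    Tendsto (fun h : ℝ => negLapL2 ν (h⁻¹ ^ 2) (h • e) ((hc.memLp_two hs).toLp ψ))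
      (𝓝[>] 0) (𝓝 (-(hc'.memLp_two hs').toLp ψ'')) := by
  obtain ⟨R, hR⟩ := exists_norm_bound_support hs
  obtain ⟨R', hR'⟩ := exists_norm_bound_support hs'
  refine tendsto_L2_of_uniform (max R R' + 1) fun ε hε => ?_
  obtain ⟨η, hη, hmod⟩ := exists_uniform_modulus hc' hs' hε
  filter_upwards [Ioc_mem_nhdsGT (lt_min hη one_pos)] with h hh
  have hh0 : 0 < h := hh.1
  have hhη : h ≤ η := hh.2.trans (min_le_left _ _)
  have hh1 : h ≤ 1 := hh.2.trans (min_le_right _ _)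
  set Ψ := (hc.memLp_two (ν := ν) hs).toLp ψ with hΨ
  have a1 := (measurePreserving_add_right ν (h • e)).quasiMeasurePreserving.ae_eq_comp
    (hc.memLp_two (ν := ν) hs).coeFn_toLp
  have a2 := (measurePreserving_add_right ν (-(h • e))).quasiMeasurePreserving.ae_eq_comp
    (hc.memLp_two (ν := ν) hs).coeFn_toLp
  filter_upwards [
    Lp.coeFn_smul (h⁻¹ ^ 2) (Ψ + Ψ - transL2 ν (h • e) Ψ - transL2 ν (-(h • e)) Ψ),
    Lp.coeFn_sub (Ψ + Ψ - transL2 ν (h • e) Ψ) (transL2 ν (-(h • e)) Ψ),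
    Lp.coeFn_sub (Ψ + Ψ) (transL2 ν (h • e) Ψ), Lp.coeFn_add Ψ Ψ,
    coeFn_transL2 (ν := ν) (h • e) Ψ, coeFn_transL2 (ν := ν) (-(h • e)) Ψ,
    (hc.memLp_two (ν := ν) hs).coeFn_toLp,
    (hc'.memLp_two (ν := ν) hs').coeFn_toLp, a1, a2,
    Lp.coeFn_neg ((hc'.memLp_two (ν := ν) hs').toLp ψ'')] with z h1 h2 h3 h4 h5 h6 h7 h8 h9 h10 h11
  simp only [Function.comp_apply] at h9 h10
  obtain ⟨w, hw, hw'⟩ := exists_second_difference_eq he hd hd' hh0 z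
  rw [negLapL2, h1, Pi.smul_apply, h2, Pi.sub_apply, h3, Pi.sub_apply, h4, Pi.add_apply, h5, h6,
    h11, Pi.neg_apply, hΨ, h7, h8, h9, h10, smul_eq_mul, hw']
  refine ⟨?_, fun hz => ?_⟩
  · rw [neg_sub_neg, abs_sub_comm]; exact hmod z w (hw.trans hhη)
  have hn : ‖z‖ ≤ ‖z + w‖ + ‖w‖ := by simpa using norm_sub_le (z + w) w
  rw [hR' z (by linarith [le_max_right R R']), hR' (z + w) (by linarith [le_max_right R R']),
    sub_self]

end DifferenceQuotients

/-! ### Estimates for real functions of `(t, x¹)`. -/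

/-- `φ` is compactly supported in `(t, x)`, with continuous derivatives
`φ_t = φt`, `φ_x = φ1`, `φ_xx = φ2`. -/
structure HasParabolicDerivs (φ φt φ1 φ2 : ℝ × ℝ → ℝ) : Prop where
  cont : Continuous φ
  cont_t : Continuous φt
  cont_x : Continuous φ1
  cont_xx : Continuous φ2
  supp : HasCompactSupport φ
  supp_t : HasCompactSupport φt
  supp_x : HasCompactSupport φ1
  supp_xx : HasCompactSupport φ2
  deriv_t : ∀ t x, HasDerivAt (fun s => φ (s, x)) (φt (t, x)) t
  deriv_x : ∀ t x, HasDerivAt (fun y => φ (t, y)) (φ1 (t, x)) x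
  deriv_xx : ∀ t x, HasDerivAt (fun y => φ1 (t, y)) (φ2 (t, x)) x

/-- The `L²` norm as a real number. -/
noncomputable def rnorm {α : Type*} [MeasurableSpace α] (ν : Measure α) (f : α → ℝ) : ℝ :=
  (eLpNorm f 2 ν).toReal

section RealNorm

variable {α : Type*} [MeasurableSpace α] {ν : Measure α} {f g : α → ℝ}

theorem rnorm_nonneg : 0 ≤ rnorm ν f := ENNReal.toReal_nonneg

theorem rnorm_eq_norm (hf : MemLp f 2 ν) : rnorm ν f = ‖hf.toLp f‖ := (Lp.norm_toLp f hf).symm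

theorem rnorm_add_le (hf : MemLp f 2 ν) (hg : MemLp g 2 ν) :
    rnorm ν (fun z => f z + g z) ≤ rnorm ν f + rnorm ν g := by
  have h := norm_add_le (hf.toLp f) (hg.toLp g)
  rw [← MemLp.toLp_add] at h
  rwa [rnorm_eq_norm hf, rnorm_eq_norm hg, rnorm_eq_norm (f := fun z => f z + g z) (hf.add hg)]

theorem rnorm_le_mul_of_le (hg : MemLp g 2 ν) {c : ℝ} (hc : 0 ≤ c)
    (h : ∀ z, |f z| ≤ c * |g z|) : rnorm ν f ≤ c * rnorm ν g := by
  have h0 : ∀ᵐ z ∂ν, ‖f z‖ ≤ c * ‖g z‖ := Eventually.of_forall h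
  have h1 := eLpNorm_le_mul_eLpNorm_of_ae_le_mul h0 2
  have h2 := ENNReal.toReal_mono (ENNReal.mul_ne_top ENNReal.ofReal_ne_top hg.2.ne) h1
  rwa [ENNReal.toReal_mul, ENNReal.toReal_ofReal hc] at h2

theorem rnorm_le_of_le (hg : MemLp g 2 ν) (h : ∀ z, |f z| ≤ |g z|) : rnorm ν f ≤ rnorm ν g := by
  have := rnorm_le_mul_of_le hg zero_le_one (f := f) (by simpa using h)
  rwa [one_mul] at this

theorem rnorm_const_mul (c : ℝ) : rnorm ν (fun z => c * f z) = |c| * rnorm ν f := by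
  have := eLpNorm_const_smul (p := 2) (μ := ν) c f
  rw [rnorm, rnorm, show (fun z => c * f z) = c • f from rfl, this]
  simp

end RealNorm

section TimeSpace

variable {φ φt φ1 φ2 : ℝ × ℝ → ℝ}

theorem HasParabolicDerivs.line_t (h : HasParabolicDerivs φ φt φ1 φ2) (z : ℝ × ℝ) (s : ℝ) :
    HasDerivAt (fun s : ℝ => φ (z + s • (1, 0))) (φt (z + s • (1, 0))) s := by
  have := (h.deriv_t (z.1 + s) z.2).comp_const_add z.1 s
  have e : ∀ s : ℝ, z + s • ((1, 0) : ℝ × ℝ) = (z.1 + s, z.2) := fun s => by ext <;> simp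
  simpa only [e] using this

theorem HasParabolicDerivs.line_x (h : HasParabolicDerivs φ φt φ1 φ2) (z : ℝ × ℝ) (s : ℝ) :
    HasDerivAt (fun s : ℝ => φ (z + s • (0, 1))) (φ1 (z + s • (0, 1))) s := by
  have := (h.deriv_x z.1 (z.2 + s)).comp_const_add z.2 s
  have e : ∀ s : ℝ, z + s • ((0, 1) : ℝ × ℝ) = (z.1, z.2 + s) := fun s => by ext <;> simp
  simpa only [e] using this

theorem HasParabolicDerivs.line_xx (h : HasParabolicDerivs φ φt φ1 φ2) (z : ℝ × ℝ) (s : ℝ) :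
    HasDerivAt (fun s : ℝ => φ1 (z + s • (0, 1))) (φ2 (z + s • (0, 1))) s := by
  have := (h.deriv_xx z.1 (z.2 + s)).comp_const_add z.2 s
  have e : ∀ s : ℝ, z + s • ((0, 1) : ℝ × ℝ) = (z.1, z.2 + s) := fun s => by ext <;> simp
  simpa only [e] using this

variable {a : ℝ × ℝ → ℝ} {δ : ℝ}

theorem memLp_coeff_mul {ψ : ℝ × ℝ → ℝ} (ha : AEMeasurable a volume) {C : ℝ} (hC : ∀ z, |a z| ≤ C)
    (hc : Continuous ψ) (hs : HasCompactSupport ψ) : MemLp (fun z => a z * ψ z) 2 volume :=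
  memLp_bounded_mul ha.aestronglyMeasurable hC (hc.memLp_two hs)

/-- Consistency of the scheme on a fixed regular function, with the same mesh `s` in time and space,
that is `τ = s⁻¹` and `σ = s⁻²`. The measurable coefficient is never differenced, so it passes
through as a bounded operator. -/
theorem HasParabolicDerivs.tendsto_discrete (h : HasParabolicDerivs φ φt φ1 φ2) (μ : ℝ)
    (ha : AEMeasurable a volume) {C : ℝ} (hC : ∀ z, |a z| ≤ C) :
    Tendsto (fun s : ℝ => μ • (h.cont.memLp_two h.supp).toLp φ
      - s⁻¹ • (transL2 volume (s • ((1, 0) : ℝ × ℝ)) ((h.cont.memLp_two h.supp).toLp φ)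
        - (h.cont.memLp_two h.supp).toLp φ)
      + mulL2 a ha.aestronglyMeasurable C hC
        (negLapL2 volume (s⁻¹ ^ 2) (s • ((0, 1) : ℝ × ℝ)) ((h.cont.memLp_two h.supp).toLp φ)))
      (𝓝[>] 0) (𝓝 (μ • (h.cont.memLp_two h.supp).toLp φ
        - (h.cont_t.memLp_two h.supp_t).toLp φt
        + mulL2 a ha.aestronglyMeasurable C hC (-(h.cont_xx.memLp_two h.supp_xx).toLp φ2))) := by
  refine (tendsto_const_nhds.sub ?_).add ?_
  · exact tendsto_difference_L2 (by simp [Prod.norm_def]) h.cont h.supp h.cont_t h.supp_t h.line_t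
  · exact ((mulL2 a ha.aestronglyMeasurable C hC).continuous.tendsto _).comp
      (tendsto_second_difference_L2 (by simp [Prod.norm_def]) h.cont h.supp h.cont_xx h.supp_xx
        h.line_x h.line_xx)

theorem HasParabolicDerivs.coeFn_limit (h : HasParabolicDerivs φ φt φ1 φ2) (μ : ℝ)
    (ha : AEMeasurable a volume) {C : ℝ} (hC : ∀ z, |a z| ≤ C) :
    (μ • (h.cont.memLp_two h.supp).toLp φ - (h.cont_t.memLp_two h.supp_t).toLp φt
        + mulL2 a ha.aestronglyMeasurable C hC (-(h.cont_xx.memLp_two h.supp_xx).toLp φ2)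
        : Lp ℝ 2 (volume : Measure (ℝ × ℝ)))
      =ᵐ[volume] fun z => μ * φ z - φt z - a z * φ2 z := by
  set Φ := (h.cont.memLp_two (ν := volume) h.supp).toLp φ
  set Φt := (h.cont_t.memLp_two (ν := volume) h.supp_t).toLp φt
  set Φ2 := (h.cont_xx.memLp_two (ν := volume) h.supp_xx).toLp φ2
  filter_upwards [Lp.coeFn_add (μ • Φ - Φt) (mulL2 a ha.aestronglyMeasurable C hC (-Φ2)),
    Lp.coeFn_sub (μ • Φ) Φt, Lp.coeFn_smul μ Φ, coeFn_mulL2 ha.aestronglyMeasurable hC (-Φ2),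
    Lp.coeFn_neg Φ2, (h.cont.memLp_two (ν := volume) h.supp).coeFn_toLp,
    (h.cont_t.memLp_two (ν := volume) h.supp_t).coeFn_toLp,
    (h.cont_xx.memLp_two (ν := volume) h.supp_xx).coeFn_toLp] with z h1 h2 h3 h4 h5 h6 h7 h8
  rw [h1, Pi.add_apply, h2, Pi.sub_apply, h3, h4, h5, Pi.smul_apply, Pi.neg_apply, h6, h7, h8,
    smul_eq_mul]
  ring

/-- The estimate of `φ_xx` for the operator `φ_t + a φ_xx` in one space dimension. -/
theorem HasParabolicDerivs.rnorm_xx_le (h : HasParabolicDerivs φ φt φ1 φ2)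
    (ha : AEMeasurable a volume) (hδ : ∀ z, δ ≤ a z) {C : ℝ} (hC : ∀ z, |a z| ≤ C) :
    δ * rnorm volume φ2 ≤ rnorm volume (fun z => φt z + a z * φ2 z) := by
  set Φ := (h.cont.memLp_two (ν := volume) h.supp).toLp φ
  have t1 := h.tendsto_discrete 0 ha hC
  have t2 := tendsto_second_difference_L2 (ν := volume) (e := ((0, 1) : ℝ × ℝ))
    (by simp [Prod.norm_def]) h.cont h.supp h.cont_xx h.supp_xx h.line_x h.line_xx
  have key := le_of_tendsto_of_tendsto (t2.norm.const_mul δ) t1.norm (by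
    filter_upwards [self_mem_nhdsWithin] with s hs
    have hs0 : (0 : ℝ) < s := hs
    exact norm_negLapL2_le le_rfl (by positivity) (by positivity) _ _ ha.aestronglyMeasurable
      hδ hC Φ)
  rw [norm_neg, ← rnorm_eq_norm] at key
  refine key.trans_eq ?_
  rw [Lp.norm_def, rnorm]
  congr 1
  rw [eLpNorm_congr_ae (h.coeFn_limit 0 ha hC), ← eLpNorm_neg]
  congr 1
  ext z
  simp only [Pi.neg_apply]; ring

/-- The maximum principle in `L²` form, for the operator `φ_t + a φ_xx - μ φ` in one space
dimension. -/
theorem HasParabolicDerivs.rnorm_le_of_subsolution (h : HasParabolicDerivs φ φt φ1 φ2)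
    (ha : AEMeasurable a volume) (hδ0 : 0 < δ) (hδ : ∀ z, δ ≤ a z) (hC : ∀ z, |a z| ≤ δ⁻¹)
    {μ : ℝ} (hμ : 0 < μ) {F : ℝ × ℝ → ℝ} (hF : MemLp F 2 volume) (hF0 : ∀ z, 0 ≤ F z)
    (hφ : ∀ z, 0 ≤ φ z) (hle : ∀ z, μ * φ z - φt z - a z * φ2 z ≤ F z) :
    μ * rnorm volume φ ≤ (1 + δ⁻¹ ^ 2) * rnorm volume F := by
  set Φ := (h.cont.memLp_two (ν := volume) h.supp).toLp φ with hΦ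
  have t1 := h.tendsto_discrete μ ha hC
  set lim := μ • Φ - (h.cont_t.memLp_two (ν := volume) h.supp_t).toLp φt
        + mulL2 a ha.aestronglyMeasurable δ⁻¹ hC (-(h.cont_xx.memLp_two h.supp_xx).toLp φ2)
    with hlim
  set D : ℝ → Lp ℝ 2 (volume : Measure (ℝ × ℝ)) := fun s : ℝ => μ • Φ
      - s⁻¹ • (transL2 volume (s • ((1, 0) : ℝ × ℝ)) Φ - Φ)
      + mulL2 a ha.aestronglyMeasurable δ⁻¹ hC
        (negLapL2 volume (s⁻¹ ^ 2) (s • ((0, 1) : ℝ × ℝ)) Φ) with hD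
  set G := hF.toLp F with hG
  have hG0 : 0 ≤ G := by
    rw [← Lp.coeFn_nonneg]
    filter_upwards [hF.coeFn_toLp] with z hz
    rw [hz]; exact hF0 z
  have hΦ0 : 0 ≤ Φ := by
    rw [← Lp.coeFn_nonneg]
    filter_upwards [(h.cont.memLp_two (ν := volume) h.supp).coeFn_toLp] with z hz
    rw [hz]; exact hφ z
  have hlimG : lim ≤ G := by
    rw [← Lp.coeFn_le]
    filter_upwards [hF.coeFn_toLp, h.coeFn_limit μ ha hC] with z h1 h2
    rw [h1, h2]; exact hle z
  -- At positive mesh `φ` is a discrete subsolution only up to the consistency error. Adding the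
  -- lattice modulus of that error to the source keeps it nonnegative, and its norm disappears in
  -- the limit.
  have t2 : Tendsto (fun s => G + |D s - lim|) (𝓝[>] 0) (𝓝 G) := by
    have : Tendsto (fun s => |D s - lim|) (𝓝[>] 0) (𝓝 0) := by
      have h0 := tendsto_iff_norm_sub_tendsto_zero.1 t1
      rw [tendsto_zero_iff_norm_tendsto_zero]
      simpa only [norm_abs_eq_norm] using h0
    simpa using tendsto_const_nhds.add this
  have key := le_of_tendsto_of_tendsto (tendsto_const_nhds (x := μ * ‖Φ‖))
    (t2.norm.const_mul (1 + δ⁻¹ ^ 2)) (by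
      filter_upwards [self_mem_nhdsWithin] with s hs
      have hs0 : (0 : ℝ) < s := hs
      refine norm_le_of_discrete_subsolution hδ0 hμ (τ := s⁻¹) (σ := s⁻¹ ^ 2) (by positivity)
        (by positivity) (s • ((1, 0) : ℝ × ℝ)) (s • ((0, 1) : ℝ × ℝ)) ha.aestronglyMeasurable hδ hC
        hΦ0 (add_nonneg hG0 (abs_nonneg _)) ?_
      calc D s = lim + (D s - lim) := by abel
        _ ≤ G + |D s - lim| := add_le_add hlimG (le_abs_self _))
  rwa [rnorm_eq_norm (h.cont.memLp_two h.supp), rnorm_eq_norm hF]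

/-- Interpolation: `‖φ_x‖² ≤ ‖φ_xx‖ ‖φ‖`. -/
theorem HasParabolicDerivs.rnorm_x_sq_le (h : HasParabolicDerivs φ φt φ1 φ2) :
    rnorm volume φ1 ^ 2 ≤ rnorm volume φ2 * rnorm volume φ := by
  have t1 := tendsto_difference_L2 (ν := volume) (e := ((0, 1) : ℝ × ℝ))
    (by simp [Prod.norm_def]) h.cont h.supp h.cont_x h.supp_x h.line_x
  have t2 := tendsto_second_difference_L2 (ν := volume) (e := ((0, 1) : ℝ × ℝ))
    (by simp [Prod.norm_def]) h.cont h.supp h.cont_xx h.supp_xx h.line_x h.line_xx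
  have key := le_of_tendsto_of_tendsto (t1.norm.pow 2) (t2.norm.mul_const _)
    (Eventually.of_forall fun s => norm_difference_sq_le s⁻¹ (s • ((0, 1) : ℝ × ℝ)) _)
  rwa [norm_neg, ← rnorm_eq_norm, ← rnorm_eq_norm, ← rnorm_eq_norm] at key

end TimeSpace

/-! ### Kato's inequality for the modulus of a complex function `p + iq`. -/

section Kato

variable {p pt p1 p2 q qt q1 q2 : ℝ × ℝ → ℝ}

/-- The regularised modulus `√(p² + q² + ε²) - ε`. -/
theorem HasParabolicDerivs.regularizedModulus (hp : HasParabolicDerivs p pt p1 p2)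
    (hq : HasParabolicDerivs q qt q1 q2) {ε : ℝ} (hε : 0 < ε) :
    HasParabolicDerivs (fun z => √(p z ^ 2 + q z ^ 2 + ε ^ 2) - ε)
      (fun z => (p z * pt z + q z * qt z) / √(p z ^ 2 + q z ^ 2 + ε ^ 2))
      (fun z => (p z * p1 z + q z * q1 z) / √(p z ^ 2 + q z ^ 2 + ε ^ 2))
      (fun z => (p1 z ^ 2 + q1 z ^ 2 + p z * p2 z + q z * q2 z) / √(p z ^ 2 + q z ^ 2 + ε ^ 2)
        - (p z * p1 z + q z * q1 z) ^ 2 / √(p z ^ 2 + q z ^ 2 + ε ^ 2) ^ 3) := by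
  have hpos : ∀ z, 0 < p z ^ 2 + q z ^ 2 + ε ^ 2 := fun z => by positivity
  have hR : ∀ z, √(p z ^ 2 + q z ^ 2 + ε ^ 2) ≠ 0 := fun z => (Real.sqrt_pos.2 (hpos z)).ne'
  have hcp := hp.cont
  have hcq := hq.cont
  have hcp1 := hp.cont_x
  have hcq1 := hq.cont_x
  have hcpt := hp.cont_t
  have hcqt := hq.cont_t
  have hcp2 := hp.cont_xx
  have hcq2 := hq.cont_xx
  -- The second derivatives `p2`, `q2` occur only multiplied by `p`, `q`, so their supports are not
  -- needed. Subtracting `ε` is what makes the regularised modulus itself vanish outside this set.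
  have hS : IsCompact (tsupport p ∪ tsupport q ∪ (tsupport p1 ∪ tsupport q1)) :=
    (hp.supp.isCompact.union hq.supp.isCompact).union
      (hp.supp_x.isCompact.union hq.supp_x.isCompact)
  have hz : ∀ z, z ∉ tsupport p ∪ tsupport q ∪ (tsupport p1 ∪ tsupport q1) →
      p z = 0 ∧ q z = 0 ∧ p1 z = 0 ∧ q1 z = 0 := fun z hz => by
    simp only [Set.mem_union, not_or] at hz
    exact ⟨image_eq_zero_of_notMem_tsupport hz.1.1, image_eq_zero_of_notMem_tsupport hz.1.2,
      image_eq_zero_of_notMem_tsupport hz.2.1, image_eq_zero_of_notMem_tsupport hz.2.2⟩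
  have hsqrt : ∀ {f g : ℝ → ℝ} {f' g' s : ℝ}, HasDerivAt f f' s → HasDerivAt g g' s →
      HasDerivAt (fun s => √(f s ^ 2 + g s ^ 2 + ε ^ 2))
        ((f s * f' + g s * g') / √(f s ^ 2 + g s ^ 2 + ε ^ 2)) s := by
    intro f g f' g' s hf hg
    have h1 : HasDerivAt (fun s => f s ^ 2 + g s ^ 2 + ε ^ 2)
        (2 * f s * f' + 2 * g s * g') s := by
      have := ((hf.pow 2).add (hg.pow 2)).add_const (ε ^ 2)
      simpa using this
    have h0 : 0 < f s ^ 2 + g s ^ 2 + ε ^ 2 := by positivity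
    convert h1.sqrt h0.ne' using 1
    have := (Real.sqrt_pos.2 h0).ne'
    field_simp
  refine ⟨by fun_prop, ?_, ?_, ?_, ?_, ?_, ?_, ?_, ?_, ?_, ?_⟩
  · exact Continuous.div (by fun_prop) (by fun_prop) hR
  · exact Continuous.div (by fun_prop) (by fun_prop) hR
  · exact (Continuous.div (by fun_prop) (by fun_prop) hR).sub
      (Continuous.div (by fun_prop) (by fun_prop) fun z => pow_ne_zero 3 (hR z))
  · refine HasCompactSupport.intro hS fun z h => ?_
    obtain ⟨h1, h2, -, -⟩ := hz z h
    simp [h1, h2, Real.sqrt_sq hε.le]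
  · refine HasCompactSupport.intro hS fun z h => ?_
    obtain ⟨h1, h2, -, -⟩ := hz z h
    simp [h1, h2]
  · refine HasCompactSupport.intro hS fun z h => ?_
    obtain ⟨h1, h2, -, -⟩ := hz z h
    simp [h1, h2]
  · refine HasCompactSupport.intro hS fun z h => ?_
    obtain ⟨h1, h2, h3, h4⟩ := hz z h
    simp [h1, h2, h3, h4]
  · intro t x
    exact (hsqrt (hp.deriv_t t x) (hq.deriv_t t x)).sub_const ε
  · intro t x
    exact (hsqrt (hp.deriv_x t x) (hq.deriv_x t x)).sub_const ε
  · intro t x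
    have h1 := hsqrt (hp.deriv_x t x) (hq.deriv_x t x)
    have h2 := ((hp.deriv_x t x).mul (hp.deriv_xx t x)).add
      ((hq.deriv_x t x).mul (hq.deriv_xx t x))
    refine (h2.div h1 (hR (t, x))).congr_deriv ?_
    have := hR (t, x)
    simp only [Pi.add_apply, Pi.mul_apply]
    field_simp
    ring

/-- Kato's inequality for the regularised modulus, pointwise. -/
theorem kato_pointwise {δ κ lam ε a β γ p pt p1 p2 q qt q1 q2 fr fi : ℝ} (hδ : 0 < δ)
    (hlam : 0 ≤ lam) (hε : 0 < ε) (ha : δ ≤ a)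
    (hell : ∀ θ : ℝ, δ * (θ ^ 2 + κ ^ 2) ≤ a * θ ^ 2 + 2 * β * θ + γ)
    (hfr : fr = pt + a * p2 - 2 * β * q1 - (γ + lam) * p)
    (hfi : fi = qt + a * q2 + 2 * β * p1 - (γ + lam) * q) :
    (δ * κ ^ 2 + lam) * (√(p ^ 2 + q ^ 2 + ε ^ 2) - ε)
        - (p * pt + q * qt) / √(p ^ 2 + q ^ 2 + ε ^ 2)
        - a * ((p1 ^ 2 + q1 ^ 2 + p * p2 + q * q2) / √(p ^ 2 + q ^ 2 + ε ^ 2)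
          - (p * p1 + q * q1) ^ 2 / √(p ^ 2 + q ^ 2 + ε ^ 2) ^ 3) ≤ |fr| + |fi| := by
  have h0 : 0 < p ^ 2 + q ^ 2 + ε ^ 2 := by positivity
  set R := √(p ^ 2 + q ^ 2 + ε ^ 2) with hR
  have hR0 : 0 < R := Real.sqrt_pos.2 h0
  have hR2 : R ^ 2 = p ^ 2 + q ^ 2 + ε ^ 2 := Real.sq_sqrt h0.le
  have hRε : ε ≤ R := Real.le_sqrt_of_sq_le (by nlinarith [sq_nonneg p, sq_nonneg q])
  have hRp : |p| ≤ R := Real.abs_le_sqrt (by nlinarith [sq_nonneg ε, sq_nonneg q])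
  have hRq : |q| ≤ R := Real.abs_le_sqrt (by nlinarith [sq_nonneg ε, sq_nonneg p])
  -- With `v = p + iq`, the gradient splits into `Re(v̄ v_x)` and `Im(v̄ v_x)`. The second
  -- derivative of the modulus removes the real part, and the imaginary part is left to compensate
  -- the `β` term.
  have hquad : δ * κ ^ 2 * (p ^ 2 + q ^ 2) ≤ a * (p1 ^ 2 + q1 ^ 2)
      - a * ((p * p1 + q * q1) ^ 2 / R ^ 2) + 2 * β * (p * q1 - q * p1) + γ * (p ^ 2 + q ^ 2) := by
    have ha0 : 0 ≤ a := hδ.le.trans ha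
    rcases (add_nonneg (sq_nonneg p) (sq_nonneg q)).eq_or_lt with hm | hm
    · have hp : p = 0 := by nlinarith [sq_nonneg p, sq_nonneg q]
      have hq : q = 0 := by nlinarith [sq_nonneg p, sq_nonneg q]
      subst hp hq
      have : 0 ≤ a * (p1 ^ 2 + q1 ^ 2) := by positivity
      simpa using this
    · set m := p ^ 2 + q ^ 2 with hmdef
      have e1 : (p * p1 + q * q1) ^ 2 / R ^ 2 ≤ (p * p1 + q * q1) ^ 2 / m := by
        apply div_le_div_of_nonneg_left (sq_nonneg _) hm
        rw [hR2]; nlinarith [sq_nonneg ε]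
      have e2 : (p * q1 - q * p1) ^ 2 / m = p1 ^ 2 + q1 ^ 2 - (p * p1 + q * q1) ^ 2 / m := by
        field_simp; rw [hmdef]; ring
      -- Ellipticity is used at `θ = Im(v̄ v_x)/|v|²`, which is `(p q_x - q p_x)/m`.
      have e3 := mul_le_mul_of_nonneg_left (hell ((p * q1 - q * p1) / m)) hm.le
      have e4 : m * (a * ((p * q1 - q * p1) / m) ^ 2 + 2 * β * ((p * q1 - q * p1) / m) + γ)
          = a * ((p * q1 - q * p1) ^ 2 / m) + 2 * β * (p * q1 - q * p1) + γ * m := by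
        field_simp
      have e5 : 0 ≤ m * (δ * ((p * q1 - q * p1) / m) ^ 2) := by positivity
      rw [e4, e2] at e3
      have e6 := mul_le_mul_of_nonneg_left e1 ha0
      linarith
  have hfp : -(p * fr + q * fi) ≤ R * (|fr| + |fi|) := by
    have h1 : -(p * fr) ≤ R * |fr| := by
      calc -(p * fr) ≤ |p * fr| := neg_le_abs _
        _ = |p| * |fr| := abs_mul _ _
        _ ≤ R * |fr| := by gcongr
    have h2 : -(q * fi) ≤ R * |fi| := by
      calc -(q * fi) ≤ |q * fi| := neg_le_abs _
        _ = |q| * |fi| := abs_mul _ _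
        _ ≤ R * |fi| := by gcongr
    linarith
  have hμ : 0 ≤ δ * κ ^ 2 + lam := by positivity
  -- Since `R² - εR = |v|² + (ε² - εR)`, the regularisation only lowers the zeroth order term.
  have hlast : (δ * κ ^ 2 + lam) * (ε ^ 2 - ε * R) ≤ 0 := by
    apply mul_nonpos_of_nonneg_of_nonpos hμ
    nlinarith
  refine le_of_mul_le_mul_left ?_ hR0
  have e : R * ((δ * κ ^ 2 + lam) * (R - ε) - (p * pt + q * qt) / R
      - a * ((p1 ^ 2 + q1 ^ 2 + p * p2 + q * q2) / R - (p * p1 + q * q1) ^ 2 / R ^ 3))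
      = (δ * κ ^ 2 + lam) * (R ^ 2 - ε * R) - (p * pt + q * qt)
        - a * (p1 ^ 2 + q1 ^ 2 + p * p2 + q * q2) + a * ((p * p1 + q * q1) ^ 2 / R ^ 2) := by
    field_simp; ring
  rw [e]
  refine le_trans ?_ hfp
  rw [hR2, hfr, hfi]
  rw [hR2] at hquad
  linarith

end Kato

/-! ### The zeroth order bound at a fixed frequency. -/

/-- The coefficients `a`, `β`, `γ` of the operator
`v ↦ v_t + a v_xx + 2 i β v_x - γ v` obtained from a uniformly elliptic operator at a frequency of
modulus `κ`. -/
structure IsFrequencyCoeff (δ κ : ℝ) (a β γ : ℝ × ℝ → ℝ) : Prop where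
  meas_a : AEMeasurable a volume
  meas_β : AEMeasurable β volume
  meas_γ : AEMeasurable γ volume
  lower_a : ∀ z, δ ≤ a z
  upper_a : ∀ z, |a z| ≤ δ⁻¹
  bound_β : ∀ z, |β z| ≤ δ⁻¹ * κ
  bound_γ : ∀ z, |γ z| ≤ δ⁻¹ * κ ^ 2
  ell : ∀ z (θ : ℝ), δ * (θ ^ 2 + κ ^ 2) ≤ a z * θ ^ 2 + 2 * β z * θ + γ z

section Frequency

variable {p pt p1 p2 q qt q1 q2 : ℝ × ℝ → ℝ} {δ κ lam : ℝ} {a β γ : ℝ × ℝ → ℝ}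

/-- The free factor `s` serves both parts of the complex equation: `-2` for the real part and, with
`p` and `q` exchanged, `2` for the imaginary part. -/
theorem IsFrequencyCoeff.memLp_source (hc : IsFrequencyCoeff δ κ a β γ)
    (hp : HasParabolicDerivs p pt p1 p2) (hq : HasParabolicDerivs q qt q1 q2) (s : ℝ) :
    MemLp (fun z => pt z + a z * p2 z + s * β z * q1 z - (γ z + lam) * p z) 2 volume := by
  have h1 : MemLp pt 2 (volume : Measure (ℝ × ℝ)) := hp.cont_t.memLp_two hp.supp_t
  have h2 := memLp_coeff_mul hc.meas_a hc.upper_a hp.cont_xx hp.supp_xx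
  have h3 := (memLp_coeff_mul hc.meas_β hc.bound_β hq.cont_x hq.supp_x).const_mul s
  have h4 := memLp_coeff_mul hc.meas_γ hc.bound_γ hp.cont hp.supp
  have h5 : MemLp p 2 (volume : Measure (ℝ × ℝ)) := hp.cont.memLp_two hp.supp
  convert (((h1.add h2).add h3).sub h4).sub (h5.const_mul lam) using 1
  ext z
  simp only [Pi.add_apply, Pi.sub_apply]
  ring

/-- The decisive `L²` bound at a fixed frequency. -/
theorem IsFrequencyCoeff.mul_rnorm_le (hc : IsFrequencyCoeff δ κ a β γ) (hδ : 0 < δ)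
    (hlam : 0 ≤ lam) (hp : HasParabolicDerivs p pt p1 p2) (hq : HasParabolicDerivs q qt q1 q2)
    {fr fi : ℝ × ℝ → ℝ} (hfr : ∀ z, fr z = pt z + a z * p2 z - 2 * β z * q1 z - (γ z + lam) * p z)
    (hfi : ∀ z, fi z = qt z + a z * q2 z + 2 * β z * p1 z - (γ z + lam) * q z)
    (hfrL : MemLp fr 2 volume) (hfiL : MemLp fi 2 volume) :
    (δ * κ ^ 2 + lam) * rnorm volume (fun z => √(p z ^ 2 + q z ^ 2)) ≤
      (1 + δ⁻¹ ^ 2) * (rnorm volume fr + rnorm volume fi) := by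
  have hμ : 0 ≤ δ * κ ^ 2 + lam := by positivity
  -- The subsolution estimate needs a positive zeroth order coefficient; when it vanishes the claim
  -- is trivial.
  rcases hμ.eq_or_lt with h0 | hμ0
  · rw [← h0, zero_mul]
    have := rnorm_nonneg (ν := volume) (f := fr)
    have := rnorm_nonneg (ν := volume) (f := fi)
    positivity
  set S := tsupport p ∪ tsupport q with hS
  have hSc : IsCompact S := hp.supp.isCompact.union hq.supp.isCompact
  set χ : ℝ × ℝ → ℝ := S.indicator fun _ => 1 with hχ
  have hχL : MemLp χ 2 volume :=
    memLp_indicator_const 2 hSc.measurableSet 1 (Or.inr hSc.measure_ne_top)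
  have hFL : MemLp (fun z => |fr z| + |fi z|) 2 volume := hfrL.abs.add hfiL.abs
  have hFle : rnorm volume (fun z => |fr z| + |fi z|) ≤ rnorm volume fr + rnorm volume fi := by
    refine (rnorm_add_le hfrL.abs hfiL.abs).trans (add_le_add ?_ ?_)
    · exact rnorm_le_of_le hfrL (by simp)
    · exact rnorm_le_of_le hfiL (by simp)
  have hz : ∀ z, z ∉ S → p z = 0 ∧ q z = 0 := fun z hz => by
    simp only [hS, Set.mem_union, not_or] at hz
    exact ⟨image_eq_zero_of_notMem_tsupport hz.1, image_eq_zero_of_notMem_tsupport hz.2⟩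
  -- The regularised modulus misses `|v|` by at most `ε`, and only on the compact set `S`, hence the
  -- error `ε ‖χ‖`, which vanishes as `ε → 0`.
  have main : ∀ ε > 0, (δ * κ ^ 2 + lam) * rnorm volume (fun z => √(p z ^ 2 + q z ^ 2)) ≤
      (1 + δ⁻¹ ^ 2) * (rnorm volume fr + rnorm volume fi)
        + (δ * κ ^ 2 + lam) * (ε * rnorm volume χ) := by
    intro ε hε
    have hφ := hp.regularizedModulus hq hε
    set φ := fun z => √(p z ^ 2 + q z ^ 2 + ε ^ 2) - ε with hφdef
    have hφ0 : ∀ z, 0 ≤ φ z := fun z => sub_nonneg.2 <|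
      Real.le_sqrt_of_sq_le (by nlinarith [sq_nonneg (p z), sq_nonneg (q z)])
    have h1 := hφ.rnorm_le_of_subsolution hc.meas_a hδ hc.lower_a hc.upper_a hμ0 hFL
      (fun z => by positivity) hφ0 (fun z =>
        kato_pointwise hδ hlam hε (hc.lower_a z) (hc.ell z) (hfr z) (hfi z))
    have hφL : MemLp φ 2 volume := hφ.cont.memLp_two hφ.supp
    have h2 : rnorm volume (fun z => √(p z ^ 2 + q z ^ 2)) ≤
        rnorm volume φ + ε * rnorm volume χ := by
      have h3 := rnorm_add_le hφL (hχL.const_mul ε)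
      rw [rnorm_const_mul, abs_of_pos hε] at h3
      refine le_trans (rnorm_le_of_le (hφL.add (hχL.const_mul ε)) fun z => ?_) h3
      rw [Pi.add_apply]
      by_cases hzS : z ∈ S
      · have hχz : χ z = 1 := Set.indicator_of_mem hzS _
        rw [hχz, mul_one, hφdef, sub_add_cancel, abs_of_nonneg (Real.sqrt_nonneg _),
          abs_of_nonneg (Real.sqrt_nonneg _)]
        exact Real.sqrt_le_sqrt (by nlinarith [sq_nonneg ε])
      · obtain ⟨e1, e2⟩ := hz z hzS
        rw [e1, e2]; simp
    calc (δ * κ ^ 2 + lam) * rnorm volume (fun z => √(p z ^ 2 + q z ^ 2))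
        ≤ (δ * κ ^ 2 + lam) * (rnorm volume φ + ε * rnorm volume χ) := by gcongr
      _ = (δ * κ ^ 2 + lam) * rnorm volume φ + (δ * κ ^ 2 + lam) * (ε * rnorm volume χ) := by ring
      _ ≤ _ := by
        refine add_le_add_left (h1.trans ?_) _
        gcongr
  have hlim : Tendsto (fun ε : ℝ => (1 + δ⁻¹ ^ 2) * (rnorm volume fr + rnorm volume fi)
        + (δ * κ ^ 2 + lam) * (ε * rnorm volume χ)) (𝓝[>] 0)
      (𝓝 ((1 + δ⁻¹ ^ 2) * (rnorm volume fr + rnorm volume fi)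
        + (δ * κ ^ 2 + lam) * (0 * rnorm volume χ))) := by
    refine tendsto_nhdsWithin_of_tendsto_nhds (Continuous.tendsto ?_ 0)
    fun_prop
  rw [zero_mul, mul_zero, add_zero] at hlim
  exact ge_of_tendsto hlim (by filter_upwards [self_mem_nhdsWithin] with ε hε using main ε hε)

end Frequency

/-! ### From the zeroth order bound to all derivatives at a fixed frequency. -/

theorem le_of_sq_le_sq_of_nonneg {x y : ℝ} (hy : 0 ≤ y) (h : x ^ 2 ≤ y ^ 2) : x ≤ y :=
  le_of_abs_le (by have := sq_le_sq.1 h; rwa [abs_of_nonneg hy] at this)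

/-- The algebra that turns the bound of the zeroth order terms into a bound of all terms. -/
theorem absorb_bounds {δ D κ s X0 X1 X2 Xt Φ F : ℝ} (hδ : 0 < δ) (hD : 0 ≤ D)
    (hX2 : 0 ≤ X2) (hΦ : 0 ≤ Φ) (hκX : 0 ≤ κ ^ 2 * X0)
    (hκ : κ ^ 2 * X0 ≤ D * Φ) (hs : s ^ 2 * X0 ≤ D * Φ)
    (hF : δ * X2 ≤ F) (hF' : F ≤ Φ + 2 * δ⁻¹ * (κ * X1) + δ⁻¹ * (κ ^ 2 * X0) + s ^ 2 * X0)
    (hX1 : X1 ^ 2 ≤ 2 * (X2 * X0)) (hXt : Xt ≤ F + δ⁻¹ * X2) {C₁ C₂ : ℝ}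
    (hC₁ : C₁ = 2 * δ⁻¹ * (1 + 4 * δ⁻¹ ^ 3 * D + δ⁻¹ * D + D) + D)
    (hC₂ : C₂ = 1 + 2 * δ⁻¹ * C₁ + δ⁻¹ * D + D + δ⁻¹ * C₁) :
    X2 ≤ C₁ * Φ ∧ κ * X1 ≤ C₁ * Φ ∧ s * X1 ≤ C₁ * Φ ∧ s * κ * X0 ≤ D * Φ ∧ Xt ≤ C₂ * Φ := by
  set e := δ⁻¹ with he
  have he0 : 0 < e := by positivity
  have hde : δ * e = 1 := mul_inv_cancel₀ hδ.ne'
  -- Interpolation with a weight; it is used for `r = κ` and `r = s`, where `s` plays the role of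
  -- `√λ`.
  have hY : ∀ r : ℝ, r ^ 2 * X0 ≤ D * Φ → (r * X1) ^ 2 ≤ 2 * X2 * (D * Φ) := fun r hr => by
    calc (r * X1) ^ 2 = r ^ 2 * X1 ^ 2 := by ring
      _ ≤ r ^ 2 * (2 * (X2 * X0)) := by gcongr
      _ = 2 * X2 * (r ^ 2 * X0) := by ring
      _ ≤ _ := by gcongr
  have hDΦ : 0 ≤ D * Φ := mul_nonneg hD hΦ
  -- The only first order term is split by the arithmetic–geometric inequality so that half of `δ
  -- X2` absorbs it.
  have h1 : 2 * e * (κ * X1) ≤ δ / 2 * X2 + 4 * e ^ 3 * (D * Φ) := by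
    apply le_of_sq_le_sq_of_nonneg (by positivity)
    have h2 : (2 * e * (κ * X1)) ^ 2 ≤ 4 * e ^ 2 * (2 * X2 * (D * Φ)) := by
      calc (2 * e * (κ * X1)) ^ 2 = 4 * e ^ 2 * (κ * X1) ^ 2 := by ring
        _ ≤ _ := by gcongr; exact hY κ hκ
    have h3 : 4 * (δ / 2 * X2) * (4 * e ^ 3 * (D * Φ)) = 4 * e ^ 2 * (2 * X2 * (D * Φ)) := by
      calc _ = 8 * (δ * e) * e ^ 2 * X2 * (D * Φ) := by ring
        _ = _ := by rw [hde]; ring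
    nlinarith [sq_nonneg (δ / 2 * X2 - 4 * e ^ 3 * (D * Φ))]
  have h2 : δ / 2 * X2 ≤ (1 + 4 * e ^ 3 * D + e * D + D) * Φ := by
    have := mul_le_mul_of_nonneg_left hκ he0.le
    linarith
  have h3 : X2 ≤ (C₁ - D) * Φ := by
    have := mul_le_mul_of_nonneg_left h2 (show 0 ≤ 2 * e by positivity)
    have e1 : 2 * e * (δ / 2 * X2) = (δ * e) * X2 := by ring
    rw [e1, hde, one_mul] at this
    rw [hC₁]; linarith
  have hC₁D : 0 ≤ C₁ - D := by rw [hC₁, add_sub_cancel_right]; positivity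
  -- The summand `D` in `C₁` serves here: `X2` is bounded with `C₁ - D`, and `2 (C₁ - D) D ≤ C₁²`.
  have h4 : ∀ r : ℝ, r ^ 2 * X0 ≤ D * Φ → r * X1 ≤ C₁ * Φ := fun r hr => by
    apply le_of_sq_le_sq_of_nonneg (mul_nonneg (by linarith) hΦ)
    calc (r * X1) ^ 2 ≤ 2 * X2 * (D * Φ) := hY r hr
      _ ≤ 2 * ((C₁ - D) * Φ) * (D * Φ) := by gcongr
      _ ≤ (C₁ * Φ) ^ 2 := by
        have : 0 ≤ ((C₁ - D) ^ 2 + D ^ 2) * Φ ^ 2 := by positivity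
        nlinarith
  have h5 := h4 κ hκ
  refine ⟨h3.trans (mul_le_mul_of_nonneg_right (by linarith) hΦ), h5, h4 s hs, ?_, ?_⟩
  · apply le_of_sq_le_sq_of_nonneg hDΦ
    calc (s * κ * X0) ^ 2 = (s ^ 2 * X0) * (κ ^ 2 * X0) := by ring
      _ ≤ (D * Φ) * (D * Φ) := by gcongr
      _ = _ := by ring
  · have h6 := mul_le_mul_of_nonneg_left h5 (show 0 ≤ 2 * e by positivity)
    have h7 := mul_le_mul_of_nonneg_left hκ he0.le
    have h8 : e * X2 ≤ e * (C₁ * Φ) := by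
      gcongr; exact h3.trans (mul_le_mul_of_nonneg_right (by linarith) hΦ)
    rw [hC₂]; linarith

theorem sq_add_sq_le_of_add_le {x y b : ℝ} (hx : 0 ≤ x) (hy : 0 ≤ y) (h : x + y ≤ b) :
    x ^ 2 + y ^ 2 ≤ b ^ 2 := by
  have h1 : (x + y) ^ 2 ≤ b ^ 2 := pow_le_pow_left₀ (add_nonneg hx hy) h 2
  nlinarith [mul_nonneg hx hy]

theorem add_sq_le_two_mul (x y : ℝ) : (x + y) ^ 2 ≤ 2 * (x ^ 2 + y ^ 2) := by
  nlinarith [sq_nonneg (x - y)]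

theorem rnorm_sub_le {α : Type*} [MeasurableSpace α] {ν : Measure α} {f g : α → ℝ}
    (hf : MemLp f 2 ν) (hg : MemLp g 2 ν) :
    rnorm ν (fun z => f z - g z) ≤ rnorm ν f + rnorm ν g := by
  have h := rnorm_add_le hf hg.neg
  rw [show rnorm ν (-g) = rnorm ν g from congrArg ENNReal.toReal (eLpNorm_neg g 2 ν)] at h
  simpa only [Pi.neg_apply, ← sub_eq_add_neg] using h

set_option maxHeartbeats 1000000 in
/-- The full estimate at a fixed frequency. -/
theorem exists_frequency_estimate {δ : ℝ} (hδ : 0 < δ) : ∃ C : ℝ, 0 ≤ C ∧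
    ∀ (κ lam : ℝ) (a β γ : ℝ × ℝ → ℝ), 0 ≤ κ → 0 ≤ lam → IsFrequencyCoeff δ κ a β γ →
    ∀ p pt p1 p2 q qt q1 q2 fr fi : ℝ × ℝ → ℝ, HasParabolicDerivs p pt p1 p2 →
    HasParabolicDerivs q qt q1 q2 →
    (∀ z, fr z = pt z + a z * p2 z - 2 * β z * q1 z - (γ z + lam) * p z) →
    (∀ z, fi z = qt z + a z * q2 z + 2 * β z * p1 z - (γ z + lam) * q z) →
    (rnorm volume pt ^ 2 + rnorm volume qt ^ 2) + (rnorm volume p2 ^ 2 + rnorm volume q2 ^ 2)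
      + 2 * (κ ^ 2 * (rnorm volume p1 ^ 2 + rnorm volume q1 ^ 2))
      + κ ^ 2 * (κ ^ 2 * (rnorm volume p ^ 2 + rnorm volume q ^ 2))
      + lam * (rnorm volume p1 ^ 2 + rnorm volume q1 ^ 2)
      + lam * (κ ^ 2 * (rnorm volume p ^ 2 + rnorm volume q ^ 2))
      + lam ^ 2 * (rnorm volume p ^ 2 + rnorm volume q ^ 2)
      ≤ C * (rnorm volume fr ^ 2 + rnorm volume fi ^ 2) := by
  -- The factor `2` comes from `‖p‖ + ‖q‖ ≤ 2 ‖v‖`. The term `δ⁻¹` serves the bound of `κ²‖v‖`, and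
  -- the term `1` that of `λ‖v‖`.
  set D : ℝ := 2 * (1 + δ⁻¹ ^ 2) * (δ⁻¹ + 1) with hD
  have hD0 : 0 ≤ D := by positivity
  set C₁ : ℝ := 2 * δ⁻¹ * (1 + 4 * δ⁻¹ ^ 3 * D + δ⁻¹ * D + D) + D with hC₁
  set C₂ : ℝ := 1 + 2 * δ⁻¹ * C₁ + δ⁻¹ * D + D + δ⁻¹ * C₁ with hC₂
  have hC₁0 : 0 ≤ C₁ := by positivity
  have hC₂0 : 0 ≤ C₂ := by positivity
  -- One `C₂²` for the time derivative; four `C₁²` for `v_xx`, twice `κ v_x`, and `√λ v_x`; three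
  -- `D²` for `κ² v`, `√λ κ v` and `λ v`. The outer `2` comes from squaring `‖fr‖ + ‖fi‖`.
  refine ⟨2 * (C₂ ^ 2 + 4 * C₁ ^ 2 + 3 * D ^ 2), by positivity, ?_⟩
  intro κ lam a β γ hκ hlam hc p pt p1 p2 q qt q1 q2 fr fi hp hq hfr hfi
  have hfrL : MemLp fr 2 (volume : Measure (ℝ × ℝ)) := by
    convert hc.memLp_source hp hq (-2) (lam := lam) using 1
    ext z; rw [hfr]; ring
  have hfiL : MemLp fi 2 (volume : Measure (ℝ × ℝ)) := by
    convert hc.memLp_source hq hp 2 (lam := lam) using 1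
    ext z; rw [hfi]
  have L : ∀ {ψ : ℝ × ℝ → ℝ}, Continuous ψ → HasCompactSupport ψ → MemLp ψ 2 volume :=
    fun h h' => h.memLp_two h'
  have hn : ∀ ψ : ℝ × ℝ → ℝ, 0 ≤ rnorm volume ψ := fun _ => rnorm_nonneg
  have h0 := hc.mul_rnorm_le hδ hlam hp hq hfr hfi hfrL hfiL
  have hmod : MemLp (fun z => √(p z ^ 2 + q z ^ 2)) 2 (volume : Measure (ℝ × ℝ)) := by
    refine (Continuous.memLp_two ?_ ?_)
    · have := hp.cont; have := hq.cont; fun_prop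
    · refine HasCompactSupport.intro (hp.supp.isCompact.union hq.supp.isCompact) fun z hz => ?_
      simp only [Set.mem_union, not_or] at hz
      rw [image_eq_zero_of_notMem_tsupport hz.1, image_eq_zero_of_notMem_tsupport hz.2]
      simp
  have hpm : rnorm volume p ≤ rnorm volume (fun z => √(p z ^ 2 + q z ^ 2)) :=
    rnorm_le_of_le hmod fun z => by
      rw [abs_of_nonneg (Real.sqrt_nonneg _)]
      exact Real.abs_le_sqrt (by nlinarith [sq_nonneg (q z)])
  have hqm : rnorm volume q ≤ rnorm volume (fun z => √(p z ^ 2 + q z ^ 2)) :=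
    rnorm_le_of_le hmod fun z => by
      rw [abs_of_nonneg (Real.sqrt_nonneg _)]
      exact Real.abs_le_sqrt (by nlinarith [sq_nonneg (p z)])
  set M := rnorm volume (fun z => √(p z ^ 2 + q z ^ 2)) with hM
  have hM0 : 0 ≤ M := hn _
  set Φ := rnorm volume fr + rnorm volume fi with hΦ
  have hΦ0 : 0 ≤ Φ := add_nonneg (hn _) (hn _)
  set X0 := rnorm volume p + rnorm volume q with hX0
  set X1 := rnorm volume p1 + rnorm volume q1 with hX1
  set X2 := rnorm volume p2 + rnorm volume q2 with hX2
  set Xt := rnorm volume pt + rnorm volume qt with hXt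
  have hX00 : 0 ≤ X0 := add_nonneg (hn _) (hn _)
  have hX10 : 0 ≤ X1 := add_nonneg (hn _) (hn _)
  have hX20 : 0 ≤ X2 := add_nonneg (hn _) (hn _)
  have hXt0 : 0 ≤ Xt := add_nonneg (hn _) (hn _)
  have hXM : X0 ≤ 2 * M := by linarith
  have hde : δ⁻¹ * δ = 1 := inv_mul_cancel₀ hδ.ne'
  have hi0 : 0 < δ⁻¹ := by positivity
  have hk2 : 0 ≤ κ ^ 2 * M := by positivity
  have hl2 : 0 ≤ lam * M := by positivity
  have hbase : 0 ≤ (1 + δ⁻¹ ^ 2) * Φ := by positivity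
  have ha1 : κ ^ 2 * X0 ≤ D * Φ := by
    have h1 : δ * (κ ^ 2 * M) ≤ (1 + δ⁻¹ ^ 2) * Φ := by linarith
    have h2 := mul_le_mul_of_nonneg_left h1 hi0.le
    rw [← mul_assoc, hde, one_mul] at h2
    calc κ ^ 2 * X0 ≤ κ ^ 2 * (2 * M) := by gcongr
      _ = 2 * (κ ^ 2 * M) := by ring
      _ ≤ 2 * (δ⁻¹ * ((1 + δ⁻¹ ^ 2) * Φ)) := by gcongr
      _ ≤ D * Φ := by rw [hD]; linarith
  have ha2 : lam * X0 ≤ D * Φ := by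
    have h3 : 0 ≤ δ * (κ ^ 2 * M) := by positivity
    have h1 : lam * M ≤ (1 + δ⁻¹ ^ 2) * Φ := by linarith
    have h4 : 0 ≤ δ⁻¹ * ((1 + δ⁻¹ ^ 2) * Φ) := by positivity
    calc lam * X0 ≤ lam * (2 * M) := by gcongr
      _ = 2 * (lam * M) := by ring
      _ ≤ 2 * ((1 + δ⁻¹ ^ 2) * Φ) := by gcongr
      _ ≤ D * Φ := by rw [hD]; linarith
  -- The principal part `g_t + a g_xx` equals the source minus lower order terms, which are bounded
  -- through `|β| ≤ δ⁻¹κ` and `|γ| ≤ δ⁻¹κ²`.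
  have hFbound : ∀ (s : ℝ), |s| = 2 → ∀ (g gt g2 r1 f : ℝ × ℝ → ℝ), MemLp g 2 volume →
      MemLp r1 2 volume → MemLp f 2 volume →
      (∀ z, f z = gt z + a z * g2 z + s * β z * r1 z - (γ z + lam) * g z) →
      rnorm volume (fun z => gt z + a z * g2 z) ≤ rnorm volume f
        + 2 * δ⁻¹ * κ * rnorm volume r1 + (δ⁻¹ * κ ^ 2 + lam) * rnorm volume g := by
    intro s hs g gt g2 r1 f hg hr1 hf hfe
    have m1 : MemLp (fun z => s * β z * r1 z) 2 volume := by
      have := (memLp_bounded_mul hc.meas_β.aestronglyMeasurable hc.bound_β hr1).const_mul s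
      simpa only [mul_assoc] using this
    have m2 : MemLp (fun z => (γ z + lam) * g z) 2 volume := by
      have := (memLp_bounded_mul hc.meas_γ.aestronglyMeasurable hc.bound_γ hg).add
        (hg.const_mul lam)
      convert this using 1
      ext z; simp [add_mul]
    have e1 : (fun z => gt z + a z * g2 z)
        = fun z => (f z - s * β z * r1 z) + (γ z + lam) * g z := by
      ext z; rw [hfe]; ring
    rw [e1]
    refine (rnorm_add_le (hf.sub m1) m2).trans (add_le_add ?_ ?_)
    · refine (rnorm_sub_le hf m1).trans (add_le_add le_rfl ?_)
      refine rnorm_le_mul_of_le hr1 (by positivity) fun z => ?_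
      rw [abs_mul, abs_mul, hs]
      refine mul_le_mul_of_nonneg_right ?_ (abs_nonneg _)
      rw [mul_assoc]
      exact mul_le_mul_of_nonneg_left (hc.bound_β z) zero_le_two
    · refine rnorm_le_mul_of_le hg (by positivity) fun z => ?_
      rw [abs_mul]
      gcongr
      exact (abs_add_le _ _).trans (add_le_add (hc.bound_γ z) (abs_of_nonneg hlam).le)
  have hFr := hFbound (-2) (by simp) p pt p2 q1 fr (L hp.cont hp.supp) (L hq.cont_x hq.supp_x) hfrL
    (fun z => by rw [hfr]; ring)
  have hFi := hFbound 2 (by simp) q qt q2 p1 fi (L hq.cont hq.supp) (L hp.cont_x hp.supp_x) hfiL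
    (fun z => by rw [hfi])
  have hpxx := hp.rnorm_xx_le hc.meas_a hc.lower_a hc.upper_a
  have hqxx := hq.rnorm_xx_le hc.meas_a hc.lower_a hc.upper_a
  have htb : ∀ (g gt g2 : ℝ × ℝ → ℝ), MemLp gt 2 volume → MemLp g2 2 volume →
      rnorm volume gt ≤ rnorm volume (fun z => gt z + a z * g2 z) + δ⁻¹ * rnorm volume g2 := by
    intro g gt g2 hgt hg2
    have m := memLp_bounded_mul hc.meas_a.aestronglyMeasurable hc.upper_a hg2
    have e1 : gt = fun z => (gt z + a z * g2 z) - a z * g2 z := by ext z; ring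
    conv_lhs => rw [e1]
    refine (rnorm_sub_le (hgt.add m) m).trans (add_le_add le_rfl ?_)
    refine rnorm_le_mul_of_le hg2 (by positivity) fun z => ?_
    rw [abs_mul]
    exact mul_le_mul_of_nonneg_right (hc.upper_a z) (abs_nonneg _)
  have hpt := htb p pt p2 (L hp.cont_t hp.supp_t) (L hp.cont_xx hp.supp_xx)
  have hqt := htb q qt q2 (L hq.cont_t hq.supp_t) (L hq.cont_xx hq.supp_xx)
  have hp1 := hp.rnorm_x_sq_le
  have hq1 := hq.rnorm_x_sq_le
  have hX1sq : X1 ^ 2 ≤ 2 * (X2 * X0) := by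
    have m1 := mul_nonneg (hn p2) (hn q)
    have m2 := mul_nonneg (hn q2) (hn p)
    have e : X1 ^ 2 ≤ 2 * (rnorm volume p1 ^ 2 + rnorm volume q1 ^ 2) := by
      rw [hX1]; exact add_sq_le_two_mul _ _
    have e2 : X2 * X0 = rnorm volume p2 * rnorm volume p + rnorm volume q2 * rnorm volume q
        + rnorm volume p2 * rnorm volume q + rnorm volume q2 * rnorm volume p := by
      rw [hX2, hX0]; ring
    rw [e2]
    linarith only [e, m1, m2, hp1, hq1]
  have hs2 : √lam ^ 2 = lam := Real.sq_sqrt hlam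
  obtain ⟨b2, bk1, bs1, bsk, bt⟩ := absorb_bounds (δ := δ) (D := D) (κ := κ) (s := √lam)
    (X0 := X0) (X1 := X1) (X2 := X2) (Xt := Xt) (Φ := Φ)
    (F := rnorm volume (fun z => pt z + a z * p2 z) + rnorm volume (fun z => qt z + a z * q2 z))
    hδ hD0 hX20 hΦ0 (by positivity) ha1 (by rw [hs2]; exact ha2)
    (by rw [hX2, mul_add]; exact add_le_add hpxx hqxx)
    (by
      rw [hs2]
      refine (add_le_add hFr hFi).trans (le_of_eq ?_)
      rw [hX1, hX0, hΦ]; ring)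
    hX1sq
    (by
      rw [hXt, hX2]
      refine (add_le_add hpt hqt).trans (le_of_eq ?_)
      ring) hC₁ hC₂
  have s1 := sq_add_sq_le_of_add_le (hn pt) (hn qt) bt
  have s2 := sq_add_sq_le_of_add_le (hn p2) (hn q2) b2
  have sc : ∀ (r : ℝ) (f g : ℝ × ℝ → ℝ) (b : ℝ), 0 ≤ r →
      r * (rnorm volume f + rnorm volume g) ≤ b →
      r ^ 2 * (rnorm volume f ^ 2 + rnorm volume g ^ 2) ≤ b ^ 2 := fun r f g b hr h => by
    have := sq_add_sq_le_of_add_le (mul_nonneg hr (hn f)) (mul_nonneg hr (hn g)) (b := b)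
      (by rw [← mul_add]; exact h)
    rwa [mul_pow, mul_pow, ← mul_add] at this
  have s3 := sc κ p1 q1 _ hκ bk1
  have s4 := sc (κ ^ 2) p q _ (by positivity) ha1
  have s5 := sc (√lam) p1 q1 _ (Real.sqrt_nonneg _) bs1
  have s6 := sc (√lam * κ) p q _ (by positivity) bsk
  have s7 := sc lam p q _ hlam ha2
  rw [mul_pow, hs2] at s6
  rw [hs2] at s5
  have hΦsq : Φ ^ 2 ≤ 2 * (rnorm volume fr ^ 2 + rnorm volume fi ^ 2) := by
    rw [hΦ]; exact add_sq_le_two_mul _ _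
  have hfin : (C₂ ^ 2 + 4 * C₁ ^ 2 + 3 * D ^ 2) * Φ ^ 2 ≤
      (C₂ ^ 2 + 4 * C₁ ^ 2 + 3 * D ^ 2) * (2 * (rnorm volume fr ^ 2 + rnorm volume fi ^ 2)) := by
    gcongr
  linarith only [s1, s2, s3, s4, s5, s6, s7, hfin]

/-- The derivative of `u` in the direction `v`. -/
noncomputable def dirDeriv {E : Type*} [NormedAddCommGroup E] [NormedSpace ℝ E] (v : E)
    (u : E → ℝ) (z : E) : ℝ := fderiv ℝ u z v

section DirDeriv

variable {E : Type*} [NormedAddCommGroup E] [NormedSpace ℝ E] {u : E → ℝ}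

theorem ContDiff.dirDeriv (hu : ContDiff ℝ ∞ u) (v : E) : ContDiff ℝ ∞ (dirDeriv v u) :=
  (hu.fderiv_right (m := ∞) (by simp)).clm_apply contDiff_const

theorem HasCompactSupport.dirDeriv (hs : HasCompactSupport u) (v : E) :
    HasCompactSupport (dirDeriv v u) := hs.fderiv_apply ℝ v

theorem dirDeriv_comm (hu : ContDiff ℝ ∞ u) (v w : E) :
    dirDeriv v (dirDeriv w u) = dirDeriv w (dirDeriv v u) := by
  have hd : Differentiable ℝ (fderiv ℝ u) :=
    (hu.fderiv_right (m := ∞) (by simp)).differentiable (by simp)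
  have key : ∀ v w z, dirDeriv v (dirDeriv w u) z = fderiv ℝ (fderiv ℝ u) z v w := by
    intro v w z
    change fderiv ℝ (fun z => fderiv ℝ u z w) z v = _
    rw [fderiv_clm_apply (hd z) (differentiableAt_const w)]
    simp
  ext z
  rw [key, key]
  exact (hu.contDiffAt.isSymmSndFDerivAt (by simp; exact WithTop.coe_le_coe.2 le_top)).eq v w

end DirDeriv

/-! ### Separating `(t, x¹)` from the other space variables. -/

section Splitting

variable {n : ℕ}

/-- Points of `ℝ^{d}` as pairs of the first coordinate and the others. -/
noncomputable def consSpace (n : ℕ) :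
    (ℝ × EuclideanSpace ℝ (Fin n)) ≃ₗ[ℝ] EuclideanSpace ℝ (Fin (n + 1)) where
  toFun w := WithLp.toLp 2 (Fin.cons w.1 w.2.ofLp : Fin (n + 1) → ℝ)
  invFun x := (x 0, WithLp.toLp 2 fun j => x j.succ)
  map_add' v w := by
    ext j
    refine Fin.cases ?_ (fun j => ?_) j <;> simp
  map_smul' c w := by
    ext j
    refine Fin.cases ?_ (fun j => ?_) j <;> simp
  left_inv w := by
    ext <;> simp
  right_inv x := by
    ext j
    refine Fin.cases ?_ (fun j => ?_) j <;> simp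

theorem measurePreserving_consSpace : MeasurePreserving (consSpace n) volume volume := by
  have h1 : MeasurePreserving
      (Prod.map id WithLp.ofLp : ℝ × EuclideanSpace ℝ (Fin n) → ℝ × (Fin n → ℝ)) :=
    (MeasurePreserving.id volume).prod (PiLp.volume_preserving_ofLp (Fin n))
  have h2 := (volume_preserving_piFinSuccAbove (fun _ : Fin (n + 1) => ℝ) 0).symm
  have h3 := (PiLp.volume_preserving_toLp (Fin (n + 1))).comp (h2.comp h1)
  refine (show ⇑(consSpace n) = _ from ?_) ▸ h3
  ext w j
  refine Fin.cases ?_ (fun j => ?_) j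
  · simp [consSpace, MeasurableEquiv.piFinSuccAbove]
  · simp [consSpace, MeasurableEquiv.piFinSuccAbove]

/-- Space-time points `((t, x¹), (x², …, x^d))`. -/
noncomputable def splitST (n : ℕ) :
    ((ℝ × ℝ) × EuclideanSpace ℝ (Fin n)) ≃L[ℝ] SpaceTime (n + 1) :=
  ((LinearEquiv.prodAssoc ℝ ℝ ℝ (EuclideanSpace ℝ (Fin n))).trans
    (LinearEquiv.prodCongr (LinearEquiv.refl ℝ ℝ) (consSpace n))).toContinuousLinearEquiv

theorem measurePreserving_splitST : MeasurePreserving (splitST n) volume volume :=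
  ((MeasurePreserving.id (volume : Measure ℝ)).prod measurePreserving_consSpace).comp
    (volume_preserving_prodAssoc (α₁ := ℝ) (β₁ := ℝ) (γ₁ := EuclideanSpace ℝ (Fin n)))

theorem splitST_time : splitST n ((1, 0), 0) = timeDir (n + 1) := by
  refine Prod.ext rfl ?_
  ext j
  refine Fin.cases ?_ (fun j => ?_) j <;> rfl

theorem splitST_zero : splitST n ((0, 1), 0) = spaceDir 0 := by
  refine Prod.ext rfl ?_
  ext j
  refine Fin.cases ?_ (fun j => ?_) j
  · simp [spaceDir]; rfl
  · simp [spaceDir]; rfl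

theorem splitST_succ (i : Fin n) :
    splitST n ((0, 0), EuclideanSpace.single i 1) = spaceDir i.succ := by
  refine Prod.ext rfl ?_
  ext j
  refine Fin.cases ?_ (fun j => ?_) j
  · simp [spaceDir]; rfl
  · have : (splitST n ((0, 0), EuclideanSpace.single i 1)).2 j.succ
      = EuclideanSpace.single i (1 : ℝ) j := rfl
    rw [this]
    simp [spaceDir]

/-- Integration against `k` in the last coordinates. -/
noncomputable def kernelInt (k : EuclideanSpace ℝ (Fin n) → ℝ) (w : SpaceTime (n + 1) → ℝ)
    (z : ℝ × ℝ) : ℝ := ∫ y, k y * w (splitST n (z, y))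

variable {k : EuclideanSpace ℝ (Fin n) → ℝ} {w u : SpaceTime (n + 1) → ℝ}

theorem slice_eq_zero (z : ℝ × ℝ) (y : EuclideanSpace ℝ (Fin n)) (h : (z, y) ∉ (splitST n) ⁻¹' tsupport w) :
    w (splitST n (z, y)) = 0 := image_eq_zero_of_notMem_tsupport h

theorem isCompact_preimage_splitST (hs : HasCompactSupport w) :
    IsCompact ((splitST n) ⁻¹' tsupport w) :=
  (splitST n).toHomeomorph.isCompact_preimage.2 hs.isCompact

theorem continuous_slice (hw : Continuous w) (z : ℝ × ℝ) :
    Continuous fun y => w (splitST n (z, y)) :=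
  hw.comp ((splitST n).continuous.comp (by fun_prop))

theorem hasCompactSupport_slice (hs : HasCompactSupport w) (z : ℝ × ℝ) :
    HasCompactSupport fun y => w (splitST n (z, y)) := by
  refine HasCompactSupport.intro ((isCompact_preimage_splitST hs).image continuous_snd) ?_
  intro y hy
  refine slice_eq_zero z y fun h => hy ⟨(z, y), h, rfl⟩

theorem integrable_kernel (hk : Continuous k) (hw : Continuous w) (hs : HasCompactSupport w)
    (z : ℝ × ℝ) : Integrable fun y => k y * w (splitST n (z, y)) :=
  (hk.mul (continuous_slice hw z)).integrable_of_hasCompactSupport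
    ((hasCompactSupport_slice hs z).mul_left)

theorem continuous_kernelInt (hk : Continuous k) (hw : Continuous w) (hs : HasCompactSupport w) :
    Continuous (kernelInt k w) := by
  set S := Prod.snd '' ((splitST n) ⁻¹' tsupport w) with hS
  have hSc : IsCompact S := (isCompact_preimage_splitST hs).image continuous_snd
  have h1 : kernelInt k w = fun z => ∫ y in S, k y * w (splitST n (z, y)) := by
    ext z
    refine (setIntegral_eq_integral_of_forall_compl_eq_zero fun y hy => ?_).symm
    rw [slice_eq_zero z y fun h => hy ⟨(z, y), h, rfl⟩, mul_zero]
  rw [h1]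
  refine continuous_parametric_integral_of_continuous ?_ hSc
  exact (hk.comp continuous_snd).mul (hw.comp (splitST n).continuous)

theorem hasCompactSupport_kernelInt (hs : HasCompactSupport w) :
    HasCompactSupport (kernelInt k w) := by
  refine HasCompactSupport.intro ((isCompact_preimage_splitST hs).image continuous_fst) ?_
  intro z hz
  have : ∀ y, k y * w (splitST n (z, y)) = 0 := fun y => by
    rw [slice_eq_zero z y fun h => hz ⟨(z, y), h, rfl⟩, mul_zero]
  simp [kernelInt, this]

/-- Differentiation under the integral. The kernel need not be integrable: the derivative of `u`
lives over a fixed compact set of `y`, and this supplies the dominating function. -/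
theorem hasDerivAt_kernelInt (hk : Continuous k) (hu : ContDiff ℝ ∞ u) (hs : HasCompactSupport u)
    {c : ℝ → ℝ × ℝ} {c' : ℝ × ℝ} (hc : ∀ s, HasDerivAt c c' s) (s : ℝ) :
    HasDerivAt (fun s => kernelInt k u (c s))
      (kernelInt k (dirDeriv (splitST n (c', 0)) u) (c s)) s := by
  set v := splitST n (c', 0) with hv
  have hw := (hu.dirDeriv v).continuous
  have hws := hs.dirDeriv v
  set S := Prod.snd '' ((splitST n) ⁻¹' tsupport (dirDeriv v u)) with hS
  have hSc : IsCompact S := (isCompact_preimage_splitST hws).image continuous_snd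
  obtain ⟨M, hM⟩ := hws.exists_bound_of_continuous hw
  have hd : ∀ s y, HasDerivAt (fun s => k y * u (splitST n (c s, y)))
      (k y * dirDeriv v u (splitST n (c s, y))) s := by
    intro s y
    refine HasDerivAt.const_mul (k y) ?_
    have h1 : HasDerivAt (fun s => ((c s, y) : (ℝ × ℝ) × EuclideanSpace ℝ (Fin n))) (c', 0) s :=
      (hc s).prodMk (hasDerivAt_const s y)
    have h2 : HasDerivAt (fun s => splitST n (c s, y)) v s :=
      (splitST n).hasFDerivAt.comp_hasDerivAt s h1
    exact ((hu.differentiable (by simp)) (splitST n (c s, y))).hasFDerivAt.comp_hasDerivAt s h2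
  refine (hasDerivAt_integral_of_dominated_loc_of_deriv_le (μ := volume) (s := Set.univ)
    (F := fun s y => k y * u (splitST n (c s, y)))
    (F' := fun s y => k y * dirDeriv v u (splitST n (c s, y)))
    (bound := S.indicator fun y => |k y| * M) univ_mem ?_ ?_ ?_ ?_ ?_ ?_).2
  · exact Eventually.of_forall fun s =>
      (integrable_kernel hk hu.continuous hs (c s)).aestronglyMeasurable
  · exact integrable_kernel hk hu.continuous hs (c s)
  · exact (integrable_kernel hk hw hws (c s)).aestronglyMeasurable
  · refine Eventually.of_forall fun y s _ => ?_
    by_cases hy : y ∈ S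
    · rw [Set.indicator_of_mem hy, norm_mul]
      exact mul_le_mul_of_nonneg_left (hM _) (norm_nonneg _)
    · rw [slice_eq_zero _ y fun h => hy ⟨(c s, y), h, rfl⟩, mul_zero, norm_zero,
        Set.indicator_of_notMem hy]
  · rw [integrable_indicator_iff hSc.measurableSet]
    exact ContinuousOn.integrableOn_compact hSc (by fun_prop)
  · exact Eventually.of_forall fun y s _ => hd s y

theorem hasParabolicDerivs_kernelInt (hk : Continuous k) (hu : ContDiff ℝ ∞ u)
    (hs : HasCompactSupport u) :
    HasParabolicDerivs (kernelInt k u) (kernelInt k (dirDeriv (timeDir (n + 1)) u))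
      (kernelInt k (dirDeriv (spaceDir 0) u))
      (kernelInt k (dirDeriv (spaceDir 0) (dirDeriv (spaceDir 0) u))) := by
  have hx : ∀ (w : SpaceTime (n + 1) → ℝ), ContDiff ℝ ∞ w → HasCompactSupport w → ∀ t x : ℝ,
      HasDerivAt (fun y => kernelInt k w (t, y)) (kernelInt k (dirDeriv (spaceDir 0) w) (t, x)) x :=
    fun w hw hws t x => by
      have := hasDerivAt_kernelInt hk hw hws (c := fun y => (t, y)) (c' := (0, 1))
        (fun s => (hasDerivAt_const s t).prodMk (hasDerivAt_id s)) x
      rwa [splitST_zero] at this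
  refine ⟨continuous_kernelInt hk hu.continuous hs,
    continuous_kernelInt hk (hu.dirDeriv _).continuous (hs.dirDeriv _),
    continuous_kernelInt hk (hu.dirDeriv _).continuous (hs.dirDeriv _),
    continuous_kernelInt hk ((hu.dirDeriv _).dirDeriv _).continuous ((hs.dirDeriv _).dirDeriv _),
    hasCompactSupport_kernelInt hs, hasCompactSupport_kernelInt (hs.dirDeriv _),
    hasCompactSupport_kernelInt (hs.dirDeriv _),
    hasCompactSupport_kernelInt ((hs.dirDeriv _).dirDeriv _), fun t x => ?_, hx u hu hs,
    hx _ (hu.dirDeriv _) (hs.dirDeriv _)⟩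
  have := hasDerivAt_kernelInt hk hu hs (c := fun s => (s, x)) (c' := (1, 0))
    (fun s => (hasDerivAt_id s).prodMk (hasDerivAt_const s x)) t
  rwa [splitST_time] at this

/-- Integration by parts in `y`, without boundary terms because the slices of `u` have compact
support. -/
theorem kernelInt_succ (hk : ContDiff ℝ ∞ k) (hu : ContDiff ℝ ∞ u) (hs : HasCompactSupport u)
    (i : Fin n) (z : ℝ × ℝ) : kernelInt k (dirDeriv (spaceDir i.succ) u) z
      = -kernelInt (dirDeriv (EuclideanSpace.single i 1) k) u z := by
  set e : EuclideanSpace ℝ (Fin n) := EuclideanSpace.single i 1 with he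
  have hg : ∀ y, fderiv ℝ (fun y => u (splitST n (z, y))) y e
      = dirDeriv (spaceDir i.succ) u (splitST n (z, y)) := fun y => by
    have h1 : HasFDerivAt (fun y => splitST n (z, y))
        ((splitST n : _ →L[ℝ] _).comp (ContinuousLinearMap.inr ℝ (ℝ × ℝ) _)) y :=
      (splitST n).hasFDerivAt.comp y (hasFDerivAt_prodMk_right z y)
    have h2 := (((hu.differentiable (by simp)) (splitST n (z, y))).hasFDerivAt.comp y h1).fderiv
    change fderiv ℝ (u ∘ fun y => splitST n (z, y)) y e = _
    rw [h2, dirDeriv, ← splitST_succ]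
    rfl
  have hsl := continuous_slice hu.continuous z
  have hgd : ContDiff ℝ ∞ fun y => u (splitST n (z, y)) :=
    hu.comp ((splitST n).contDiff.comp (contDiff_prodMk_right z))
  have := integral_mul_fderiv_eq_neg_fderiv_mul_of_integrable (μ := volume) (f := k)
    (g := fun y => u (splitST n (z, y))) (v := e)
    (integrable_kernel (hk.dirDeriv e).continuous hu.continuous hs z)
    (by
      simp only [hg]
      exact integrable_kernel hk.continuous (hu.dirDeriv _).continuous (hs.dirDeriv _) z)
    (integrable_kernel hk.continuous hu.continuous hs z)
    (fun y _ => hk.differentiable (by simp) y) (fun y _ => hgd.differentiable (by simp) y)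
  simp only [hg] at this
  exact this

end Splitting

theorem rnorm_sq_eq_integral {α : Type*} [MeasurableSpace α] {ν : Measure α} {f : α → ℝ}
    (hf : MemLp f 2 ν) : rnorm ν f ^ 2 = ∫ z, f z ^ 2 ∂ν := by
  rw [rnorm_eq_norm hf, ← real_inner_self_eq_norm_sq, L2.inner_def]
  refine integral_congr_ae ?_
  filter_upwards [hf.coeFn_toLp] with z hz
  simp [hz, pow_two]

/-! ### The partial Fourier transform, in real form. -/

section Plancherel

variable {n : ℕ}

/-- The real part of the Fourier kernel. -/
noncomputable def cosKernel (ξ y : EuclideanSpace ℝ (Fin n)) : ℝ :=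
  Real.cos (2 * Real.pi * inner ℝ y ξ)

/-- The imaginary part of the Fourier kernel. -/
noncomputable def sinKernel (ξ y : EuclideanSpace ℝ (Fin n)) : ℝ :=
  -Real.sin (2 * Real.pi * inner ℝ y ξ)

theorem contDiff_cosKernel (ξ : EuclideanSpace ℝ (Fin n)) : ContDiff ℝ ∞ (cosKernel ξ) :=
  Real.contDiff_cos.comp (contDiff_const.mul (contDiff_id.inner ℝ contDiff_const))

theorem contDiff_sinKernel (ξ : EuclideanSpace ℝ (Fin n)) : ContDiff ℝ ∞ (sinKernel ξ) :=
  (Real.contDiff_sin.comp (contDiff_const.mul (contDiff_id.inner ℝ contDiff_const))).neg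

theorem hasFDerivAt_phase (ξ y : EuclideanSpace ℝ (Fin n)) :
    HasFDerivAt (fun y => 2 * Real.pi * inner ℝ y ξ) ((2 * Real.pi) • innerSL ℝ ξ) y := by
  have : HasFDerivAt (fun y => inner ℝ y ξ) (innerSL ℝ ξ) y := by
    have h := (innerSL ℝ ξ).hasFDerivAt (x := y)
    refine h.congr_of_eventuallyEq (Eventually.of_forall fun y => ?_)
    simp [real_inner_comm]
  exact this.const_mul _

theorem dirDeriv_cosKernel (ξ : EuclideanSpace ℝ (Fin n)) (i : Fin n) :
    dirDeriv (EuclideanSpace.single i 1) (cosKernel ξ)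
      = fun y => (2 * Real.pi * ξ i) * sinKernel ξ y := by
  ext y
  have h := (hasFDerivAt_phase ξ y).cos.fderiv
  change fderiv ℝ (fun y => Real.cos (2 * Real.pi * inner ℝ y ξ)) y _ = _
  rw [h]
  simp [sinKernel, EuclideanSpace.inner_single_right]
  ring

theorem dirDeriv_sinKernel (ξ : EuclideanSpace ℝ (Fin n)) (i : Fin n) :
    dirDeriv (EuclideanSpace.single i 1) (sinKernel ξ)
      = fun y => -(2 * Real.pi * ξ i) * cosKernel ξ y := by
  ext y
  have h := (hasFDerivAt_phase ξ y).sin.neg.fderiv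
  change fderiv ℝ (-fun y => Real.sin (2 * Real.pi * inner ℝ y ξ)) y _ = _
  rw [h]
  simp [cosKernel, EuclideanSpace.inner_single_right]
  ring

theorem kernelInt_const_mul (c : ℝ) (k : EuclideanSpace ℝ (Fin n) → ℝ)
    (u : SpaceTime (n + 1) → ℝ) (z : ℝ × ℝ) :
    kernelInt (fun y => c * k y) u z = c * kernelInt k u z := by
  simp only [kernelInt, mul_assoc, integral_const_mul]

theorem kernelInt_cos_succ {u : SpaceTime (n + 1) → ℝ} (hu : ContDiff ℝ ∞ u)
    (hs : HasCompactSupport u) (ξ : EuclideanSpace ℝ (Fin n)) (i : Fin n) (z : ℝ × ℝ) :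
    kernelInt (cosKernel ξ) (dirDeriv (spaceDir i.succ) u) z
      = -(2 * Real.pi * ξ i) * kernelInt (sinKernel ξ) u z := by
  rw [kernelInt_succ (contDiff_cosKernel ξ) hu hs, dirDeriv_cosKernel, kernelInt_const_mul]; ring

theorem kernelInt_sin_succ {u : SpaceTime (n + 1) → ℝ} (hu : ContDiff ℝ ∞ u)
    (hs : HasCompactSupport u) (ξ : EuclideanSpace ℝ (Fin n)) (i : Fin n) (z : ℝ × ℝ) :
    kernelInt (sinKernel ξ) (dirDeriv (spaceDir i.succ) u) z
      = (2 * Real.pi * ξ i) * kernelInt (cosKernel ξ) u z := by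
  rw [kernelInt_succ (contDiff_sinKernel ξ) hu hs, dirDeriv_sinKernel, kernelInt_const_mul]; ring

theorem fourier_normSq_eq {g : EuclideanSpace ℝ (Fin n) → ℝ} (hg : Integrable g)
    (ξ : EuclideanSpace ℝ (Fin n)) :
    ‖FourierTransform.fourier (fun y => (g y : ℂ)) ξ‖ ^ 2
      = (∫ y, cosKernel ξ y * g y) ^ 2 + (∫ y, sinKernel ξ y * g y) ^ 2 := by
  have i1 : Integrable fun y => cosKernel ξ y * g y := by
    refine hg.bdd_mul (c := 1) (contDiff_cosKernel ξ).continuous.aestronglyMeasurable ?_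
    exact Eventually.of_forall fun y => Real.abs_cos_le_one _
  have i2 : Integrable fun y => sinKernel ξ y * g y := by
    refine hg.bdd_mul (c := 1) (contDiff_sinKernel ξ).continuous.aestronglyMeasurable ?_
    exact Eventually.of_forall fun y => by
      rw [sinKernel, norm_neg]; exact Real.abs_sin_le_one _
  have h : FourierTransform.fourier (fun y => (g y : ℂ)) ξ
      = ((∫ y, cosKernel ξ y * g y : ℝ) : ℂ) + ((∫ y, sinKernel ξ y * g y : ℝ) : ℂ) * Complex.I := by
    rw [Real.fourier_eq', ← integral_complex_ofReal, ← integral_complex_ofReal, ← integral_mul_const,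
      ← integral_add i1.ofReal (i2.ofReal.mul_const _)]
    refine integral_congr_ae (Eventually.of_forall fun y => ?_)
    simp only [smul_eq_mul]
    rw [Complex.exp_mul_I, ← Complex.ofReal_cos, ← Complex.ofReal_sin, neg_mul, neg_mul,
      Real.cos_neg, Real.sin_neg, cosKernel, sinKernel]
    push_cast
    ring
  rw [h, ← Complex.normSq_eq_norm_sq, Complex.normSq_add_mul_I]

/-- Plancherel for Schwartz functions. The kernels are the real and imaginary parts of `exp(-2πi⟨y,
ξ⟩)`, so the sum of squares is the squared modulus of the transform. -/
theorem integrable_fourier_sq {g : EuclideanSpace ℝ (Fin n) → ℝ} (hg : ContDiff ℝ ∞ g)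
    (hs : HasCompactSupport g) :
    Integrable (fun ξ => (∫ y, cosKernel ξ y * g y) ^ 2 + (∫ y, sinKernel ξ y * g y) ^ 2) ∧
    ∫ ξ, ((∫ y, cosKernel ξ y * g y) ^ 2 + (∫ y, sinKernel ξ y * g y) ^ 2) = ∫ y, g y ^ 2 := by
  have hc : ContDiff ℝ ∞ (fun y => (g y : ℂ)) := Complex.ofRealCLM.contDiff.comp hg
  have hcs : HasCompactSupport (fun y => (g y : ℂ)) := hs.comp_left Complex.ofReal_zero
  set f := hcs.toSchwartzMap hc with hf
  have e : ∀ ξ, ‖FourierTransform.fourier f ξ‖ ^ 2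
      = (∫ y, cosKernel ξ y * g y) ^ 2 + (∫ y, sinKernel ξ y * g y) ^ 2 := fun ξ => by
    rw [SchwartzMap.fourier_coe]
    exact fourier_normSq_eq (hg.continuous.integrable_of_hasCompactSupport hs) ξ
  refine ⟨?_, ?_⟩
  · simp only [← e]
    exact ((FourierTransform.fourier f).memLp 2).integrable_norm_pow (by simp)
  · simp only [← e]
    rw [SchwartzMap.integral_norm_sq_fourier]
    refine integral_congr_ae (Eventually.of_forall fun y => ?_)
    change ‖(g y : ℂ)‖ ^ 2 = _
    rw [Complex.norm_real, Real.norm_eq_abs, sq_abs]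

/-- Plancherel's theorem in the last variables, for square integrable functions with smooth
compactly supported sections. -/
theorem integrable_partialFourier {W : SpaceTime (n + 1) → ℝ} (hW : MemLp W 2 volume)
    (hc : ∀ z, ContDiff ℝ ∞ fun y => W (splitST n (z, y)))
    (hs : ∀ z, HasCompactSupport fun y => W (splitST n (z, y)))
    (hcos : ∀ ξ, MemLp (kernelInt (cosKernel ξ) W) 2 volume)
    (hsin : ∀ ξ, MemLp (kernelInt (sinKernel ξ) W) 2 volume) :
    Integrable (fun ξ => rnorm volume (kernelInt (cosKernel ξ) W) ^ 2
      + rnorm volume (kernelInt (sinKernel ξ) W) ^ 2) ∧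
    ∫ ξ, (rnorm volume (kernelInt (cosKernel ξ) W) ^ 2
      + rnorm volume (kernelInt (sinKernel ξ) W) ^ 2) = rnorm volume W ^ 2 := by
  have hWJ : MemLp (fun q => W (splitST n q)) 2 volume :=
    hW.comp_measurePreserving measurePreserving_splitST
  -- Joint measurability in `(z, ξ)` cannot come from continuity: `W` will be the image of a test
  -- function under the operator, which is only measurable in `(t, x¹)`.
  have hmeas : ∀ κ : EuclideanSpace ℝ (Fin n) → EuclideanSpace ℝ (Fin n) → ℝ,
      Continuous (fun q : EuclideanSpace ℝ (Fin n) × EuclideanSpace ℝ (Fin n) => κ q.1 q.2) →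
      AEStronglyMeasurable (fun q : (ℝ × ℝ) × EuclideanSpace ℝ (Fin n) =>
        kernelInt (κ q.2) W q.1) (volume.prod volume) := by
    intro κ hκ
    have h1 : Measure.QuasiMeasurePreserving
        (fun q : ((ℝ × ℝ) × EuclideanSpace ℝ (Fin n)) × EuclideanSpace ℝ (Fin n) => (q.1.1, q.2))
        ((volume.prod volume).prod volume) (volume.prod volume) :=
      QuasiMeasurePreserving.prodMap Measure.quasiMeasurePreserving_fst
        (Measure.QuasiMeasurePreserving.id _)
    have h2 := hWJ.1.comp_quasiMeasurePreserving h1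
    have h3 : AEStronglyMeasurable
        (fun q : ((ℝ × ℝ) × EuclideanSpace ℝ (Fin n)) × EuclideanSpace ℝ (Fin n) =>
          κ q.1.2 q.2 * W (splitST n (q.1.1, q.2))) ((volume.prod volume).prod volume) := by
      refine AEStronglyMeasurable.mul ?_ h2
      have : Continuous
        fun q : ((ℝ × ℝ) × EuclideanSpace ℝ (Fin n)) × EuclideanSpace ℝ (Fin n) => κ q.1.2 q.2 :=
        hκ.comp (by fun_prop :  Continuous
          fun q : ((ℝ × ℝ) × EuclideanSpace ℝ (Fin n)) × EuclideanSpace ℝ (Fin n) => (q.1.2, q.2))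
      exact this.aestronglyMeasurable
    exact h3.integral_prod_right'
  have m1 := hmeas cosKernel (by unfold cosKernel; fun_prop)
  have m2 := hmeas sinKernel (by unfold sinKernel; fun_prop)
  set F : (ℝ × ℝ) × EuclideanSpace ℝ (Fin n) → ℝ := fun q =>
    kernelInt (cosKernel q.2) W q.1 ^ 2 + kernelInt (sinKernel q.2) W q.1 ^ 2 with hF
  have mF : AEStronglyMeasurable F (volume.prod volume) := (m1.pow 2).add (m2.pow 2)
  have hpl := fun z => integrable_fourier_sq (hc z) (hs z)
  have hW2 : Integrable (fun q => W (splitST n q) ^ 2) (volume.prod volume) := hWJ.integrable_sq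
  -- Integrating first in `ξ` allows Plancherel on each slice, so the iterated integral is the
  -- squared norm of `W`. Fubini then exchanges the order.
  have hFint : Integrable F (volume.prod volume) := by
    rw [integrable_prod_iff mF]
    refine ⟨Eventually.of_forall fun z => (hpl z).1, ?_⟩
    have e : (fun z => ∫ ξ, ‖F (z, ξ)‖) = fun z => ∫ y, W (splitST n (z, y)) ^ 2 := by
      ext z
      rw [← (hpl z).2]
      refine integral_congr_ae (Eventually.of_forall fun ξ => ?_)
      exact Real.norm_of_nonneg (by positivity)
    rw [e]
    exact hW2.integral_prod_left
  have hG : (fun ξ => rnorm volume (kernelInt (cosKernel ξ) W) ^ 2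
      + rnorm volume (kernelInt (sinKernel ξ) W) ^ 2) = fun ξ => ∫ z, F (z, ξ) := by
    ext ξ
    rw [rnorm_sq_eq_integral (hcos ξ), rnorm_sq_eq_integral (hsin ξ),
      ← integral_add (hcos ξ).integrable_sq (hsin ξ).integrable_sq]
  rw [hG]
  refine ⟨hFint.integral_prod_right, ?_⟩
  rw [← integral_integral_swap (f := fun z ξ => F (z, ξ)) hFint, rnorm_sq_eq_integral hW,
    ← measurePreserving_splitST.integral_comp (splitST n).toHomeomorph.measurableEmbedding]
  have e2 : ∫ q, W (splitST n q) ^ 2 = ∫ z, ∫ y, W (splitST n (z, y)) ^ 2 := integral_prod _ hW2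
  rw [e2]
  exact integral_congr_ae (Eventually.of_forall fun z => (hpl z).2)

end Plancherel

/-! ### Bounds and measurability of the coefficients. -/

section Admissible

variable {d : ℕ} {δ : ℝ} {a : ℝ → ℝ → Matrix (Fin d) (Fin d) ℝ}

/-- Diagonal entries are values of the form at unit vectors. Nonnegativity of the form at `e_j ±
e_k` then bounds an off-diagonal entry by the mean of two diagonal ones. -/
theorem IsAdmissible.abs_coeff_le (h : IsAdmissible δ a) (hδ : 0 < δ) (t s : ℝ) (j k : Fin d) :
    |a t s j k| ≤ δ⁻¹ := by
  have hq : ∀ (r : ℝ), ∑ i, ∑ l, a t s i l * ((Pi.single j 1 + r • Pi.single k 1 : Fin d → ℝ) i)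
      * ((Pi.single j 1 + r • Pi.single k 1 : Fin d → ℝ) l)
      = a t s j j + 2 * r * a t s j k + r ^ 2 * a t s k k := by
    intro r
    have e : ∀ i l, a t s i l * ((Pi.single j 1 + r • Pi.single k 1 : Fin d → ℝ) i)
      * ((Pi.single j 1 + r • Pi.single k 1 : Fin d → ℝ) l)
      = (if l = j then (if i = j then a t s i l else 0) else 0)
        + r * (if l = k then (if i = j then a t s i l else 0) else 0)
        + r * (if l = j then (if i = k then a t s i l else 0) else 0)
        + r ^ 2 * (if l = k then (if i = k then a t s i l else 0) else 0) := by
      intro i l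
      simp only [Pi.add_apply, Pi.smul_apply, Pi.single_apply, smul_eq_mul]
      split_ifs <;> ring
    simp only [e, Finset.sum_add_distrib, ← Finset.mul_sum, Finset.sum_ite_eq', Finset.mem_univ,
      if_true]
    rw [h.symmetric t s k j]
    ring
  have hd : ∀ i, |a t s i i| ≤ δ⁻¹ ∧ 0 ≤ a t s i i := by
    intro i
    have e : ∑ p, ∑ q, a t s p q * (Pi.single i 1 : Fin d → ℝ) p * (Pi.single i 1 : Fin d → ℝ) q
        = a t s i i := by
      simp [Pi.single_apply]
    have e2 : ∑ p, (Pi.single i 1 : Fin d → ℝ) p ^ 2 = 1 := by simp [Pi.single_apply]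
    have h1 := h.lower t s (Pi.single i 1)
    have h2 := h.upper t s (Pi.single i 1)
    rw [e, e2] at h1 h2
    have h3 : 0 ≤ a t s i i := by linarith
    exact ⟨by rw [abs_of_nonneg h3]; linarith, h3⟩
  have hn : ∀ ϑ : Fin d → ℝ, 0 ≤ ∑ i, ∑ l, a t s i l * ϑ i * ϑ l := fun ϑ =>
    le_trans (mul_nonneg hδ.le (Finset.sum_nonneg fun _ _ => sq_nonneg _)) (h.lower t s ϑ)
  have p1 := hn (Pi.single j 1 + (1 : ℝ) • Pi.single k 1)
  have p2 := hn (Pi.single j 1 + (-1 : ℝ) • Pi.single k 1)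
  rw [hq] at p1 p2
  have hj := hd j
  have hk := hd k
  rw [abs_of_nonneg hj.2] at hj
  rw [abs_of_nonneg hk.2] at hk
  rw [abs_le]
  constructor <;> linarith [hj.1, hk.1]

/-- The map `(t, x) ↦ (t, x¹)` pulls null sets back to null sets, so Lebesgue measurability survives
the composition. -/
theorem aestronglyMeasurable_coeff [NeZero d] (h : IsAdmissible δ a) (j k : Fin d) :
    AEStronglyMeasurable (fun z : SpaceTime d => a z.1 (z.2 0) j k) volume := by
  have h1 : Measure.QuasiMeasurePreserving (fun x : EuclideanSpace ℝ (Fin d) => x 0)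
      volume volume :=
    (Measure.quasiMeasurePreserving_eval (fun _ : Fin d => (volume : Measure ℝ)) 0).comp
      (PiLp.volume_preserving_ofLp (Fin d)).quasiMeasurePreserving
  have h2 : Measure.QuasiMeasurePreserving (fun z : SpaceTime d => (z.1, z.2 0))
      volume volume := QuasiMeasurePreserving.prodMap (Measure.QuasiMeasurePreserving.id _) h1
  exact ((h.measurable j k).comp_quasiMeasurePreserving h2).aestronglyMeasurable

end Admissible

/-! ### The a priori estimate for test functions, through the frequency problems. -/

section SmoothEstimate

variable {n : ℕ} {δ : ℝ} {a : ℝ → ℝ → Matrix (Fin (n + 1)) (Fin (n + 1)) ℝ}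

theorem form_cons (h : IsAdmissible δ a) (t s θ r : ℝ) (ζ : Fin n → ℝ) :
    ∑ j, ∑ k, a t s j k * (Fin.cons θ (fun i => r * ζ i) : Fin (n + 1) → ℝ) j
        * (Fin.cons θ (fun i => r * ζ i) : Fin (n + 1) → ℝ) k
      = a t s 0 0 * θ ^ 2 + 2 * (∑ k : Fin n, a t s 0 k.succ * ζ k) * θ * r
        + (∑ j : Fin n, ∑ k : Fin n, a t s j.succ k.succ * ζ j * ζ k) * r ^ 2 := by
  simp only [Fin.sum_univ_succ, Fin.cons_zero, Fin.cons_succ, Finset.sum_add_distrib]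
  have e1 : ∑ x : Fin n, a t s x.succ 0 * (r * ζ x) * θ
      = (∑ k : Fin n, a t s 0 k.succ * ζ k) * θ * r := by
    rw [Finset.sum_mul, Finset.sum_mul]
    refine Finset.sum_congr rfl fun x _ => ?_
    rw [h.symmetric t s x.succ 0]; ring
  have e2 : ∑ x : Fin n, a t s 0 x.succ * θ * (r * ζ x)
      = (∑ k : Fin n, a t s 0 k.succ * ζ k) * θ * r := by
    rw [Finset.sum_mul, Finset.sum_mul]
    refine Finset.sum_congr rfl fun x _ => ?_
    ring
  have e3 : ∑ x : Fin n, ∑ y : Fin n, a t s x.succ y.succ * (r * ζ x) * (r * ζ y)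
      = (∑ j : Fin n, ∑ k : Fin n, a t s j.succ k.succ * ζ j * ζ k) * r ^ 2 := by
    rw [Finset.sum_mul]
    refine Finset.sum_congr rfl fun x _ => ?_
    rw [Finset.sum_mul]
    refine Finset.sum_congr rfl fun y _ => ?_
    ring
  rw [e1, e2, e3]; ring

/-- All bounds are the two ellipticity inequalities for vectors `(θ, rζ)`: `r = 0` gives the one for
`a`, and `θ = 0` the one for `γ`. -/
theorem IsAdmissible.isFrequencyCoeff (h : IsAdmissible δ a) (hδ : 0 < δ) {κ : ℝ} (hκ : 0 ≤ κ)
    (ζ : Fin n → ℝ) (hζ : ∑ i, ζ i ^ 2 = κ ^ 2) :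
    IsFrequencyCoeff δ κ (fun z => a z.1 z.2 0 0)
      (fun z => ∑ k : Fin n, a z.1 z.2 0 k.succ * ζ k)
      (fun z => ∑ j : Fin n, ∑ k : Fin n, a z.1 z.2 j.succ k.succ * ζ j * ζ k) := by
  have hsq : ∀ θ r : ℝ, ∑ j, (Fin.cons θ (fun i => r * ζ i) : Fin (n + 1) → ℝ) j ^ 2
      = θ ^ 2 + r ^ 2 * κ ^ 2 := fun θ r => by
    simp only [Fin.sum_univ_succ, Fin.cons_zero, Fin.cons_succ, mul_pow, ← Finset.mul_sum, hζ]
  have lo : ∀ t s θ r, _ := fun t s θ r =>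
    h.lower t s (Fin.cons θ (fun i => r * ζ i) : Fin (n + 1) → ℝ)
  have up : ∀ t s θ r, _ := fun t s θ r =>
    h.upper t s (Fin.cons θ (fun i => r * ζ i) : Fin (n + 1) → ℝ)
  simp only [form_cons h, hsq] at lo up
  refine ⟨h.measurable 0 0, ?_, ?_, fun z => ?_, fun z => h.abs_coeff_le hδ _ _ _ _, fun z => ?_,
    fun z => ?_, fun z θ => ?_⟩
  · exact Finset.aemeasurable_fun_sum _ fun k _ => (h.measurable 0 k.succ).mul_const _
  · exact Finset.aemeasurable_fun_sum _ fun j _ => Finset.aemeasurable_fun_sum _ fun k _ =>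
      ((h.measurable j.succ k.succ).mul_const _).mul_const _
  · have := lo z.1 z.2 1 0
    simpa using this
  · rcases hκ.eq_or_lt with h0 | h0
    · rw [← h0] at hζ ⊢
      have hz : ∀ i, ζ i = 0 := fun i => by
        have := (Finset.sum_eq_zero_iff_of_nonneg (fun i _ => sq_nonneg (ζ i))).1
          (by rw [hζ]; ring) i (Finset.mem_univ i)
        exact pow_eq_zero_iff (two_ne_zero) |>.1 this
      simp [hz]
    -- The forms at `(κ, ζ)` and `(-κ, ζ)` differ by `4βκ`, and both lie between `0` and `2δ⁻¹κ²`.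
    · have u1 := up z.1 z.2 κ 1
      have u2 := up z.1 z.2 (-κ) 1
      have l1 := lo z.1 z.2 κ 1
      have l2 := lo z.1 z.2 (-κ) 1
      have pos : 0 ≤ δ * (κ ^ 2 + 1 ^ 2 * κ ^ 2) := by positivity
      have pos' : 0 ≤ δ * ((-κ) ^ 2 + 1 ^ 2 * κ ^ 2) := by positivity
      rw [abs_le]
      constructor
      · refine le_of_mul_le_mul_right ?_ h0
        nlinarith
      · refine le_of_mul_le_mul_right ?_ h0
        nlinarith
  · have u1 := up z.1 z.2 0 1
    have l1 := lo z.1 z.2 0 1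
    have pos : 0 ≤ δ * (0 ^ 2 + 1 ^ 2 * κ ^ 2) := by positivity
    rw [abs_le]
    have pos' : 0 ≤ δ⁻¹ * κ ^ 2 := by positivity
    constructor <;> linarith
  · have := lo z.1 z.2 θ 1
    linarith

/-- The square of the `L²(dt dx¹)` norm of the partial Fourier transform of `w` at `ξ`. -/
noncomputable def freqEnergy (ξ : EuclideanSpace ℝ (Fin n)) (w : SpaceTime (n + 1) → ℝ) : ℝ :=
  rnorm volume (kernelInt (cosKernel ξ) w) ^ 2 + rnorm volume (kernelInt (sinKernel ξ) w) ^ 2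

/-- A transversal derivative exchanges the cosine and sine parts, up to sign, and multiplies them by
`2πξ_i`. -/
theorem freqEnergy_succ {u : SpaceTime (n + 1) → ℝ} (hu : ContDiff ℝ ∞ u)
    (hs : HasCompactSupport u) (ξ : EuclideanSpace ℝ (Fin n)) (i : Fin n) :
    freqEnergy ξ (dirDeriv (spaceDir i.succ) u) = (2 * Real.pi * ξ i) ^ 2 * freqEnergy ξ u := by
  have e1 := funext (kernelInt_cos_succ hu hs ξ i)
  have e2 := funext (kernelInt_sin_succ hu hs ξ i)
  rw [freqEnergy, e1, e2, rnorm_const_mul, rnorm_const_mul, mul_pow, mul_pow, sq_abs, sq_abs,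
    freqEnergy]
  ring

theorem sum_freqEnergy_succ {u : SpaceTime (n + 1) → ℝ} (hu : ContDiff ℝ ∞ u)
    (hs : HasCompactSupport u) (ξ : EuclideanSpace ℝ (Fin n)) :
    ∑ i : Fin n, freqEnergy ξ (dirDeriv (spaceDir i.succ) u)
      = (2 * Real.pi * ‖ξ‖) ^ 2 * freqEnergy ξ u := by
  simp only [freqEnergy_succ hu hs, ← Finset.sum_mul, mul_pow, ← Finset.mul_sum,
    EuclideanSpace.real_norm_sq_eq]

theorem freqEnergy_integral {u : SpaceTime (n + 1) → ℝ} (hu : ContDiff ℝ ∞ u)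
    (hs : HasCompactSupport u) :
    Integrable (fun ξ => freqEnergy ξ u) ∧ ∫ ξ, freqEnergy ξ u = rnorm volume u ^ 2 :=
  integrable_partialFourier (hu.continuous.memLp_two hs)
    (fun z => hu.comp ((splitST n).contDiff.comp (contDiff_prodMk_right z)))
    (hasCompactSupport_slice hs)
    (fun ξ => (continuous_kernelInt (contDiff_cosKernel ξ).continuous hu.continuous hs).memLp_two
      (hasCompactSupport_kernelInt hs))
    (fun ξ => (continuous_kernelInt (contDiff_sinKernel ξ).continuous hu.continuous hs).memLp_two
      (hasCompactSupport_kernelInt hs))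

/-- `L₀ u - λ u` for smooth `u`. -/
noncomputable def smoothOp {d : ℕ} [NeZero d] (a : ℝ → ℝ → Matrix (Fin d) (Fin d) ℝ) (lam : ℝ)
    (u : SpaceTime d → ℝ) (z : SpaceTime d) : ℝ :=
  dirDeriv (timeDir d) u z
    + ∑ j, ∑ k, a z.1 (z.2 0) j k * dirDeriv (spaceDir k) (dirDeriv (spaceDir j) u) z - lam * u z

theorem memLp_smoothOp {d : ℕ} [NeZero d] {a : ℝ → ℝ → Matrix (Fin d) (Fin d) ℝ}
    (h : IsAdmissible δ a) (hδ : 0 < δ) (lam : ℝ) {u : SpaceTime d → ℝ} (hu : ContDiff ℝ ∞ u)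
    (hs : HasCompactSupport u) : MemLp (smoothOp a lam u) 2 volume := by
  refine MemLp.sub (MemLp.add ?_ ?_) ?_
  · exact (hu.dirDeriv _).continuous.memLp_two (hs.dirDeriv _)
  · refine memLp_finsetSum _ fun j _ => memLp_finsetSum _ fun k _ => ?_
    exact memLp_bounded_mul (aestronglyMeasurable_coeff h j k) (fun z => h.abs_coeff_le hδ _ _ _ _)
      (((hu.dirDeriv _).dirDeriv _).continuous.memLp_two ((hs.dirDeriv _).dirDeriv _))
  · exact (hu.continuous.memLp_two hs).const_mul lam

/-- This is where the structure of the coefficients is used: they do not depend on `y` and leave the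
integral. -/
theorem kernelInt_smoothOp (lam : ℝ) {u : SpaceTime (n + 1) → ℝ} (hu : ContDiff ℝ ∞ u)
    (hs : HasCompactSupport u) {k : EuclideanSpace ℝ (Fin n) → ℝ} (hk : Continuous k)
    (z : ℝ × ℝ) : kernelInt k (smoothOp a lam u) z = kernelInt k (dirDeriv (timeDir (n + 1)) u) z
      + ∑ j, ∑ l, a z.1 z.2 j l * kernelInt k (dirDeriv (spaceDir l) (dirDeriv (spaceDir j) u)) z
      - lam * kernelInt k u z := by
  have it := integrable_kernel hk (hu.dirDeriv (timeDir (n + 1))).continuous (hs.dirDeriv _) z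
  have iu := (integrable_kernel hk hu.continuous hs z).const_mul lam
  have ix : ∀ j l, Integrable fun y => a z.1 z.2 j l
      * (k y * dirDeriv (spaceDir l) (dirDeriv (spaceDir j) u) (splitST n (z, y))) := fun j l =>
    (integrable_kernel hk ((hu.dirDeriv _).dirDeriv _).continuous
      ((hs.dirDeriv _).dirDeriv _) z).const_mul _
  have e : ∀ y, k y * smoothOp a lam u (splitST n (z, y))
      = k y * dirDeriv (timeDir (n + 1)) u (splitST n (z, y))
        + ∑ j, ∑ l, a z.1 z.2 j l
          * (k y * dirDeriv (spaceDir l) (dirDeriv (spaceDir j) u) (splitST n (z, y)))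
        - lam * (k y * u (splitST n (z, y))) := by
    intro y
    have e1 : (splitST n (z, y)).1 = z.1 := rfl
    have e2 : (splitST n (z, y)).2 0 = z.2 := rfl
    rw [smoothOp, e1, e2, mul_sub, mul_add, Finset.mul_sum]
    rw [mul_left_comm (k y) lam]
    refine congrArg (_ + · - _) (Finset.sum_congr rfl fun j _ => ?_)
    rw [Finset.mul_sum]
    exact Finset.sum_congr rfl fun l _ => by ring
  rw [kernelInt]
  simp only [e]
  have isum : Integrable fun y => ∑ j, ∑ l, a z.1 z.2 j l
          * (k y * dirDeriv (spaceDir l) (dirDeriv (spaceDir j) u) (splitST n (z, y))) :=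
    integrable_finsetSum _ fun j _ => integrable_finsetSum _ fun l _ => ix j l
  have iadd : Integrable fun y => k y * dirDeriv (timeDir (n + 1)) u (splitST n (z, y))
      + ∑ j, ∑ l, a z.1 z.2 j l
        * (k y * dirDeriv (spaceDir l) (dirDeriv (spaceDir j) u) (splitST n (z, y))) :=
    it.add isum
  rw [integral_sub iadd iu, integral_add it isum, integral_const_mul,
    integral_finsetSum _ fun j _ => integrable_finsetSum _ fun l _ => ix j l]
  refine congrArg (_ + · - _) (Finset.sum_congr rfl fun j _ => ?_)
  rw [integral_finsetSum _ fun l _ => ix j l]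
  refine Finset.sum_congr rfl fun l _ => ?_
  rw [integral_const_mul]
  rfl

/-- Real part of the symbol calculation with `ζ = 2πξ`. Symmetry of `a` merges the two mixed sums
into the factor `2`. -/
theorem sum_coeff_cos {u : SpaceTime (n + 1) → ℝ} (h : IsAdmissible δ a) (hu : ContDiff ℝ ∞ u)
    (hs : HasCompactSupport u) (ξ : EuclideanSpace ℝ (Fin n)) (z : ℝ × ℝ) :
    ∑ j, ∑ l, a z.1 z.2 j l
        * kernelInt (cosKernel ξ) (dirDeriv (spaceDir l) (dirDeriv (spaceDir j) u)) z
      = a z.1 z.2 0 0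
          * kernelInt (cosKernel ξ) (dirDeriv (spaceDir 0) (dirDeriv (spaceDir 0) u)) z
        - 2 * (∑ k : Fin n, a z.1 z.2 0 k.succ * (2 * Real.pi * ξ k))
          * kernelInt (sinKernel ξ) (dirDeriv (spaceDir 0) u) z
        - (∑ j : Fin n, ∑ k : Fin n, a z.1 z.2 j.succ k.succ * (2 * Real.pi * ξ j)
          * (2 * Real.pi * ξ k)) * kernelInt (cosKernel ξ) u z := by
  have hu0 := hu.dirDeriv (spaceDir (0 : Fin (n + 1)))
  have hs0 := hs.dirDeriv (spaceDir (0 : Fin (n + 1)))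
  simp only [Fin.sum_univ_succ, Finset.sum_add_distrib,
    fun i : Fin n => dirDeriv_comm hu (spaceDir 0) (spaceDir i.succ),
    kernelInt_cos_succ hu0 hs0,
    fun i j : Fin n => kernelInt_cos_succ (hu.dirDeriv (spaceDir j.succ)) (hs.dirDeriv _) ξ i z,
    kernelInt_sin_succ hu hs]
  have e1 : ∑ x : Fin n, a z.1 z.2 x.succ 0 * (-(2 * Real.pi * ξ x)
        * kernelInt (sinKernel ξ) (dirDeriv (spaceDir 0) u) z)
      = -((∑ k : Fin n, a z.1 z.2 0 k.succ * (2 * Real.pi * ξ k))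
          * kernelInt (sinKernel ξ) (dirDeriv (spaceDir 0) u) z) := by
    rw [Finset.sum_mul, ← Finset.sum_neg_distrib]
    refine Finset.sum_congr rfl fun x _ => ?_
    rw [h.symmetric _ _ x.succ 0]; ring
  have e2 : ∑ x : Fin n, a z.1 z.2 0 x.succ * (-(2 * Real.pi * ξ x)
        * kernelInt (sinKernel ξ) (dirDeriv (spaceDir 0) u) z)
      = -((∑ k : Fin n, a z.1 z.2 0 k.succ * (2 * Real.pi * ξ k))
          * kernelInt (sinKernel ξ) (dirDeriv (spaceDir 0) u) z) := by
    rw [Finset.sum_mul, ← Finset.sum_neg_distrib]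
    exact Finset.sum_congr rfl fun x _ => by ring
  have e3 : ∑ x : Fin n, ∑ y : Fin n, a z.1 z.2 x.succ y.succ * (-(2 * Real.pi * ξ y)
        * (2 * Real.pi * ξ x * kernelInt (cosKernel ξ) u z))
      = -((∑ j : Fin n, ∑ k : Fin n, a z.1 z.2 j.succ k.succ * (2 * Real.pi * ξ j)
          * (2 * Real.pi * ξ k)) * kernelInt (cosKernel ξ) u z) := by
    rw [Finset.sum_mul, ← Finset.sum_neg_distrib]
    refine Finset.sum_congr rfl fun x _ => ?_
    rw [Finset.sum_mul, ← Finset.sum_neg_distrib]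
    exact Finset.sum_congr rfl fun y _ => by ring
  rw [e1, e2, e3]; ring

theorem sum_coeff_sin {u : SpaceTime (n + 1) → ℝ} (h : IsAdmissible δ a) (hu : ContDiff ℝ ∞ u)
    (hs : HasCompactSupport u) (ξ : EuclideanSpace ℝ (Fin n)) (z : ℝ × ℝ) :
    ∑ j, ∑ l, a z.1 z.2 j l
        * kernelInt (sinKernel ξ) (dirDeriv (spaceDir l) (dirDeriv (spaceDir j) u)) z
      = a z.1 z.2 0 0
          * kernelInt (sinKernel ξ) (dirDeriv (spaceDir 0) (dirDeriv (spaceDir 0) u)) z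
        + 2 * (∑ k : Fin n, a z.1 z.2 0 k.succ * (2 * Real.pi * ξ k))
          * kernelInt (cosKernel ξ) (dirDeriv (spaceDir 0) u) z
        - (∑ j : Fin n, ∑ k : Fin n, a z.1 z.2 j.succ k.succ * (2 * Real.pi * ξ j)
          * (2 * Real.pi * ξ k)) * kernelInt (sinKernel ξ) u z := by
  have hu0 := hu.dirDeriv (spaceDir (0 : Fin (n + 1)))
  have hs0 := hs.dirDeriv (spaceDir (0 : Fin (n + 1)))
  simp only [Fin.sum_univ_succ, Finset.sum_add_distrib,
    fun i : Fin n => dirDeriv_comm hu (spaceDir 0) (spaceDir i.succ),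
    kernelInt_sin_succ hu0 hs0,
    fun i j : Fin n => kernelInt_sin_succ (hu.dirDeriv (spaceDir j.succ)) (hs.dirDeriv _) ξ i z,
    kernelInt_cos_succ hu hs]
  have e1 : ∑ x : Fin n, a z.1 z.2 x.succ 0 * (2 * Real.pi * ξ x
        * kernelInt (cosKernel ξ) (dirDeriv (spaceDir 0) u) z)
      = (∑ k : Fin n, a z.1 z.2 0 k.succ * (2 * Real.pi * ξ k))
          * kernelInt (cosKernel ξ) (dirDeriv (spaceDir 0) u) z := by
    rw [Finset.sum_mul]
    refine Finset.sum_congr rfl fun x _ => ?_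
    rw [h.symmetric _ _ x.succ 0]; ring
  have e2 : ∑ x : Fin n, a z.1 z.2 0 x.succ * (2 * Real.pi * ξ x
        * kernelInt (cosKernel ξ) (dirDeriv (spaceDir 0) u) z)
      = (∑ k : Fin n, a z.1 z.2 0 k.succ * (2 * Real.pi * ξ k))
          * kernelInt (cosKernel ξ) (dirDeriv (spaceDir 0) u) z := by
    rw [Finset.sum_mul]
    exact Finset.sum_congr rfl fun x _ => by ring
  have e3 : ∑ x : Fin n, ∑ y : Fin n, a z.1 z.2 x.succ y.succ * (2 * Real.pi * ξ y
        * (-(2 * Real.pi * ξ x) * kernelInt (sinKernel ξ) u z))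
      = -((∑ j : Fin n, ∑ k : Fin n, a z.1 z.2 j.succ k.succ * (2 * Real.pi * ξ j)
          * (2 * Real.pi * ξ k)) * kernelInt (sinKernel ξ) u z) := by
    rw [Finset.sum_mul, ← Finset.sum_neg_distrib]
    refine Finset.sum_congr rfl fun x _ => ?_
    rw [Finset.sum_mul, ← Finset.sum_neg_distrib]
    exact Finset.sum_congr rfl fun y _ => by ring
  rw [e1, e2, e3]; ring

/-- The function need not be continuous in `(t, x¹)`, but for fixed `(t, x¹)` the coefficients are
constants and the slice in `y` is a test function, which is all that Plancherel asks. -/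
theorem freqEnergy_smoothOp_integral (h : IsAdmissible δ a) (hδ : 0 < δ) (lam : ℝ)
    {u : SpaceTime (n + 1) → ℝ} (hu : ContDiff ℝ ∞ u) (hs : HasCompactSupport u) :
    Integrable (fun ξ => freqEnergy ξ (smoothOp a lam u)) ∧
      ∫ ξ, freqEnergy ξ (smoothOp a lam u) = rnorm volume (smoothOp a lam u) ^ 2 := by
  have hL : ∀ k : EuclideanSpace ℝ (Fin n) → ℝ, Continuous k →
      MemLp (kernelInt k (smoothOp a lam u)) 2 volume := by
    intro k hk
    have m : ∀ w : SpaceTime (n + 1) → ℝ, ContDiff ℝ ∞ w → HasCompactSupport w →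
        MemLp (kernelInt k w) 2 volume := fun w hw hws =>
      (continuous_kernelInt hk hw.continuous hws).memLp_two (hasCompactSupport_kernelInt hws)
    rw [funext (kernelInt_smoothOp lam hu hs hk)]
    refine MemLp.sub (MemLp.add (m _ (hu.dirDeriv _) (hs.dirDeriv _)) ?_) ((m u hu hs).const_mul _)
    refine memLp_finsetSum _ fun j _ => memLp_finsetSum _ fun l _ => ?_
    exact memLp_bounded_mul (h.measurable j l).aestronglyMeasurable (fun z => h.abs_coeff_le hδ _ _ _ _)
      (m _ ((hu.dirDeriv _).dirDeriv _) ((hs.dirDeriv _).dirDeriv _))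
  have hsl : ∀ (w : SpaceTime (n + 1) → ℝ) (z : ℝ × ℝ), ContDiff ℝ ∞ w →
      ContDiff ℝ ∞ fun y => w (splitST n (z, y)) := fun w z hw =>
    hw.comp ((splitST n).contDiff.comp (contDiff_prodMk_right z))
  refine integrable_partialFourier (memLp_smoothOp h hδ lam hu hs) (fun z => ?_) (fun z => ?_)
    (fun ξ => hL _ (contDiff_cosKernel ξ).continuous)
    (fun ξ => hL _ (contDiff_sinKernel ξ).continuous)
  · refine ContDiff.sub (ContDiff.add (hsl _ z (hu.dirDeriv _)) ?_)
      (contDiff_const.mul (hsl _ z hu))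
    refine ContDiff.sum fun j _ => ContDiff.sum fun l _ => ?_
    exact (contDiff_const (c := a z.1 z.2 j l)).mul (hsl _ z ((hu.dirDeriv _).dirDeriv _))
  · have hc : HasCompactSupport (smoothOp a lam u) := by
      refine HasCompactSupport.intro hs.isCompact fun q hq => ?_
      have e : ∀ v w, dirDeriv v (dirDeriv w u) q = 0 := fun v w =>
        image_eq_zero_of_notMem_tsupport fun hm => hq
          (tsupport_fderiv_apply_subset ℝ w (tsupport_fderiv_apply_subset ℝ v hm))
      have e' : ∀ v, dirDeriv v u q = 0 := fun v => image_eq_zero_of_notMem_tsupport fun hm => hq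
          (tsupport_fderiv_apply_subset ℝ v hm)
      simp [smoothOp, e, e', image_eq_zero_of_notMem_tsupport hq]
    exact hasCompactSupport_slice hc z

/-- The a priori estimate for smooth compactly supported functions. -/
theorem exists_smooth_estimate {δ : ℝ} (hδ : 0 < δ) : ∃ C : ℝ, 0 ≤ C ∧
    ∀ (n : ℕ) (a : ℝ → ℝ → Matrix (Fin (n + 1)) (Fin (n + 1)) ℝ), IsAdmissible δ a →
    ∀ lam : ℝ, 0 ≤ lam → ∀ u : SpaceTime (n + 1) → ℝ, ContDiff ℝ ∞ u → HasCompactSupport u →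
    rnorm volume (dirDeriv (timeDir (n + 1)) u) ^ 2
      + ∑ j, ∑ k, rnorm volume (dirDeriv (spaceDir k) (dirDeriv (spaceDir j) u)) ^ 2
      + lam * ∑ j, rnorm volume (dirDeriv (spaceDir j) u) ^ 2
      + lam ^ 2 * rnorm volume u ^ 2 ≤ C * rnorm volume (smoothOp a lam u) ^ 2 := by
  obtain ⟨C, hC, hest⟩ := exists_frequency_estimate hδ
  refine ⟨C, hC, fun n a ha lam hlam u hu hs => ?_⟩
  have key : ∀ ξ : EuclideanSpace ℝ (Fin n), freqEnergy ξ (dirDeriv (timeDir (n + 1)) u)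
      + ∑ j, ∑ k, freqEnergy ξ (dirDeriv (spaceDir k) (dirDeriv (spaceDir j) u))
      + lam * ∑ j, freqEnergy ξ (dirDeriv (spaceDir j) u)
      + lam ^ 2 * freqEnergy ξ u ≤ C * freqEnergy ξ (smoothOp a lam u) := by
    intro ξ
    have hκ : 0 ≤ 2 * Real.pi * ‖ξ‖ := by positivity
    have hζ : ∑ i, (2 * Real.pi * ξ i) ^ 2 = (2 * Real.pi * ‖ξ‖) ^ 2 := by
      simp only [mul_pow, ← Finset.mul_sum, EuclideanSpace.real_norm_sq_eq]
    have h1 := hest _ lam _ _ _ hκ hlam (ha.isFrequencyCoeff hδ hκ _ hζ) _ _ _ _ _ _ _ _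
      (kernelInt (cosKernel ξ) (smoothOp a lam u)) (kernelInt (sinKernel ξ) (smoothOp a lam u))
      (hasParabolicDerivs_kernelInt (contDiff_cosKernel ξ).continuous hu hs)
      (hasParabolicDerivs_kernelInt (contDiff_sinKernel ξ).continuous hu hs)
      (fun z => by
        rw [kernelInt_smoothOp lam hu hs (contDiff_cosKernel ξ).continuous,
          sum_coeff_cos ha hu hs]; ring)
      (fun z => by
        rw [kernelInt_smoothOp lam hu hs (contDiff_sinKernel ξ).continuous,
          sum_coeff_sin ha hu hs]; ring)
    refine le_trans (le_of_eq ?_) h1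
    have hu0 := hu.dirDeriv (spaceDir (0 : Fin (n + 1)))
    have hs0 := hs.dirDeriv (spaceDir (0 : Fin (n + 1)))
    -- Splitting off the first coordinate, the second derivatives contribute `v_xx` once, `κ v_x`
    -- twice (both orders of the mixed derivatives) and `κ² v` once.
    simp only [Fin.sum_univ_succ, Finset.sum_add_distrib,
      fun i : Fin n => dirDeriv_comm hu (spaceDir 0) (spaceDir i.succ),
      sum_freqEnergy_succ hu0 hs0, sum_freqEnergy_succ hu hs,
      fun j : Fin n => sum_freqEnergy_succ (hu.dirDeriv (spaceDir j.succ)) (hs.dirDeriv _) ξ,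
      ← Finset.mul_sum]
    simp only [freqEnergy]
    ring
  have it := freqEnergy_integral (hu.dirDeriv (timeDir (n + 1))) (hs.dirDeriv _)
  have ij := fun j : Fin (n + 1) => freqEnergy_integral (hu.dirDeriv (spaceDir j)) (hs.dirDeriv _)
  have ijk := fun j k : Fin (n + 1) => freqEnergy_integral
    ((hu.dirDeriv (spaceDir j)).dirDeriv (spaceDir k)) ((hs.dirDeriv _).dirDeriv _)
  have iu := freqEnergy_integral hu hs
  have iF := freqEnergy_smoothOp_integral ha hδ lam hu hs
  have sj : Integrable fun ξ => ∑ j, freqEnergy ξ (dirDeriv (spaceDir j) u) :=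
    integrable_finsetSum _ fun j _ => (ij j).1
  have sjk : Integrable fun ξ =>
      ∑ j, ∑ k, freqEnergy ξ (dirDeriv (spaceDir k) (dirDeriv (spaceDir j) u)) :=
    integrable_finsetSum _ fun j _ => integrable_finsetSum _ fun k _ => (ijk j k).1
  have i2 : Integrable fun ξ => freqEnergy ξ (dirDeriv (timeDir (n + 1)) u)
      + ∑ j, ∑ k, freqEnergy ξ (dirDeriv (spaceDir k) (dirDeriv (spaceDir j) u)) := it.1.add sjk
  have i3 : Integrable fun ξ => freqEnergy ξ (dirDeriv (timeDir (n + 1)) u)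
      + ∑ j, ∑ k, freqEnergy ξ (dirDeriv (spaceDir k) (dirDeriv (spaceDir j) u))
      + lam * ∑ j, freqEnergy ξ (dirDeriv (spaceDir j) u) := i2.add (sj.const_mul lam)
  have hint := integral_mono (i3.add (iu.1.const_mul (lam ^ 2))) (iF.1.const_mul C) key
  simp only [Pi.add_apply] at hint
  rw [integral_add i3 (iu.1.const_mul (lam ^ 2)),
    integral_add i2 (sj.const_mul lam), integral_add it.1 sjk, integral_const_mul,
    integral_const_mul, integral_const_mul, it.2, iu.2, iF.2,
    integral_finsetSum _ fun j _ => (ij j).1,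
    integral_finsetSum _ fun j _ => integrable_finsetSum _ fun k _ => (ijk j k).1] at hint
  simp only [fun j => integral_finsetSum Finset.univ fun k _ => (ijk j k).1, (ij _).2,
    (ijk _ _).2] at hint
  exact hint

end SmoothEstimate

instance SpaceTime.isAddHaarMeasure_volume (d : ℕ) :
    (volume : Measure (SpaceTime d)).IsAddHaarMeasure :=
  Measure.prod.instIsAddHaarMeasure volume volume

/-! ### Mollification in `L²`. -/

section Mollification

variable {d : ℕ} {k g : SpaceTime d → ℝ}

/-- Convolution of `k` with `g`. -/
noncomputable def mollify (k g : SpaceTime d → ℝ) (z : SpaceTime d) : ℝ := ∫ w, k w * g (z - w)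

theorem mollify_eq_convolution :
    mollify k g = convolution k g (ContinuousLinearMap.mul ℝ ℝ) volume := rfl

theorem mollify_eq_swap (z : SpaceTime d) : mollify k g z = ∫ w, k (z - w) * g w := by
  rw [mollify, ← integral_sub_left_eq_self (fun w => k w * g (z - w)) volume z]
  simp

theorem contDiff_mollify (hk : ContDiff ℝ ∞ k) (hs : HasCompactSupport k) (hg : MemLp g 2 volume) :
    ContDiff ℝ ∞ (mollify k g) :=
  hs.contDiff_convolution_left (ContinuousLinearMap.mul ℝ ℝ) hk (hg.locallyIntegrable (by norm_num))

theorem dirDeriv_mollify (hk : ContDiff ℝ ∞ k) (hs : HasCompactSupport k) (hg : MemLp g 2 volume)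
    (v : SpaceTime d) : dirDeriv v (mollify k g) = mollify (dirDeriv v k) g := by
  ext z
  have hl : LocallyIntegrable g volume := hg.locallyIntegrable (by norm_num)
  have h1 := hs.hasFDerivAt_convolution_left (ContinuousLinearMap.mul ℝ ℝ) (hk.of_le (by simp)) hl z
  rw [dirDeriv, mollify_eq_convolution, h1.fderiv]
  have h2 := (hs.fderiv ℝ).convolutionExists_left
    ((ContinuousLinearMap.mul ℝ ℝ).precompL (SpaceTime d)) (hk.continuous_fderiv (by simp)) hl z
  rw [convolution_def, ContinuousLinearMap.integral_apply h2]
  rfl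

theorem hasCompactSupport_mollify (hs : HasCompactSupport k) (hg : HasCompactSupport g) :
    HasCompactSupport (mollify k g) :=
  HasCompactSupport.convolution (L := ContinuousLinearMap.mul ℝ ℝ) hs hg

/-- Weak derivatives, for functions. -/
def WeakDerivFun (v : SpaceTime d) (u g : SpaceTime d → ℝ) : Prop :=
  ∀ φ : SpaceTime d → ℝ, ContDiff ℝ ∞ φ → HasCompactSupport φ →
    ∫ z, u z * fderiv ℝ φ z v = -∫ z, g z * φ z

/-- The definition of the weak derivative, tested with the reflected and translated kernel `k(z -
·)`; the reflection supplies the sign. -/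
theorem mollify_weakDeriv {v : SpaceTime d} {u g : SpaceTime d → ℝ} (h : WeakDerivFun v u g)
    (hk : ContDiff ℝ ∞ k) (hs : HasCompactSupport k) :
    mollify (dirDeriv v k) u = mollify k g := by
  ext z
  rw [mollify_eq_swap, mollify_eq_swap]
  have hφ : ContDiff ℝ ∞ fun w => k (z - w) := hk.comp (contDiff_const.sub contDiff_id)
  have hφs : HasCompactSupport fun w => k (z - w) :=
    hs.comp_homeomorph (Homeomorph.subLeft z)
  have hd : ∀ w, fderiv ℝ (fun w => k (z - w)) w v = -dirDeriv v k (z - w) := fun w => by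
    have h1 : HasFDerivAt (fun w : SpaceTime d => z - w) (-ContinuousLinearMap.id ℝ _) w := by
      simpa using (hasFDerivAt_id w).const_sub z
    have h2 := ((hk.differentiable (by simp) (z - w)).hasFDerivAt.comp w h1).fderiv
    change fderiv ℝ (k ∘ fun w => z - w) w v = _
    rw [h2]
    simp [dirDeriv]
  have h3 := h _ hφ hφs
  simp only [hd, mul_neg, integral_neg, neg_inj] at h3
  simpa only [mul_comm] using h3

/-- Cauchy–Schwarz with `|K| = |K|^{1/2} |K|^{1/2}`, then Tonelli. A general `G` allows `g(z - w)`,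
which bounds the convolution, and also `g(z - w) - g(z)`, which gives its convergence. -/
theorem lintegral_sq_convolution_le {α : Type*} [MeasurableSpace α] {ν : Measure α} [SFinite ν]
    {K : α → ℝ} (hK : AEMeasurable K ν) {G : α → α → ℝ}
    (hG : AEMeasurable (fun q : α × α => G q.1 q.2) (ν.prod ν)) :
    ∫⁻ z, ‖∫ w, K w * G z w ∂ν‖ₑ ^ 2 ∂ν
      ≤ (∫⁻ w, ‖K w‖ₑ ∂ν) * ∫⁻ w, ‖K w‖ₑ * ∫⁻ z, ‖G z w‖ₑ ^ 2 ∂ν ∂ν := by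
  have hsec : ∀ᵐ z ∂ν, AEMeasurable (G z) ν :=
    hG.aestronglyMeasurable.prodMk_left.mono fun _ h => h.aemeasurable
  have hpt : ∀ᵐ z ∂ν, ‖∫ w, K w * G z w ∂ν‖ₑ ^ 2
      ≤ (∫⁻ w, ‖K w‖ₑ ∂ν) * ∫⁻ w, ‖K w‖ₑ * ‖G z w‖ₑ ^ 2 ∂ν := by
    filter_upwards [hsec] with z hz
    have h1 : ‖∫ w, K w * G z w ∂ν‖ₑ ≤ ∫⁻ w, ‖K w‖ₑ ^ (1 / 2 : ℝ)
        * (‖K w‖ₑ ^ (1 / 2 : ℝ) * ‖G z w‖ₑ) ∂ν := by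
      refine (enorm_integral_le_lintegral_enorm _).trans (le_of_eq ?_)
      refine lintegral_congr fun w => ?_
      rw [enorm_mul, ← mul_assoc, ← ENNReal.rpow_add_of_nonneg _ _ (by norm_num) (by norm_num)]
      norm_num
    have h2 := ENNReal.lintegral_mul_le_Lp_mul_Lq ν Real.HolderConjugate.two_two
      (f := fun w => ‖K w‖ₑ ^ (1 / 2 : ℝ)) (g := fun w => ‖K w‖ₑ ^ (1 / 2 : ℝ) * ‖G z w‖ₑ)
      (hK.enorm.pow_const _) ((hK.enorm.pow_const _).mul hz.enorm)
    have e1 : ∀ w, (‖K w‖ₑ ^ (1 / 2 : ℝ)) ^ (2 : ℝ) = ‖K w‖ₑ := fun w => by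
      rw [← ENNReal.rpow_mul]; norm_num
    have e2 : ∀ w, (‖K w‖ₑ ^ (1 / 2 : ℝ) * ‖G z w‖ₑ) ^ (2 : ℝ) = ‖K w‖ₑ * ‖G z w‖ₑ ^ 2 :=
      fun w => by
        rw [ENNReal.mul_rpow_of_nonneg _ _ (by norm_num), e1, ENNReal.rpow_ofNat]
    simp only [Pi.mul_apply, e1, e2] at h2
    have h3 := pow_le_pow_left₀ zero_le (h1.trans h2) 2
    refine h3.trans (le_of_eq ?_)
    rw [mul_pow, ← ENNReal.rpow_ofNat, ← ENNReal.rpow_ofNat, ← ENNReal.rpow_mul,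
      ← ENNReal.rpow_mul]
    norm_num
  have hm : AEMeasurable (fun q : α × α => ‖K q.2‖ₑ * ‖G q.1 q.2‖ₑ ^ 2) (ν.prod ν) :=
    (hK.enorm.comp_snd).mul (hG.enorm.pow_const _)
  calc ∫⁻ z, ‖∫ w, K w * G z w ∂ν‖ₑ ^ 2 ∂ν
      ≤ ∫⁻ z, (∫⁻ w, ‖K w‖ₑ ∂ν) * ∫⁻ w, ‖K w‖ₑ * ‖G z w‖ₑ ^ 2 ∂ν ∂ν := lintegral_mono_ae hpt
    _ = (∫⁻ w, ‖K w‖ₑ ∂ν) * ∫⁻ z, ∫⁻ w, ‖K w‖ₑ * ‖G z w‖ₑ ^ 2 ∂ν ∂ν :=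
      lintegral_const_mul'' _ hm.lintegral_prod_right'
    _ = (∫⁻ w, ‖K w‖ₑ ∂ν) * ∫⁻ w, ∫⁻ z, ‖K w‖ₑ * ‖G z w‖ₑ ^ 2 ∂ν ∂ν := by
      rw [lintegral_lintegral_swap hm]
    _ = _ := by
      congr 1
      have hsec' : ∀ᵐ w ∂ν, AEMeasurable (fun z => G z w) ν :=
        hG.prod_swap.aestronglyMeasurable.prodMk_left.mono fun _ h => h.aemeasurable
      refine lintegral_congr_ae ?_
      filter_upwards [hsec'] with w hw
      exact lintegral_const_mul'' _ (hw.enorm.pow_const _)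

theorem eLpNorm_two_sq {α : Type*} [MeasurableSpace α] {ν : Measure α} (f : α → ℝ) :
    eLpNorm f 2 ν ^ 2 = ∫⁻ z, ‖f z‖ₑ ^ 2 ∂ν := by
  rw [eLpNorm_eq_lintegral_rpow_enorm_toReal (by norm_num) (by norm_num), ← ENNReal.rpow_natCast,
    ← ENNReal.rpow_mul]
  simp

theorem aemeasurable_comp_sub (hg : MemLp g 2 volume) :
    AEMeasurable (fun q : SpaceTime d × SpaceTime d => g (q.1 - q.2)) (volume.prod volume) :=
  hg.1.aemeasurable.comp_quasiMeasurePreserving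
    (quasiMeasurePreserving_sub (volume : Measure (SpaceTime d)) volume)

theorem memLp_mollify (hk : Continuous k) (hs : HasCompactSupport k) (hg : MemLp g 2 volume)
    (hm : AEStronglyMeasurable (mollify k g) volume) :
    MemLp (mollify k g) 2 volume := by
  refine ⟨hm, ?_⟩
  have h1 := lintegral_sq_convolution_le (ν := volume) (G := fun z w => g (z - w))
    hk.aemeasurable (aemeasurable_comp_sub hg)
  have h2 : ∀ w : SpaceTime d, ∫⁻ z, ‖g (z - w)‖ₑ ^ 2 = eLpNorm g 2 volume ^ 2 := fun w => by
    rw [eLpNorm_two_sq, ← lintegral_sub_right_eq_self (fun z => ‖g z‖ₑ ^ 2) w]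
  simp only [h2] at h1
  have hK : ∫⁻ w, ‖k w‖ₑ < ⊤ := (hk.integrable_of_hasCompactSupport hs).2
  have h3 : eLpNorm (mollify k g) 2 volume ^ 2 < ⊤ := by
    rw [eLpNorm_two_sq]
    refine h1.trans_lt (ENNReal.mul_lt_top hK ?_)
    rw [lintegral_mul_const'' _ hk.aemeasurable.enorm]
    exact ENNReal.mul_lt_top hK (ENNReal.pow_lt_top hg.2)
  by_contra hc
  rw [not_lt, top_le_iff] at hc
  rw [hc] at h3
  simp at h3

theorem continuous_transL2 (G : L2 d) :
    Tendsto (fun w => transL2 volume w G) (𝓝 (0 : SpaceTime d)) (𝓝 G) := by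
  have hc : Continuous fun w : SpaceTime d =>
      (⟨fun z => z + w, by fun_prop⟩ : C(SpaceTime d, SpaceTime d)) := by
    refine ContinuousMap.continuous_of_continuous_uncurry _ ?_
    change Continuous fun q : SpaceTime d × SpaceTime d => q.2 + q.1
    fun_prop
  have h := (continuous_const (y := G)).compMeasurePreservingLp hc
    (fun w => measurePreserving_add_right volume w) (by norm_num)
  have h0 := h.tendsto 0
  have e : Lp.compMeasurePreserving (fun z : SpaceTime d => z + 0)
      (measurePreserving_add_right volume 0) G = G := transL2_zero G
  have h1 : Tendsto (fun w => transL2 volume w G) (𝓝 (0 : SpaceTime d))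
      (𝓝 (Lp.compMeasurePreserving (fun z : SpaceTime d => z + 0)
      (measurePreserving_add_right volume 0) G)) := h0
  rwa [e] at h1

/-- A sequence of mollifiers. -/
noncomputable def bumpSeq (d : ℕ) (n : ℕ) : ContDiffBump (0 : SpaceTime d) where
  rIn := 1 / (2 * (n + 1))
  rOut := 1 / (n + 1)
  rIn_pos := by positivity
  rIn_lt_rOut := by
    apply one_div_lt_one_div_of_lt (by positivity)
    have : (0 : ℝ) < n + 1 := by positivity
    linarith

/-- The normalised mollifiers. -/
noncomputable def mollifier (d : ℕ) (n : ℕ) : SpaceTime d → ℝ := (bumpSeq d n).normed volume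

theorem contDiff_mollifier (n : ℕ) : ContDiff ℝ ∞ (mollifier d n) := (bumpSeq d n).contDiff_normed

theorem hasCompactSupport_mollifier (n : ℕ) : HasCompactSupport (mollifier d n) :=
  (bumpSeq d n).hasCompactSupport_normed

/-- The kernel has unit mass, so the error is an average of `g(z - w) - g(z)` over small `w`;
continuity of translations in `L²` makes it small. -/
theorem tendsto_mollify (hg : MemLp g 2 volume) :
    Tendsto (fun n => rnorm volume (fun z => mollify (mollifier d n) g z - g z)) atTop (𝓝 0) := by
  rw [Metric.tendsto_atTop]
  intro ε hε
  set G := hg.toLp g with hG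
  have hcont := (continuous_transL2 G)
  rw [Metric.tendsto_nhds_nhds] at hcont
  obtain ⟨η, hη, hclose⟩ := hcont (ε / 2) (by positivity)
  obtain ⟨N, hN⟩ := exists_nat_gt (1 / η)
  refine ⟨N, fun n hn => ?_⟩
  set K := mollifier d n with hKdef
  have hKc : Continuous K := (contDiff_mollifier n).continuous
  have hK0 : ∀ w, 0 ≤ K w := fun w => (bumpSeq d n).nonneg_normed w
  have hK1 : ∫ w, K w = 1 := (bumpSeq d n).integral_normed
  have hKi : Integrable K := (bumpSeq d n).integrable_normed
  have hKl : ∫⁻ w, ‖K w‖ₑ = 1 := by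
    have := ofReal_integral_norm_eq_lintegral_enorm hKi
    simp only [fun w => Real.norm_of_nonneg (hK0 w), hK1, ENNReal.ofReal_one] at this
    exact this.symm
  have hsmall : (1 : ℝ) / (n + 1) < η := by
    have h1 : (N : ℝ) ≤ n := by exact_mod_cast hn
    rw [div_lt_iff₀ (by positivity)]
    rw [div_lt_iff₀ hη] at hN
    nlinarith
  have hsupp : ∀ w, K w ≠ 0 → ‖w‖ < η := fun w hw => by
    have : w ∈ Function.support K := hw
    rw [hKdef, mollifier, (bumpSeq d n).support_normed_eq] at this
    have h2 : ‖w‖ < 1 / (n + 1) := by simpa [bumpSeq] using this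
    exact h2.trans hsmall
  have hconv : ∀ z, mollify K g z - g z = ∫ w, K w * (g (z - w) - g z) := by
    intro z
    have hl : LocallyIntegrable g volume := hg.locallyIntegrable (by norm_num)
    have i1 : Integrable fun w => K w * g (z - w) :=
      (hasCompactSupport_mollifier n).convolutionExists_left (ContinuousLinearMap.mul ℝ ℝ) hKc hl z
    simp only [mul_sub]
    rw [integral_sub i1 (hKi.mul_const _), integral_mul_const, hK1, one_mul]
    rfl
  have hGm : AEMeasurable (fun q : SpaceTime d × SpaceTime d => g (q.1 - q.2) - g q.1)
      (volume.prod volume) :=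
    (aemeasurable_comp_sub hg).sub hg.1.aemeasurable.comp_fst
  have h1 := lintegral_sq_convolution_le (ν := volume) (G := fun z w => g (z - w) - g z)
    hKc.aemeasurable hGm
  have h2 : ∀ w, ‖w‖ < η → ∫⁻ z, ‖g (z - w) - g z‖ₑ ^ 2 ≤ ENNReal.ofReal (ε / 2) ^ 2 := by
    intro w hw
    have h3 := hclose (x := -w) (by simpa using hw)
    rw [dist_eq_norm] at h3
    have h4 : eLpNorm (fun z => g (z - w) - g z) 2 volume = ENNReal.ofReal ‖transL2 volume (-w) G - G‖ := by
      rw [Lp.norm_def, ENNReal.ofReal_toReal (Lp.eLpNorm_ne_top _)]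
      refine eLpNorm_congr_ae ?_
      have a1 := (measurePreserving_add_right (volume : Measure (SpaceTime d)) (-w)).quasiMeasurePreserving.ae_eq_comp
        hg.coeFn_toLp
      filter_upwards [Lp.coeFn_sub (transL2 volume (-w) G) G, coeFn_transL2 (-w) G, hg.coeFn_toLp, a1]
        with z b1 b2 b3 b4
      simp only [Function.comp_apply] at b4
      rw [b1, Pi.sub_apply, b2, hG, b3, b4, sub_eq_add_neg z w]
    rw [← eLpNorm_two_sq, h4]
    gcongr
  have h5 : ∫⁻ w, ‖K w‖ₑ * ∫⁻ z, ‖g (z - w) - g z‖ₑ ^ 2 ≤ ENNReal.ofReal (ε / 2) ^ 2 := by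
    calc ∫⁻ w, ‖K w‖ₑ * ∫⁻ z, ‖g (z - w) - g z‖ₑ ^ 2
        ≤ ∫⁻ w, ‖K w‖ₑ * ENNReal.ofReal (ε / 2) ^ 2 := by
          refine lintegral_mono fun w => ?_
          by_cases hw : K w = 0
          · simp [hw]
          · exact mul_le_mul_right (h2 w (hsupp w hw)) _
      _ = _ := by rw [lintegral_mul_const'' _ hKc.aemeasurable.enorm, hKl, one_mul]
  have h6 : eLpNorm (fun z => mollify K g z - g z) 2 volume ^ 2 ≤ ENNReal.ofReal (ε / 2) ^ 2 := by
    rw [eLpNorm_two_sq]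
    simp only [hconv]
    refine h1.trans ?_
    rw [hKl, one_mul]
    exact h5
  have h7 : eLpNorm (fun z => mollify K g z - g z) 2 volume ≤ ENNReal.ofReal (ε / 2) := by
    by_contra hc
    rw [not_le] at hc
    exact absurd (ENNReal.pow_lt_pow_left two_ne_zero hc) (not_lt.2 h6)
  rw [Real.dist_eq, sub_zero, abs_of_nonneg rnorm_nonneg, rnorm]
  have h8 := ENNReal.toReal_mono ENNReal.ofReal_ne_top h7
  rw [ENNReal.toReal_ofReal (by positivity)] at h8
  linarith

end Mollification

/-! ### Calculus of `L²` convergence for sequences of functions. -/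

section Convergence

variable {α : Type*} [MeasurableSpace α] {ν : Measure α}

/-- Convergence in `L²`, for sequences of functions. -/
structure ConvL2 (ν : Measure α) (F : ℕ → α → ℝ) (f : α → ℝ) : Prop where
  memLp : ∀ n, MemLp (F n) 2 ν
  memLp_lim : MemLp f 2 ν
  tendsto : Tendsto (fun n => rnorm ν (fun z => F n z - f z)) atTop (𝓝 0)

theorem ConvL2.of_le {F : ℕ → α → ℝ} {f : α → ℝ} (hF : ∀ n, MemLp (F n) 2 ν) (hf : MemLp f 2 ν)
    {b : ℕ → ℝ} (hb : Tendsto b atTop (𝓝 0)) (h : ∀ n, rnorm ν (fun z => F n z - f z) ≤ b n) :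
    ConvL2 ν F f :=
  ⟨hF, hf, squeeze_zero (fun _ => rnorm_nonneg) h hb⟩

variable {F G : ℕ → α → ℝ} {f g : α → ℝ}

theorem ConvL2.add (hF : ConvL2 ν F f) (hG : ConvL2 ν G g) :
    ConvL2 ν (fun n z => F n z + G n z) (fun z => f z + g z) := by
  refine .of_le (fun n => (hF.memLp n).add (hG.memLp n)) (hF.memLp_lim.add hG.memLp_lim)
    (b := fun n => rnorm ν (fun z => F n z - f z) + rnorm ν (fun z => G n z - g z))
    (by simpa using hF.tendsto.add hG.tendsto) fun n => ?_
  have := rnorm_add_le ((hF.memLp n).sub hF.memLp_lim) ((hG.memLp n).sub hG.memLp_lim)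
  simp only [Pi.sub_apply] at this
  refine le_trans (le_of_eq ?_) this
  congr 1; ext z; ring

theorem ConvL2.const_mul (hF : ConvL2 ν F f) (c : ℝ) :
    ConvL2 ν (fun n z => c * F n z) (fun z => c * f z) := by
  refine .of_le (fun n => (hF.memLp n).const_mul c) (hF.memLp_lim.const_mul c)
    (b := fun n => |c| * rnorm ν (fun z => F n z - f z))
    (by simpa using hF.tendsto.const_mul |c|) fun n => ?_
  rw [← rnorm_const_mul]
  refine le_of_eq ?_
  congr 1; ext z; ring

theorem ConvL2.sub (hF : ConvL2 ν F f) (hG : ConvL2 ν G g) :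
    ConvL2 ν (fun n z => F n z - G n z) (fun z => f z - g z) := by
  have := hF.add (hG.const_mul (-1))
  simpa only [neg_one_mul, ← sub_eq_add_neg] using this

theorem ConvL2.bounded_mul (hF : ConvL2 ν F f) {b : α → ℝ} (hb : AEStronglyMeasurable b ν) {C : ℝ}
    (hC0 : 0 ≤ C) (hC : ∀ z, |b z| ≤ C) : ConvL2 ν (fun n z => b z * F n z) (fun z => b z * f z) := by
  refine .of_le (fun n => memLp_bounded_mul hb hC (hF.memLp n))
    (memLp_bounded_mul hb hC hF.memLp_lim)
    (b := fun n => C * rnorm ν (fun z => F n z - f z))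
    (by simpa using hF.tendsto.const_mul C) fun n => ?_
  refine rnorm_le_mul_of_le ((hF.memLp n).sub hF.memLp_lim) hC0 fun z => ?_
  rw [← mul_sub, abs_mul]
  exact mul_le_mul_of_nonneg_right (hC z) (abs_nonneg _)

theorem ConvL2.sum {ι : Type*} (s : Finset ι) {F : ι → ℕ → α → ℝ} {f : ι → α → ℝ}
    (h : ∀ i ∈ s, ConvL2 ν (F i) (f i)) :
    ConvL2 ν (fun n z => ∑ i ∈ s, F i n z) (fun z => ∑ i ∈ s, f i z) := by
  classical
  induction s using Finset.induction_on with
  | empty =>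
    simp only [Finset.sum_empty]
    refine ⟨fun _ => MemLp.zero', MemLp.zero', ?_⟩
    simp [rnorm]
  | insert i s hi ih =>
    simp only [Finset.sum_insert hi]
    exact (h i (Finset.mem_insert_self i s)).add
      (ih fun j hj => h j (Finset.mem_insert_of_mem hj))

theorem ConvL2.rnorm_tendsto (hF : ConvL2 ν F f) :
    Tendsto (fun n => rnorm ν (F n)) atTop (𝓝 (rnorm ν f)) := by
  rw [tendsto_iff_dist_tendsto_zero]
  refine squeeze_zero (fun _ => dist_nonneg) (fun n => ?_) hF.tendsto
  have h1 := rnorm_add_le ((hF.memLp n).sub hF.memLp_lim) hF.memLp_lim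
  have h2 := rnorm_sub_le (hF.memLp n) ((hF.memLp n).sub hF.memLp_lim)
  simp only [Pi.sub_apply, sub_add_cancel, sub_sub_cancel] at h1 h2
  rw [Real.dist_eq, abs_le]
  constructor
  · have e : rnorm ν f ≤ rnorm ν (F n) + rnorm ν (F n - f) := h2
    have e' : rnorm ν (fun z => F n z - f z) = rnorm ν (F n - f) := rfl
    linarith
  · have e : rnorm ν (F n) ≤ rnorm ν (F n - f) + rnorm ν f := h1
    have e' : rnorm ν (fun z => F n z - f z) = rnorm ν (F n - f) := rfl
    linarith

/-- Dominated convergence for the squares, with majorant `(M + |b₀|)² f²`. It serves the cutoffs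
(`b₀ = 1`) and their derivatives (`b₀ = 0`). -/
theorem convL2_mul_of_tendsto {b : ℕ → α → ℝ} {b₀ : ℝ} {M : ℝ}
    (hb : ∀ n, AEStronglyMeasurable (b n) ν) (hM : ∀ n z, |b n z| ≤ M)
    (hlim : ∀ z, Tendsto (fun n => b n z) atTop (𝓝 b₀)) (hf : MemLp f 2 ν) :
    ConvL2 ν (fun n z => b n z * f z) (fun z => b₀ * f z) := by
  have m : ∀ n, MemLp (fun z => b n z * f z) 2 ν := fun n => memLp_bounded_mul (hb n) (hM n) hf
  have m0 : MemLp (fun z => b₀ * f z) 2 ν := hf.const_mul b₀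
  refine ⟨m, m0, ?_⟩
  have hsq : Tendsto (fun n => rnorm ν (fun z => b n z * f z - b₀ * f z) ^ 2) atTop (𝓝 0) := by
    have e : ∀ n, rnorm ν (fun z => b n z * f z - b₀ * f z) ^ 2
        = ∫ z, (b n z * f z - b₀ * f z) ^ 2 ∂ν := fun n => rnorm_sq_eq_integral ((m n).sub m0)
    simp only [e]
    have h0 : (0 : ℝ) = ∫ z, (0 : ℝ) ∂ν := by simp
    rw [h0]
    refine tendsto_integral_of_dominated_convergence (fun z => (M + |b₀|) ^ 2 * f z ^ 2)
      (fun n => (((m n).sub m0).1.pow 2)) (hf.integrable_sq.const_mul _) (fun n => ?_) ?_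
    · refine Eventually.of_forall fun z => ?_
      have h1 : |b n z - b₀| ≤ M + |b₀| := (abs_sub _ _).trans (by linarith [hM n z])
      rw [Real.norm_of_nonneg (sq_nonneg _), ← sub_mul, mul_pow]
      refine mul_le_mul_of_nonneg_right ?_ (sq_nonneg _)
      rw [← sq_abs]
      exact pow_le_pow_left₀ (abs_nonneg _) h1 2
    · refine Eventually.of_forall fun z => ?_
      have := (((hlim z).mul_const (f z)).sub_const (b₀ * f z)).pow 2
      simpa using this
  have := hsq.sqrt
  simpa [Real.sqrt_sq rnorm_nonneg] using this

end Convergence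

/-! ### Density of test functions in `W^{1,2}_2`. -/

section Density

variable {d : ℕ}

theorem dirDeriv_scale {f : SpaceTime d → ℝ} (hf : ContDiff ℝ ∞ f) (c : ℝ) (v : SpaceTime d) :
    dirDeriv v (fun z => f (c • z)) = fun z => c * dirDeriv v f (c • z) := by
  ext z
  have h1 : HasFDerivAt (fun z : SpaceTime d => c • z) (c • ContinuousLinearMap.id ℝ _) z :=
    (hasFDerivAt_id z).const_smul c
  have h2 := ((hf.differentiable (by simp) (c • z)).hasFDerivAt.comp z h1).fderiv
  change fderiv ℝ (f ∘ fun z => c • z) z v = _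
  rw [h2]
  simp [dirDeriv]

/-- The smooth cutoff function. -/
noncomputable def cutoffBase (d : ℕ) : ContDiffBump (0 : SpaceTime d) := ⟨1, 2, one_pos, one_lt_two⟩

/-- Smooth cutoff functions that tend to `1`. -/
noncomputable def cutoff (d n : ℕ) (z : SpaceTime d) : ℝ := cutoffBase d ((1 / ((n : ℝ) + 1)) • z)

theorem contDiff_cutoff (n : ℕ) : ContDiff ℝ ∞ (cutoff d n) :=
  (cutoffBase d).contDiff.comp (contDiff_const_smul _)

theorem hasCompactSupport_cutoff (n : ℕ) : HasCompactSupport (cutoff d n) :=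
  (cutoffBase d).hasCompactSupport.comp_smul (by positivity)

theorem abs_cutoff_le (n : ℕ) (z : SpaceTime d) : |cutoff d n z| ≤ 1 := by
  rw [cutoff, abs_of_nonneg (cutoffBase d).nonneg]
  exact (cutoffBase d).le_one

theorem tendsto_cutoff (z : SpaceTime d) : Tendsto (fun n => cutoff d n z) atTop (𝓝 1) := by
  have h1 : Tendsto (fun n : ℕ => (1 / ((n : ℝ) + 1)) • z) atTop (𝓝 ((0 : ℝ) • z)) :=
    tendsto_one_div_add_atTop_nhds_zero_nat.smul_const z
  have h2 := ((cutoffBase d).continuous.tendsto _).comp h1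
  rw [zero_smul] at h2
  rwa [(cutoffBase d).one_of_mem_closedBall
    (Metric.mem_closedBall_self (cutoffBase d).rIn_pos.le)] at h2

theorem exists_bound_scaled {f : SpaceTime d → ℝ} (hf : Continuous f) (hs : HasCompactSupport f) :
    ∃ M, (∀ (n : ℕ) z, |1 / ((n : ℝ) + 1) * f ((1 / ((n : ℝ) + 1)) • z)| ≤ M) ∧
      ∀ z, Tendsto (fun n : ℕ => 1 / ((n : ℝ) + 1) * f ((1 / ((n : ℝ) + 1)) • z)) atTop (𝓝 0) := by
  obtain ⟨M, hM⟩ := hs.exists_bound_of_continuous hf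
  have hM0 : 0 ≤ M := (norm_nonneg _).trans (hM 0)
  have hb : ∀ (n : ℕ) z, |1 / ((n : ℝ) + 1) * f ((1 / ((n : ℝ) + 1)) • z)|
      ≤ 1 / ((n : ℝ) + 1) * M := fun n z => by
    rw [abs_mul, abs_of_nonneg (by positivity : (0 : ℝ) ≤ 1 / ((n : ℝ) + 1))]
    exact mul_le_mul_of_nonneg_left (hM _) (by positivity)
  refine ⟨M, fun n z => (hb n z).trans ?_, fun z => ?_⟩
  · have : 1 / ((n : ℝ) + 1) ≤ 1 := by
      rw [div_le_one (by positivity)]; linarith [Nat.cast_nonneg (α := ℝ) n]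
    nlinarith
  · refine squeeze_zero_norm (fun n => hb n z) ?_
    simpa using tendsto_one_div_add_atTop_nhds_zero_nat.mul_const M

theorem convL2_cutoff {g : SpaceTime d → ℝ} (hg : MemLp g 2 volume) :
    ConvL2 volume (fun n z => cutoff d n z * g z) g := by
  have := convL2_mul_of_tendsto (fun n => (contDiff_cutoff (d := d) n).continuous.aestronglyMeasurable)
    abs_cutoff_le tendsto_cutoff hg
  simpa using this

theorem convL2_dirDeriv_cutoff {g : SpaceTime d → ℝ} (hg : MemLp g 2 volume) (v : SpaceTime d) :
    ConvL2 volume (fun n z => dirDeriv v (cutoff d n) z * g z) (fun _ => 0) := by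
  have hb : ContDiff ℝ ∞ (cutoffBase d) := (cutoffBase d).contDiff
  have e : ∀ n, dirDeriv v (cutoff d n) = fun z =>
      1 / ((n : ℝ) + 1) * dirDeriv v (cutoffBase d) ((1 / ((n : ℝ) + 1)) • z) := fun n =>
    dirDeriv_scale hb _ v
  obtain ⟨M, h1, h2⟩ := exists_bound_scaled (hb.dirDeriv v).continuous
    ((cutoffBase d).hasCompactSupport.dirDeriv v)
  have := convL2_mul_of_tendsto (b := fun n => dirDeriv v (cutoff d n)) (b₀ := 0) (M := M)
    (fun n => ((contDiff_cutoff (d := d) n).dirDeriv v).continuous.aestronglyMeasurable)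
    (fun n z => by rw [e]; exact h1 n z) (fun z => by simp only [e]; exact h2 z) hg
  simpa using this

theorem convL2_dirDeriv_dirDeriv_cutoff {g : SpaceTime d → ℝ} (hg : MemLp g 2 volume)
    (v w : SpaceTime d) :
    ConvL2 volume (fun n z => dirDeriv w (dirDeriv v (cutoff d n)) z * g z) (fun _ => 0) := by
  have hb : ContDiff ℝ ∞ (cutoffBase d) := (cutoffBase d).contDiff
  have e : ∀ n, dirDeriv w (dirDeriv v (cutoff d n)) = fun z => 1 / ((n : ℝ) + 1) *
      (1 / ((n : ℝ) + 1) * dirDeriv w (dirDeriv v (cutoffBase d)) ((1 / ((n : ℝ) + 1)) • z)) := by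
    intro n
    have e1 : dirDeriv v (cutoff d n) = fun z =>
      1 / ((n : ℝ) + 1) * dirDeriv v (cutoffBase d) ((1 / ((n : ℝ) + 1)) • z) :=
      dirDeriv_scale hb _ v
    have hd := hb.dirDeriv v
    have e2 := dirDeriv_scale hd (1 / ((n : ℝ) + 1)) w
    ext z
    rw [e1]
    have hdiff : DifferentiableAt ℝ
        (fun z => dirDeriv v (cutoffBase d) ((1 / ((n : ℝ) + 1)) • z)) z :=
      (hd.comp (contDiff_const_smul _)).differentiable (by simp) z
    have e3 := congrFun e2 z
    rw [dirDeriv] at e3 ⊢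
    rw [fderiv_const_mul hdiff, _root_.smul_apply, e3, smul_eq_mul]
  obtain ⟨M, h1, h2⟩ := exists_bound_scaled ((hb.dirDeriv v).dirDeriv w).continuous
    (((cutoffBase d).hasCompactSupport.dirDeriv v).dirDeriv w)
  have hle : ∀ n : ℕ, |1 / ((n : ℝ) + 1)| ≤ 1 := fun n => by
    rw [abs_of_nonneg (by positivity), div_le_one (by positivity)]
    linarith [Nat.cast_nonneg (α := ℝ) n]
  have := convL2_mul_of_tendsto (b := fun n => dirDeriv w (dirDeriv v (cutoff d n))) (b₀ := 0)
    (M := M)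
    (fun n => (((contDiff_cutoff (d := d) n).dirDeriv v).dirDeriv w).continuous.aestronglyMeasurable)
    (fun n z => by
      rw [e, abs_mul]
      exact (mul_le_of_le_one_left (abs_nonneg _) (hle n)).trans (h1 n z))
    (fun z => by
      simp only [e]
      simpa using tendsto_one_div_add_atTop_nhds_zero_nat.mul (h2 z)) hg
  simpa using this

theorem integrable_mul_test {u φ : SpaceTime d → ℝ} (hu : MemLp u 2 volume) (hφ : Continuous φ)
    (hs : HasCompactSupport φ) : Integrable fun z => u z * φ z :=
  hu.integrable_mul (hφ.memLp_two hs)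

/-- The product rule, obtained by using `χφ` as test function. -/
theorem WeakDerivFun.mul_smooth {v : SpaceTime d} {u g χ : SpaceTime d → ℝ}
    (h : WeakDerivFun v u g) (hu : MemLp u 2 volume) (hg : MemLp g 2 volume)
    (hχ : ContDiff ℝ ∞ χ) :
    WeakDerivFun v (fun z => χ z * u z) (fun z => χ z * g z + dirDeriv v χ z * u z) := by
  intro φ hφ hs
  have h1 := h (fun z => χ z * φ z) (hχ.mul hφ) (hs.mul_left)
  have e : ∀ z, fderiv ℝ (fun z => χ z * φ z) z v
      = χ z * dirDeriv v φ z + φ z * dirDeriv v χ z := fun z => by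
    have h2 := ((hχ.differentiable (by simp) z).hasFDerivAt.mul
      (hφ.differentiable (by simp) z).hasFDerivAt).fderiv
    change fderiv ℝ (χ * φ) z v = _
    rw [h2]
    simp [dirDeriv]
  simp only [e, mul_add] at h1
  have c1 := (hφ.dirDeriv v).continuous
  have i1 : Integrable fun z => u z * (χ z * dirDeriv v φ z) :=
    integrable_mul_test hu (hχ.continuous.mul c1) ((hs.dirDeriv v).mul_left)
  have i2 : Integrable fun z => u z * (φ z * dirDeriv v χ z) :=
    integrable_mul_test hu (hφ.continuous.mul (hχ.dirDeriv v).continuous) (hs.mul_right)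
  have i3 : Integrable fun z => g z * (χ z * φ z) :=
    integrable_mul_test hg (hχ.continuous.mul hφ.continuous) (hs.mul_left)
  rw [integral_add i1 i2] at h1
  have l : ∫ z, χ z * u z * fderiv ℝ φ z v = ∫ z, u z * (χ z * dirDeriv v φ z) :=
    integral_congr_ae (Eventually.of_forall fun z => by simp only [dirDeriv]; ring)
  have r : ∫ z, (χ z * g z + dirDeriv v χ z * u z) * φ z
      = (∫ z, g z * (χ z * φ z)) + ∫ z, u z * (φ z * dirDeriv v χ z) := by
    rw [← integral_add i3 i2]
    exact integral_congr_ae (Eventually.of_forall fun z => by ring)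
  rw [l, r]
  linarith

theorem WeakDerivFun.add {v : SpaceTime d} {u g u' g' : SpaceTime d → ℝ}
    (h : WeakDerivFun v u g) (h' : WeakDerivFun v u' g') (hu : MemLp u 2 volume)
    (hg : MemLp g 2 volume) (hu' : MemLp u' 2 volume) (hg' : MemLp g' 2 volume) :
    WeakDerivFun v (fun z => u z + u' z) (fun z => g z + g' z) := by
  intro φ hφ hs
  have c1 : Continuous fun z => fderiv ℝ φ z v := (hφ.dirDeriv v).continuous
  have s1 : HasCompactSupport fun z => fderiv ℝ φ z v := hs.dirDeriv v
  simp only [add_mul]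
  rw [integral_add (integrable_mul_test hu c1 s1) (integrable_mul_test hu' c1 s1),
    integral_add (integrable_mul_test hg hφ.continuous hs)
      (integrable_mul_test hg' hφ.continuous hs), h φ hφ hs, h' φ hφ hs]
  ring

theorem exists_tendsto_close {ι : Type*} [Finite ι] {A : ι → ℕ → SpaceTime d → ℝ}
    {f : ι → SpaceTime d → ℝ} (h : ∀ i, ConvL2 volume (A i) (f i)) {ε : ℝ} (hε : 0 < ε) :
    ∃ n, ∀ i, rnorm volume (fun z => A i n z - f i z) < ε := by
  have : ∀ᶠ n in atTop, ∀ i, rnorm volume (fun z => A i n z - f i z) < ε :=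
    eventually_all.2 fun i => (h i).tendsto.eventually (gt_mem_nhds hε)
  exact this.exists

/-- Smooth compactly supported functions are dense in `W^{1,2}_2`. -/
theorem exists_smooth_approx {u ut : L2 d} {ux : Fin d → L2 d} {uxx : Fin d → Fin d → L2 d}
    (h : IsW12With u ut ux uxx) {ε : ℝ} (hε : 0 < ε) :
    ∃ φ : SpaceTime d → ℝ, ContDiff ℝ ∞ φ ∧ HasCompactSupport φ ∧
      rnorm volume (fun z => φ z - u z) < ε ∧
      rnorm volume (fun z => dirDeriv (timeDir d) φ z - ut z) < ε ∧
      (∀ j, rnorm volume (fun z => dirDeriv (spaceDir j) φ z - ux j z) < ε) ∧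
      ∀ j k, rnorm volume (fun z => dirDeriv (spaceDir k) (dirDeriv (spaceDir j) φ) z - uxx j k z)
        < ε := by
  -- One finite index set for `u` and all its derivatives, so that a single cutoff and a single
  -- mollifier serve them simultaneously.
  let I := Unit ⊕ Unit ⊕ Fin d ⊕ (Fin d × Fin d)
  let f : I → SpaceTime d → ℝ :=
    Sum.elim (fun _ => u) (Sum.elim (fun _ => ut) (Sum.elim (fun j => ux j) fun q => uxx q.1 q.2))
  -- These are the weak derivatives of `cutoff · u` by the product rule; every term with a
  -- differentiated cutoff tends to zero.
  let A : I → ℕ → SpaceTime d → ℝ :=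
    Sum.elim (fun _ n z => cutoff d n z * u z)
    (Sum.elim (fun _ n z => cutoff d n z * ut z + dirDeriv (timeDir d) (cutoff d n) z * u z)
    (Sum.elim (fun j n z => cutoff d n z * ux j z + dirDeriv (spaceDir j) (cutoff d n) z * u z)
      fun q n z => (cutoff d n z * uxx q.1 q.2 z
        + dirDeriv (spaceDir q.2) (cutoff d n) z * ux q.1 z)
        + (dirDeriv (spaceDir q.1) (cutoff d n) z * ux q.2 z
        + dirDeriv (spaceDir q.2) (dirDeriv (spaceDir q.1) (cutoff d n)) z * u z)))
  have hA : ∀ i, ConvL2 volume (A i) (f i) := by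
    rintro (_ | _ | j | q)
    · exact convL2_cutoff (Lp.memLp u)
    · have := (convL2_cutoff (Lp.memLp ut)).add (convL2_dirDeriv_cutoff (Lp.memLp u) (timeDir d))
      simp only [add_zero] at this
      exact this
    · have := (convL2_cutoff (Lp.memLp (ux j))).add
        (convL2_dirDeriv_cutoff (Lp.memLp u) (spaceDir j))
      simp only [add_zero] at this
      exact this
    · have := ((convL2_cutoff (Lp.memLp (uxx q.1 q.2))).add
        (convL2_dirDeriv_cutoff (Lp.memLp (ux q.1)) (spaceDir q.2))).add
        ((convL2_dirDeriv_cutoff (Lp.memLp (ux q.2)) (spaceDir q.1)).add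
        (convL2_dirDeriv_dirDeriv_cutoff (Lp.memLp u) (spaceDir q.1) (spaceDir q.2)))
      simp only [add_zero] at this
      exact this
  obtain ⟨n, hn⟩ := exists_tendsto_close hA (half_pos hε)
  have hmem : ∀ i, MemLp (A i n) 2 volume := fun i => (hA i).memLp n
  have hmol : ∀ i, ConvL2 volume (fun m => mollify (mollifier d m) (A i n)) (A i n) := fun i =>
    ⟨fun m => memLp_mollify (contDiff_mollifier m).continuous (hasCompactSupport_mollifier m) (hmem i)
      (contDiff_mollify (contDiff_mollifier m) (hasCompactSupport_mollifier m)
        (hmem i)).continuous.aestronglyMeasurable, hmem i, tendsto_mollify (hmem i)⟩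
  -- The mollifier is chosen after the cutoff index `n` is frozen, with half of `ε` reserved for
  -- each approximation.
  obtain ⟨m, hm⟩ := exists_tendsto_close hmol (half_pos hε)
  set K := mollifier d m with hK
  have hKc : ContDiff ℝ ∞ K := contDiff_mollifier m
  have hKs : HasCompactSupport K := hasCompactSupport_mollifier m
  have hclose : ∀ i, rnorm volume (fun z => mollify K (A i n) z - f i z) < ε := fun i => by
    have h1 := rnorm_add_le (((hmol i).memLp m).sub (hmem i)) ((hmem i).sub (hA i).memLp_lim)
    have h2 : rnorm volume (fun z => mollify K (A i n) z - f i z) ≤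
        rnorm volume (fun z => mollify K (A i n) z - A i n z)
          + rnorm volume (fun z => A i n z - f i z) := by
      refine le_trans (le_of_eq ?_) h1
      congr 1; ext z; simp only [Pi.sub_apply]; ring
    linarith [hn i, hm i]
  have hχ := contDiff_cutoff (d := d) n
  have hχs := hasCompactSupport_cutoff (d := d) n
  have wu : ∀ v g, WeakDerivFun v u g → MemLp g 2 volume →
      WeakDerivFun v (fun z => cutoff d n z * u z)
        (fun z => cutoff d n z * g z + dirDeriv v (cutoff d n) z * u z) := fun v g hw hg =>
    hw.mul_smooth (Lp.memLp u) hg hχ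
  have d1 : ∀ v (g : SpaceTime d → ℝ), WeakDerivFun v u g → MemLp g 2 volume →
      dirDeriv v (mollify K (A (Sum.inl ()) n))
        = mollify K (fun z => cutoff d n z * g z + dirDeriv v (cutoff d n) z * u z) :=
    fun v g hw hg => by
      rw [dirDeriv_mollify hKc hKs (hmem _)]
      exact mollify_weakDeriv (wu v g hw hg) hKc hKs
  have dt : dirDeriv (timeDir d) (mollify K (A (Sum.inl ()) n))
      = mollify K (A (Sum.inr (Sum.inl ())) n) := d1 _ _ h.time (Lp.memLp ut)
  have dx : ∀ j, dirDeriv (spaceDir j) (mollify K (A (Sum.inl ()) n))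
      = mollify K (A (Sum.inr (Sum.inr (Sum.inl j))) n) := fun j =>
    d1 _ _ (h.space j) (Lp.memLp (ux j))
  have dxx : ∀ j k, dirDeriv (spaceDir k) (mollify K (A (Sum.inr (Sum.inr (Sum.inl j))) n))
      = mollify K (A (Sum.inr (Sum.inr (Sum.inr (j, k)))) n) := fun j k => by
    rw [dirDeriv_mollify hKc hKs (hmem _)]
    have w1 := WeakDerivFun.mul_smooth (h.space_space j k) (Lp.memLp (ux j)) (Lp.memLp (uxx j k))
      hχ
    have w2 := WeakDerivFun.mul_smooth (h.space k) (Lp.memLp u) (Lp.memLp (ux k))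
      (hχ.dirDeriv (spaceDir j))
    refine mollify_weakDeriv (w1.add w2 ?_ ?_ ?_ ?_) hKc hKs
    · exact (convL2_cutoff (Lp.memLp (ux j))).memLp n
    · exact ((convL2_cutoff (Lp.memLp (uxx j k))).add
        (convL2_dirDeriv_cutoff (Lp.memLp (ux j)) (spaceDir k))).memLp n
    · exact (convL2_dirDeriv_cutoff (Lp.memLp u) (spaceDir j)).memLp n
    · exact ((convL2_dirDeriv_cutoff (Lp.memLp (ux k)) (spaceDir j)).add
        (convL2_dirDeriv_dirDeriv_cutoff (Lp.memLp u) (spaceDir j) (spaceDir k))).memLp n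
  refine ⟨mollify K (A (Sum.inl ()) n), contDiff_mollify hKc hKs (hmem _),
    hasCompactSupport_mollify hKs hχs.mul_right, hclose (Sum.inl ()), ?_, fun j => ?_,
    fun j k => ?_⟩
  · rw [dt]; exact hclose _
  · rw [dx]; exact hclose (Sum.inr (Sum.inr (Sum.inl j)))
  · rw [dx, dxx]; exact hclose (Sum.inr (Sum.inr (Sum.inr (j, k))))

end Density

/-! ### The a priori estimate on `W^{1,2}_2`. -/

section Estimate

theorem memLp_parabolicOp {d : ℕ} [NeZero d] {δ : ℝ} (hδ : 0 < δ)
    {a : ℝ → ℝ → Matrix (Fin d) (Fin d) ℝ} (ha : IsAdmissible δ a) (lam : ℝ) (u ut : L2 d)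
    (uxx : Fin d → Fin d → L2 d) : MemLp (parabolicOp a lam u ut uxx) 2 volume :=
  ((Lp.memLp ut).add (memLp_finsetSum _ fun j _ => memLp_finsetSum _ fun k _ =>
    memLp_bounded_mul (aestronglyMeasurable_coeff ha j k) (fun _ => ha.abs_coeff_le hδ _ _ j k)
      (Lp.memLp (uxx j k)))).sub ((Lp.memLp u).const_mul lam)

/-- The a priori estimate, in terms of the squares of the norms. -/
theorem exists_weak_estimate {δ : ℝ} (hδ : 0 < δ) : ∃ C, 0 ≤ C ∧ ∀ (d : ℕ) [NeZero d]
    (a : ℝ → ℝ → Matrix (Fin d) (Fin d) ℝ), IsAdmissible δ a → ∀ lam : ℝ, 0 ≤ lam →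
    ∀ (u ut : L2 d) (ux : Fin d → L2 d) (uxx : Fin d → Fin d → L2 d), IsW12With u ut ux uxx →
    rnorm volume ut ^ 2 + ∑ j, ∑ k, rnorm volume (uxx j k) ^ 2
      + lam * ∑ j, rnorm volume (ux j) ^ 2 + lam ^ 2 * rnorm volume u ^ 2
      ≤ C * rnorm volume (parabolicOp a lam u ut uxx) ^ 2 := by
  obtain ⟨C, hC0, hC⟩ := exists_smooth_estimate hδ
  refine ⟨C, hC0, fun d hd a ha lam hlam u ut ux uxx h => ?_⟩
  obtain ⟨n, rfl⟩ : ∃ n, d = n + 1 := Nat.exists_eq_succ_of_ne_zero hd.out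
  have hpos : ∀ m : ℕ, (0 : ℝ) < 1 / ((m : ℝ) + 1) := fun m => by positivity
  choose φ hφ hs h0 h1 h2 h3 using fun m : ℕ => exists_smooth_approx h (hpos m)
  have hlim := tendsto_one_div_add_atTop_nhds_zero_nat (𝕜 := ℝ)
  have c0 : ConvL2 volume φ u := .of_le (fun m => (hφ m).continuous.memLp_two (hs m))
    (Lp.memLp u) hlim fun m => (h0 m).le
  have c1 : ConvL2 volume (fun m => dirDeriv (timeDir (n + 1)) (φ m)) ut :=
    .of_le (fun m => ((hφ m).dirDeriv _).continuous.memLp_two ((hs m).dirDeriv _))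
      (Lp.memLp ut) hlim fun m => (h1 m).le
  have c2 : ∀ j, ConvL2 volume (fun m => dirDeriv (spaceDir j) (φ m)) (ux j) := fun j =>
    .of_le (fun m => ((hφ m).dirDeriv _).continuous.memLp_two ((hs m).dirDeriv _))
      (Lp.memLp (ux j)) hlim fun m => (h2 m j).le
  have c3 : ∀ j k, ConvL2 volume (fun m => dirDeriv (spaceDir k) (dirDeriv (spaceDir j) (φ m)))
      (uxx j k) := fun j k =>
    .of_le (fun m => (((hφ m).dirDeriv _).dirDeriv _).continuous.memLp_two
      (((hs m).dirDeriv _).dirDeriv _)) (Lp.memLp (uxx j k)) hlim fun m => (h3 m j k).le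
  have cL : ConvL2 volume (fun m => smoothOp a lam (φ m)) (parabolicOp a lam u ut uxx) :=
    (c1.add (ConvL2.sum _ fun j _ => ConvL2.sum _ fun k _ =>
      (c3 j k).bounded_mul (aestronglyMeasurable_coeff ha j k) (inv_nonneg.2 hδ.le)
        fun z => ha.abs_coeff_le hδ _ _ j k)).sub (c0.const_mul lam)
  refine le_of_tendsto_of_tendsto' (((((c1.rnorm_tendsto.pow 2).add
    (tendsto_finsetSum _ fun j _ => tendsto_finsetSum _ fun k _ =>
      (c3 j k).rnorm_tendsto.pow 2)).add
    ((tendsto_finsetSum _ fun j _ => (c2 j).rnorm_tendsto.pow 2).const_mul lam)).add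
    ((c0.rnorm_tendsto.pow 2).const_mul (lam ^ 2)))) ((cL.rnorm_tendsto.pow 2).const_mul C)
    fun m => hC n a ha lam hlam (φ m) (hφ m) (hs m)

variable {α : Type*} [MeasurableSpace α] {ν : Measure α}

theorem eLpNorm_eq_ofReal_rnorm {f : α → ℝ} (hf : MemLp f 2 ν) :
    eLpNorm f 2 ν = ENNReal.ofReal (rnorm ν f) := (ENNReal.ofReal_toReal hf.2.ne).symm

theorem eLpNorm_sqrt_sum {ι : Type*} [Fintype ι] {g : ι → α → ℝ} (hg : ∀ i, MemLp (g i) 2 ν) :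
    eLpNorm (fun z => √(∑ i, g i z ^ 2)) 2 ν = ENNReal.ofReal √(∑ i, rnorm ν (g i) ^ 2) := by
  have hsq : ∀ x : ℝ, ‖x‖ₑ ^ 2 = ENNReal.ofReal (x ^ 2) := fun x => by
    rw [← ofReal_norm, ← ENNReal.ofReal_pow (norm_nonneg _), Real.norm_eq_abs, sq_abs]
  have h1 : eLpNorm (fun z => √(∑ i, g i z ^ 2)) 2 ν ^ 2 = ∑ i, eLpNorm (g i) 2 ν ^ 2 := by
    simp only [eLpNorm_two_sq]
    rw [← lintegral_finsetSum' _ fun i _ => ((hg i).1.aemeasurable.enorm.pow_const 2)]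
    refine lintegral_congr fun z => ?_
    rw [hsq, Real.sq_sqrt (Finset.sum_nonneg fun i _ => sq_nonneg _),
      ENNReal.ofReal_sum_of_nonneg fun i _ => sq_nonneg _]
    simp only [hsq]
  have h2 : ∑ i, eLpNorm (g i) 2 ν ^ 2 = ENNReal.ofReal √(∑ i, rnorm ν (g i) ^ 2) ^ 2 := by
    rw [← ENNReal.ofReal_pow (Real.sqrt_nonneg _),
      Real.sq_sqrt (Finset.sum_nonneg fun i _ => sq_nonneg _),
      ENNReal.ofReal_sum_of_nonneg fun i _ => sq_nonneg _]
    refine Finset.sum_congr rfl fun i _ => ?_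
    rw [eLpNorm_eq_ofReal_rnorm (hg i), ENNReal.ofReal_pow rnorm_nonneg]
  exact (ENNReal.pow_right_strictMono (n := 2) (by norm_num)).injective (h1.trans h2)

/-- The hypothesis bounds each of the four terms separately by `√C R`, hence the factor `4`. -/
theorem ofReal_estimate {C lam R U Ut S T : ℝ} (hC : 0 ≤ C) (hlam : 0 ≤ lam) (hR : 0 ≤ R)
    (hU : 0 ≤ U) (hUt : 0 ≤ Ut) (hS : 0 ≤ S) (hT : 0 ≤ T)
    (h : Ut ^ 2 + S + lam * T + lam ^ 2 * U ^ 2 ≤ C * R ^ 2) :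
    ENNReal.ofReal Ut + ENNReal.ofReal √S + ENNReal.ofReal √lam * ENNReal.ofReal √T
        + ENNReal.ofReal lam * ENNReal.ofReal U
      ≤ (4 * √C).toNNReal * ENNReal.ofReal R := by
  have hlT : 0 ≤ lam * T := mul_nonneg hlam hT
  have hM : (√C * R) ^ 2 = C * R ^ 2 := by rw [mul_pow, Real.sq_sqrt hC]
  have hM0 : 0 ≤ √C * R := mul_nonneg (Real.sqrt_nonneg _) hR
  have h1 := sq_nonneg Ut
  have h2 : (lam * U) ^ 2 = lam ^ 2 * U ^ 2 := mul_pow _ _ _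
  have h3 := sq_nonneg (lam * U)
  have e1 : Ut ≤ √C * R := le_of_sq_le_sq_of_nonneg hM0 (by linarith)
  have e2 : √S ≤ √C * R := by
    rw [Real.sqrt_le_left hM0]; linarith
  have e3 : √lam * √T ≤ √C * R := by
    rw [← Real.sqrt_mul hlam, Real.sqrt_le_left hM0]; linarith
  have e4 : lam * U ≤ √C * R := le_of_sq_le_sq_of_nonneg hM0 (by linarith)
  rw [← ENNReal.ofReal_mul (Real.sqrt_nonneg _), ← ENNReal.ofReal_mul hlam,
    ← ENNReal.ofReal_add hUt (Real.sqrt_nonneg _), ← ENNReal.ofReal_add (by positivity)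
      (by positivity), ← ENNReal.ofReal_add (by positivity) (by positivity)]
  change _ ≤ ENNReal.ofReal (4 * √C) * _
  rw [← ENNReal.ofReal_mul (by positivity)]
  exact ENNReal.ofReal_le_ofReal (by linarith)

theorem normL2_estimate {d : ℕ} [NeZero d] {δ : ℝ} (hδ : 0 < δ)
    {a : ℝ → ℝ → Matrix (Fin d) (Fin d) ℝ} (ha : IsAdmissible δ a) {lam : ℝ} (hlam : 0 ≤ lam)
    {u ut : L2 d} {ux : Fin d → L2 d} {uxx : Fin d → Fin d → L2 d} {C : ℝ} (hC : 0 ≤ C)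
    (h : rnorm volume ut ^ 2 + ∑ j, ∑ k, rnorm volume (uxx j k) ^ 2
      + lam * ∑ j, rnorm volume (ux j) ^ 2 + lam ^ 2 * rnorm volume u ^ 2
      ≤ C * rnorm volume (parabolicOp a lam u ut uxx) ^ 2) :
    normL2 ut + normL2 (fun z => √(∑ j, ∑ k, uxx j k z ^ 2)) +
        ENNReal.ofReal √lam * normL2 (fun z => √(∑ k, ux k z ^ 2)) + ENNReal.ofReal lam * normL2 u
      ≤ (4 * √C).toNNReal * normL2 (parabolicOp a lam u ut uxx) := by
  have hxx : normL2 (fun z => √(∑ j, ∑ k, uxx j k z ^ 2))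
      = ENNReal.ofReal √(∑ j, ∑ k, rnorm volume (uxx j k) ^ 2) := by
    have := eLpNorm_sqrt_sum (ν := volume) (g := fun (q : Fin d × Fin d) => uxx q.1 q.2)
      fun q => Lp.memLp _
    simpa only [Fintype.sum_prod_type, normL2] using this
  have hx : normL2 (fun z => √(∑ k, ux k z ^ 2))
      = ENNReal.ofReal √(∑ k, rnorm volume (ux k) ^ 2) :=
    eLpNorm_sqrt_sum fun k => Lp.memLp _
  have hS : 0 ≤ ∑ j, ∑ k, rnorm volume (uxx j k) ^ 2 :=
    Finset.sum_nonneg fun j _ => Finset.sum_nonneg fun k _ => sq_nonneg _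
  have hT : 0 ≤ ∑ k, rnorm volume (ux k) ^ 2 := Finset.sum_nonneg fun k _ => sq_nonneg _
  rw [hxx, hx, normL2, normL2, normL2, eLpNorm_eq_ofReal_rnorm (Lp.memLp ut),
    eLpNorm_eq_ofReal_rnorm (Lp.memLp u), eLpNorm_eq_ofReal_rnorm (memLp_parabolicOp hδ ha lam u ut uxx)]
  set S := ∑ j, ∑ k, rnorm volume (uxx j k) ^ 2
  set T := ∑ k, rnorm volume (ux k) ^ 2
  set R := rnorm volume (parabolicOp a lam u ut uxx)
  exact ofReal_estimate hC hlam rnorm_nonneg rnorm_nonneg rnorm_nonneg hS hT h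

end Estimate

/-! ### The method of continuity in Hilbert space. -/

section Continuity

variable {X Y : Type*} [NormedAddCommGroup X] [NormedSpace ℝ X] [CompleteSpace X]
  [NormedAddCommGroup Y] [InnerProductSpace ℝ Y] [CompleteSpace Y]

/-- The lower bound makes the range closed, and a closed subspace with trivial orthogonal complement
is everything. -/
theorem surjective_of_bound_of_orthogonal {T : X →L[ℝ] Y} {K : ℝ} (hT : ∀ x, ‖x‖ ≤ K * ‖T x‖)
    (h : ∀ y, (∀ x, inner ℝ (T x) y = (0 : ℝ)) → y = 0) : Function.Surjective T := by
  have ha : AntilipschitzWith K.toNNReal T := AddMonoidHomClass.antilipschitz_of_bound T fun x =>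
    (hT x).trans (mul_le_mul_of_nonneg_right (Real.le_coe_toNNReal K) (norm_nonneg _))
  have hc : IsClosed (Set.range T) := ha.isClosed_range T.uniformContinuous
  have hc' : IsClosed ((LinearMap.range T.toLinearMap : Submodule ℝ Y) : Set Y) := by
    have e : ((LinearMap.range T.toLinearMap : Submodule ℝ Y) : Set Y) = Set.range T := by
      ext; simp
    rwa [e]
  have : CompleteSpace (LinearMap.range T.toLinearMap) := hc'.completeSpace_coe
  have ho : (LinearMap.range T.toLinearMap)ᗮ = ⊥ := by
    rw [Submodule.eq_bot_iff]
    intro y hy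
    rw [Submodule.mem_orthogonal] at hy
    exact h y fun x => hy _ (LinearMap.mem_range_self T.toLinearMap x)
  have := LinearMap.range_eq_top.1 (Submodule.orthogonal_eq_bot_iff.1 ho)
  exact this

/-- A vector orthogonal to the range of `T'` has the form `T x`, so its squared norm is `⟨(T - T')
x, T x⟩`, at most `‖T - T'‖ K` times itself. -/
theorem surjective_of_close {T T' : X →L[ℝ] Y} {K : ℝ} (hT : ∀ x, ‖x‖ ≤ K * ‖T x‖)
    (hT' : ∀ x, ‖x‖ ≤ K * ‖T' x‖) (hs : Function.Surjective T) (hc : ‖T - T'‖ * K < 1) :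
    Function.Surjective T' := by
  refine surjective_of_bound_of_orthogonal hT' fun y hy => ?_
  obtain ⟨x, rfl⟩ := hs y
  have h1 : ‖T x‖ ^ 2 ≤ ‖T - T'‖ * K * ‖T x‖ ^ 2 := by
    calc ‖T x‖ ^ 2 = inner ℝ ((T - T') x) (T x) := by
          rw [_root_.sub_apply, inner_sub_left, hy x, sub_zero,
            real_inner_self_eq_norm_sq]
      _ ≤ ‖(T - T') x‖ * ‖T x‖ := real_inner_le_norm _ _
      _ ≤ (‖T - T'‖ * ‖x‖) * ‖T x‖ :=
          mul_le_mul_of_nonneg_right ((T - T').le_opNorm x) (norm_nonneg _)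
      _ ≤ (‖T - T'‖ * (K * ‖T x‖)) * ‖T x‖ :=
          mul_le_mul_of_nonneg_right (mul_le_mul_of_nonneg_left (hT x) (norm_nonneg _))
            (norm_nonneg _)
      _ = _ := by ring
  have h2 : ‖T x‖ ^ 2 ≤ 0 := by nlinarith [sq_nonneg ‖T x‖]
  exact norm_eq_zero.1 (pow_eq_zero_iff (two_ne_zero) |>.1 (le_antisymm h2 (sq_nonneg _)))

/-- The method of continuity. -/
theorem surjective_of_continuity_method {T D : X →L[ℝ] Y} {K : ℝ}
    (hT : ∀ s ∈ Set.Icc (0 : ℝ) 1, ∀ x, ‖x‖ ≤ K * ‖(T + s • D) x‖) (h0 : Function.Surjective T) :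
    Function.Surjective (T + D) := by
  obtain ⟨n, hn⟩ := exists_nat_gt (‖D‖ * K)
  have hn1 : (0 : ℝ) < (n : ℝ) + 1 := by positivity
  have key : ∀ m : ℕ, m ≤ n + 1 → Function.Surjective (T + ((m : ℝ) / ((n : ℝ) + 1)) • D) := by
    intro m
    induction m with
    | zero => intro _; simpa using h0
    | succ m ih =>
      intro hm
      have hmem : ∀ q : ℕ, q ≤ n + 1 → (q : ℝ) / ((n : ℝ) + 1) ∈ Set.Icc (0 : ℝ) 1 := fun q hq =>
        ⟨by positivity, by rw [div_le_one hn1]; exact_mod_cast hq⟩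
      refine surjective_of_close (hT _ (hmem m (by omega))) (hT _ (hmem (m + 1) hm))
        (ih (by omega)) ?_
      have e : T + ((m : ℝ) / ((n : ℝ) + 1)) • D - (T + (((m + 1 : ℕ) : ℝ) / ((n : ℝ) + 1)) • D)
          = (-(1 / ((n : ℝ) + 1))) • D := by
        rw [add_sub_add_left_eq_sub, ← sub_smul]
        congr 1
        push_cast
        field_simp
        ring
      rw [e, norm_smul, Real.norm_eq_abs, abs_neg, abs_of_nonneg (by positivity), mul_assoc,
        one_div, inv_mul_lt_iff₀ hn1]
      linarith
  have h1 := key (n + 1) le_rfl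
  rw [Nat.cast_add_one, div_self hn1.ne', one_smul] at h1
  exact h1

end Continuity

/-! ### `W^{1,2}_2` as a Banach space and the operator on it. -/

section Space

variable {d : ℕ}

/-- Written with inner products, being a weak derivative is a family of closed linear conditions on
`(u, g)`; hence `parabolicSobolev` is a closed subspace of the space of jets. -/
theorem isWeakDeriv_iff {v : SpaceTime d} {u g : L2 d} :
    IsWeakDeriv v u g ↔ ∀ (φ : SpaceTime d → ℝ) (hφ : ContDiff ℝ ∞ φ) (hs : HasCompactSupport φ),
      inner ℝ (((hφ.dirDeriv v).continuous.memLp_two (ν := volume) (hs.dirDeriv v)).toLp _) u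
        + inner ℝ ((hφ.continuous.memLp_two (ν := volume) hs).toLp _) g = (0 : ℝ) := by
  refine forall_congr' fun φ => forall_congr' fun hφ => forall_congr' fun hs => ?_
  have key : ∀ (ψ : SpaceTime d → ℝ) (hψ : MemLp ψ 2 volume) (w : L2 d),
      (inner ℝ (hψ.toLp ψ) w : ℝ) = ∫ z, w z * ψ z := fun ψ hψ w => by
    rw [L2.inner_def]
    refine integral_congr_ae ?_
    filter_upwards [hψ.coeFn_toLp] with z hz
    rw [hz]
    simp
  rw [key, key, eq_neg_iff_add_eq_zero]
  rfl

/-- A function of `L²` together with candidates for its first and second derivatives. -/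
abbrev Jet (d : ℕ) : Type := L2 d × L2 d × (Fin d → L2 d) × (Fin d → Fin d → L2 d)

/-- The space `W^{1,2}_2`. -/
def parabolicSobolev (d : ℕ) : Submodule ℝ (Jet d) where
  carrier := {q | IsW12With q.1 q.2.1 q.2.2.1 q.2.2.2}
  zero_mem' := by
    refine ⟨?_, fun j => ?_, fun j k => ?_⟩ <;> rw [isWeakDeriv_iff] <;> intro φ hφ hs <;>
      simp
  add_mem' := by
    intro p q hp hq
    have key : ∀ {v} {u g u' g' : L2 d}, IsWeakDeriv v u g → IsWeakDeriv v u' g' →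
        IsWeakDeriv v (u + u') (g + g') := fun h h' => by
      rw [isWeakDeriv_iff] at h h' ⊢
      intro φ hφ hs
      rw [inner_add_right, inner_add_right]
      linarith [h φ hφ hs, h' φ hφ hs]
    exact ⟨key hp.time hq.time, fun j => key (hp.space j) (hq.space j),
      fun j k => key (hp.space_space j k) (hq.space_space j k)⟩
  smul_mem' := by
    intro c q hq
    have key : ∀ {v} {u g : L2 d}, IsWeakDeriv v u g → IsWeakDeriv v (c • u) (c • g) := fun h => by
      rw [isWeakDeriv_iff] at h ⊢
      intro φ hφ hs
      rw [inner_smul_right, inner_smul_right, ← mul_add, h φ hφ hs, mul_zero]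
    exact ⟨key hq.time, fun j => key (hq.space j), fun j k => key (hq.space_space j k)⟩

theorem isClosed_isWeakDeriv (v : SpaceTime d) {f g : Jet d → L2 d} (hf : Continuous f)
    (hg : Continuous g) : IsClosed {q | IsWeakDeriv v (f q) (g q)} := by
  simp only [isWeakDeriv_iff, Set.ofPred_forall]
  refine isClosed_iInter fun φ => isClosed_iInter fun hφ => isClosed_iInter fun hs => ?_
  exact isClosed_eq (by fun_prop) continuous_const

theorem isClosed_parabolicSobolev : IsClosed (parabolicSobolev d : Set (Jet d)) := by
  have e : (parabolicSobolev d : Set (Jet d)) =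
      {q | IsWeakDeriv (timeDir d) q.1 q.2.1} ∩
        ((⋂ j, {q | IsWeakDeriv (spaceDir j) q.1 (q.2.2.1 j)}) ∩
          ⋂ j, ⋂ k, {q | IsWeakDeriv (spaceDir k) (q.2.2.1 j) (q.2.2.2 j k)}) := by
    ext q
    simp only [Set.mem_inter_iff, Set.mem_iInter, Set.mem_ofPred_eq]
    exact ⟨fun h => ⟨h.time, h.space, h.space_space⟩, fun h => ⟨h.1, h.2.1, h.2.2⟩⟩
  rw [e]
  exact (isClosed_isWeakDeriv _ (by fun_prop) (by fun_prop)).inter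
    ((isClosed_iInter fun j => isClosed_isWeakDeriv _ (by fun_prop) (by fun_prop)).inter
      (isClosed_iInter fun j => isClosed_iInter fun k =>
        isClosed_isWeakDeriv _ (by fun_prop) (by fun_prop)))

instance : CompleteSpace (parabolicSobolev d) := isClosed_parabolicSobolev.completeSpace_coe

theorem ae_sum_apply {ι : Type*} [Fintype ι] (f : ι → L2 d) :
    ∀ᵐ z, (∑ i, f i : L2 d) z = ∑ i, f i z := by
  filter_upwards [Lp.coeFn_finsetSum Finset.univ f] with z hz
  rw [hz, Finset.sum_apply]

variable [NeZero d] {δ : ℝ} {a : ℝ → ℝ → Matrix (Fin d) (Fin d) ℝ}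

/-- The operator `u ↦ L₀u - λu` on `W^{1,2}_2`. -/
noncomputable def parabolicCLM (hδ : 0 < δ) (ha : IsAdmissible δ a) (lam : ℝ) :
    parabolicSobolev d →L[ℝ] L2 d :=
  (ContinuousLinearMap.fst ℝ _ _ ∘L ContinuousLinearMap.snd ℝ _ _
    + ∑ j, ∑ k, mulL2 _ (aestronglyMeasurable_coeff ha j k) δ⁻¹
        (fun _ => ha.abs_coeff_le hδ _ _ j k) ∘L ContinuousLinearMap.proj k
          ∘L ContinuousLinearMap.proj (φ := fun _ : Fin d => Fin d → L2 d) j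
          ∘L ContinuousLinearMap.snd ℝ _ _ ∘L ContinuousLinearMap.snd ℝ _ _
          ∘L ContinuousLinearMap.snd ℝ _ _
    - lam • ContinuousLinearMap.fst ℝ _ _) ∘L (parabolicSobolev d).subtypeL

theorem parabolicCLM_apply (hδ : 0 < δ) (ha : IsAdmissible δ a) (lam : ℝ)
    (q : parabolicSobolev d) :
    parabolicCLM hδ ha lam q = (memLp_parabolicOp hδ ha lam q.1.1 q.1.2.1 q.1.2.2.2).toLp _ := by
  have e : parabolicCLM hδ ha lam q = q.1.2.1 + ∑ j, ∑ k, mulL2 _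
      (aestronglyMeasurable_coeff ha j k) δ⁻¹ (fun _ => ha.abs_coeff_le hδ _ _ j k)
      (q.1.2.2.2 j k) - lam • q.1.1 := by
    simp [parabolicCLM]
  have m : ∀ j k, MemLp (fun z : SpaceTime d => a z.1 (z.2 0) j k * q.1.2.2.2 j k z) 2 volume :=
    fun j k => memLp_bounded_mul (aestronglyMeasurable_coeff ha j k)
      (fun _ => ha.abs_coeff_le hδ _ _ j k) (Lp.memLp (q.1.2.2.2 j k))
  rw [e]
  refine Lp.ext ?_
  have hm : ∀ᵐ z : SpaceTime d, ∀ j k, mulL2 _ (aestronglyMeasurable_coeff ha j k) δ⁻¹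
      (fun _ => ha.abs_coeff_le hδ _ _ j k) (q.1.2.2.2 j k) z
        = a z.1 (z.2 0) j k * q.1.2.2.2 j k z :=
    eventually_all.2 fun j => eventually_all.2 fun k => coeFn_mulL2 _ _ _
  have hs : ∀ᵐ z : SpaceTime d, (∑ j, ∑ k, mulL2 _ (aestronglyMeasurable_coeff ha j k) δ⁻¹
      (fun _ => ha.abs_coeff_le hδ _ _ j k) (q.1.2.2.2 j k) : L2 d) z
        = ∑ j, (∑ k, mulL2 _ (aestronglyMeasurable_coeff ha j k) δ⁻¹
      (fun _ => ha.abs_coeff_le hδ _ _ j k) (q.1.2.2.2 j k) : L2 d) z :=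
    ae_sum_apply _
  have hs' : ∀ᵐ z : SpaceTime d, ∀ j, (∑ k, mulL2 _ (aestronglyMeasurable_coeff ha j k) δ⁻¹
      (fun _ => ha.abs_coeff_le hδ _ _ j k) (q.1.2.2.2 j k) : L2 d) z
        = ∑ k, mulL2 _ (aestronglyMeasurable_coeff ha j k) δ⁻¹
      (fun _ => ha.abs_coeff_le hδ _ _ j k) (q.1.2.2.2 j k) z :=
    eventually_all.2 fun j => ae_sum_apply _
  filter_upwards [hm, hs, hs', (memLp_parabolicOp hδ ha lam q.1.1 q.1.2.1 q.1.2.2.2).coeFn_toLp,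
    Lp.coeFn_sub (q.1.2.1 + ∑ j, ∑ k, mulL2 _
      (aestronglyMeasurable_coeff ha j k) δ⁻¹ (fun _ => ha.abs_coeff_le hδ _ _ j k)
      (q.1.2.2.2 j k)) (lam • q.1.1), Lp.coeFn_add q.1.2.1 (∑ j, ∑ k, mulL2 _
      (aestronglyMeasurable_coeff ha j k) δ⁻¹ (fun _ => ha.abs_coeff_le hδ _ _ j k)
      (q.1.2.2.2 j k)), Lp.coeFn_smul lam q.1.1] with z h1 h2 h3 h4 h5 h6 h7
  rw [h4, h5, Pi.sub_apply, h6, Pi.add_apply, h7, h2]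
  simp only [h3, h1, parabolicOp, Pi.smul_apply, smul_eq_mul]

theorem parabolicCLM_eq_iff (hδ : 0 < δ) (ha : IsAdmissible δ a) (lam : ℝ)
    (q : parabolicSobolev d) (f : L2 d) :
    parabolicCLM hδ ha lam q = f ↔ ∀ᵐ z, parabolicOp a lam q.1.1 q.1.2.1 q.1.2.2.2 z = f z := by
  have h := (memLp_parabolicOp hδ ha lam q.1.1 q.1.2.1 q.1.2.2.2).coeFn_toLp
  rw [parabolicCLM_apply]
  constructor
  · rintro rfl
    filter_upwards [h] with z hz using hz.symm
  · intro hf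
    exact Lp.ext (h.trans hf)

theorem isSolution_iff (hδ : 0 < δ) (ha : IsAdmissible δ a) (lam : ℝ) (f u : L2 d) :
    IsSolution a lam f u ↔ ∃ q : parabolicSobolev d, q.1.1 = u ∧ parabolicCLM hδ ha lam q = f := by
  constructor
  · rintro ⟨ut, ux, uxx, h, hf⟩
    exact ⟨⟨(u, ut, ux, uxx), h⟩, rfl, (parabolicCLM_eq_iff hδ ha lam _ f).2 hf⟩
  · rintro ⟨q, rfl, hf⟩
    exact ⟨_, _, _, q.2, (parabolicCLM_eq_iff hδ ha lam q f).1 hf⟩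

/-- For `λ > 0`, the norm of `W^{1,2}_2` is controlled by `L₀u - λu`, uniformly with respect to the
coefficients. -/
theorem exists_parabolicCLM_bound (hδ : 0 < δ) (d : ℕ) [NeZero d] {lam : ℝ} (hlam : 0 < lam) :
    ∃ K, 0 ≤ K ∧ ∀ (a : ℝ → ℝ → Matrix (Fin d) (Fin d) ℝ) (ha : IsAdmissible δ a)
      (q : parabolicSobolev d), ‖q‖ ≤ K * ‖parabolicCLM hδ ha lam q‖ := by
  obtain ⟨C, hC0, hC⟩ := exists_weak_estimate hδ
  -- The norm of a jet is the maximum over its components. First derivatives cost `λ⁻¹` and the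
  -- function itself `λ⁻²` after division in the squared estimate.
  refine ⟨√(C * (1 + lam⁻¹ + (lam ^ 2)⁻¹)), Real.sqrt_nonneg _, fun a ha q => ?_⟩
  have h := hC d a ha lam hlam.le _ _ _ _ q.2
  rw [rnorm_eq_norm (memLp_parabolicOp hδ ha lam q.1.1 q.1.2.1 q.1.2.2.2),
    ← parabolicCLM_apply hδ ha] at h
  set R := ‖parabolicCLM hδ ha lam q‖ with hR
  have hn : ∀ u : L2 d, rnorm volume u = ‖u‖ := fun u => (Lp.norm_def u).symm
  simp only [hn] at h
  set B := √(C * (1 + lam⁻¹ + (lam ^ 2)⁻¹)) with hB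
  have hl1 : 0 < lam⁻¹ := inv_pos.2 hlam
  have hl2 : 0 < (lam ^ 2)⁻¹ := inv_pos.2 (pow_pos hlam 2)
  have hCR : 0 ≤ C * R ^ 2 := mul_nonneg hC0 (sq_nonneg _)
  have hB2 : (B * R) ^ 2 = C * R ^ 2 * (1 + lam⁻¹ + (lam ^ 2)⁻¹) := by
    rw [mul_pow, hB, Real.sq_sqrt (by positivity)]; ring
  have hBR : 0 ≤ B * R := mul_nonneg (Real.sqrt_nonneg _) (norm_nonneg _)
  have s1 := sq_nonneg ‖q.1.2.1‖
  have s2 : 0 ≤ ∑ j, ∑ k, ‖q.1.2.2.2 j k‖ ^ 2 :=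
    Finset.sum_nonneg fun j _ => Finset.sum_nonneg fun k _ => sq_nonneg _
  have s3 : 0 ≤ lam * ∑ j, ‖q.1.2.2.1 j‖ ^ 2 :=
    mul_nonneg hlam.le (Finset.sum_nonneg fun j _ => sq_nonneg _)
  have s4 : 0 ≤ lam ^ 2 * ‖q.1.1‖ ^ 2 := by positivity
  have p1 : 0 ≤ C * R ^ 2 * lam⁻¹ := mul_nonneg hCR hl1.le
  have p2 : 0 ≤ C * R ^ 2 * (lam ^ 2)⁻¹ := mul_nonneg hCR hl2.le
  have b1 : ‖q.1.2.1‖ ≤ B * R := le_of_sq_le_sq_of_nonneg hBR (by rw [hB2]; linarith)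
  have b2 : ∀ j k, ‖q.1.2.2.2 j k‖ ≤ B * R := fun j k => by
    have t1 : ‖q.1.2.2.2 j k‖ ^ 2 ≤ ∑ k, ‖q.1.2.2.2 j k‖ ^ 2 :=
      Finset.single_le_sum (f := fun k => ‖q.1.2.2.2 j k‖ ^ 2) (fun _ _ => sq_nonneg _)
        (Finset.mem_univ k)
    have t2 : ∑ k, ‖q.1.2.2.2 j k‖ ^ 2 ≤ ∑ j, ∑ k, ‖q.1.2.2.2 j k‖ ^ 2 :=
      Finset.single_le_sum (f := fun j => ∑ k, ‖q.1.2.2.2 j k‖ ^ 2)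
        (fun _ _ => Finset.sum_nonneg fun _ _ => sq_nonneg _) (Finset.mem_univ j)
    exact le_of_sq_le_sq_of_nonneg hBR (by rw [hB2]; linarith)
  have b3 : ∀ j, ‖q.1.2.2.1 j‖ ≤ B * R := fun j => by
    have t1 : ‖q.1.2.2.1 j‖ ^ 2 ≤ ∑ j, ‖q.1.2.2.1 j‖ ^ 2 :=
      Finset.single_le_sum (f := fun j => ‖q.1.2.2.1 j‖ ^ 2) (fun _ _ => sq_nonneg _)
        (Finset.mem_univ j)
    have t2 : ∑ j, ‖q.1.2.2.1 j‖ ^ 2 ≤ C * R ^ 2 * lam⁻¹ := by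
      rw [← div_eq_mul_inv, le_div_iff₀ hlam]; linarith
    exact le_of_sq_le_sq_of_nonneg hBR (by rw [hB2]; linarith)
  have b4 : ‖q.1.1‖ ≤ B * R := by
    have t2 : ‖q.1.1‖ ^ 2 ≤ C * R ^ 2 * (lam ^ 2)⁻¹ := by
      rw [← div_eq_mul_inv, le_div_iff₀ (pow_pos hlam 2)]; linarith
    exact le_of_sq_le_sq_of_nonneg hBR (by rw [hB2]; linarith)
  change ‖q.1‖ ≤ B * R
  rw [norm_prod_le_iff, norm_prod_le_iff, norm_prod_le_iff, pi_norm_le_iff_of_nonneg hBR,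
    pi_norm_le_iff_of_nonneg hBR]
  exact ⟨b4, b1, b3, fun j => (pi_norm_le_iff_of_nonneg hBR).2 (b2 j)⟩

end Space

/-! ### Solvability for the heat operator, and then for general coefficients. -/

section Heat

variable {d : ℕ}

/-- Square integrability replaces compact support, because mollifications of a general `L²` function
are to be integrated by parts against themselves. -/
theorem integral_mul_dirDeriv {f g : SpaceTime d → ℝ} {v : SpaceTime d} (hf : ContDiff ℝ ∞ f)
    (hg : ContDiff ℝ ∞ g) (f2 : MemLp f 2 volume) (g2 : MemLp g 2 volume)
    (f2' : MemLp (dirDeriv v f) 2 volume) (g2' : MemLp (dirDeriv v g) 2 volume) :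
    ∫ z, f z * dirDeriv v g z = -∫ z, dirDeriv v f z * g z :=
  integral_mul_fderiv_eq_neg_fderiv_mul_of_integrable (f2'.integrable_mul g2)
    (f2.integrable_mul g2') (f2.integrable_mul g2) (fun z _ => hf.differentiable (by simp) z)
    (fun z _ => hg.differentiable (by simp) z)

theorem isWeakDeriv_dirDeriv {f : SpaceTime d → ℝ} {v : SpaceTime d} (hf : ContDiff ℝ ∞ f)
    (f2 : MemLp f 2 volume) (f2' : MemLp (dirDeriv v f) 2 volume) :
    IsWeakDeriv v (f2.toLp f) (f2'.toLp _) := by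
  intro φ hφ hs
  have h := integral_mul_dirDeriv (v := v) hf hφ f2 (hφ.continuous.memLp_two hs) f2'
    ((hφ.dirDeriv v).continuous.memLp_two (hs.dirDeriv v))
  refine Eq.trans (integral_congr_ae ?_) (h.trans (congrArg Neg.neg (integral_congr_ae ?_)))
  · filter_upwards [f2.coeFn_toLp] with z hz
    rw [hz]; rfl
  · filter_upwards [f2'.coeFn_toLp] with z hz
    rw [hz]

/-- A smooth function with compact support, as an element of `W^{1,2}_2`. -/
noncomputable def smoothJet {φ : SpaceTime d → ℝ} (hφ : ContDiff ℝ ∞ φ) (hs : HasCompactSupport φ) :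
    parabolicSobolev d :=
  ⟨((hφ.continuous.memLp_two hs).toLp φ,
    ((hφ.dirDeriv (timeDir d)).continuous.memLp_two (hs.dirDeriv _)).toLp _,
    fun j => ((hφ.dirDeriv (spaceDir j)).continuous.memLp_two (hs.dirDeriv _)).toLp _,
    fun j k => (((hφ.dirDeriv (spaceDir j)).dirDeriv (spaceDir k)).continuous.memLp_two
      ((hs.dirDeriv _).dirDeriv _)).toLp _),
    ⟨isWeakDeriv_dirDeriv hφ (hφ.continuous.memLp_two hs)
        ((hφ.dirDeriv _).continuous.memLp_two (hs.dirDeriv _)),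
      fun _ => isWeakDeriv_dirDeriv hφ (hφ.continuous.memLp_two hs)
        ((hφ.dirDeriv _).continuous.memLp_two (hs.dirDeriv _)),
      fun _ _ => isWeakDeriv_dirDeriv (hφ.dirDeriv _)
        ((hφ.dirDeriv _).continuous.memLp_two (hs.dirDeriv _))
        (((hφ.dirDeriv _).dirDeriv _).continuous.memLp_two ((hs.dirDeriv _).dirDeriv _))⟩⟩

theorem coeFn_smoothJet {φ : SpaceTime d → ℝ} (hφ : ContDiff ℝ ∞ φ) (hs : HasCompactSupport φ) :
    ∀ᵐ z, (smoothJet hφ hs).1.1 z = φ z ∧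
      (smoothJet hφ hs).1.2.1 z = dirDeriv (timeDir d) φ z ∧
      ∀ j k, (smoothJet hφ hs).1.2.2.2 j k z = dirDeriv (spaceDir k) (dirDeriv (spaceDir j) φ) z := by
  have h : ∀ᵐ z, ∀ j k, (smoothJet hφ hs).1.2.2.2 j k z
      = dirDeriv (spaceDir k) (dirDeriv (spaceDir j) φ) z :=
    eventually_all.2 fun j => eventually_all.2 fun k =>
      (((hφ.dirDeriv (spaceDir j)).dirDeriv (spaceDir k)).continuous.memLp_two
        ((hs.dirDeriv _).dirDeriv _)).coeFn_toLp
  filter_upwards [(hφ.continuous.memLp_two (ν := volume) hs).coeFn_toLp,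
    ((hφ.dirDeriv (timeDir d)).continuous.memLp_two (ν := volume) (hs.dirDeriv _)).coeFn_toLp, h]
    with z h1 h2 h3 using ⟨h1, h2, h3⟩

theorem isAdmissible_one {δ : ℝ} (hδ0 : 0 < δ) (hδ1 : δ < 1) :
    IsAdmissible δ fun _ _ => (1 : Matrix (Fin d) (Fin d) ℝ) := by
  have e : ∀ ϑ : Fin d → ℝ,
      ∑ j, ∑ k, (1 : Matrix (Fin d) (Fin d) ℝ) j k * ϑ j * ϑ k = ∑ j, ϑ j ^ 2 := fun ϑ => by
    simp [Matrix.one_apply, sq]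
  have h0 : ∀ ϑ : Fin d → ℝ, 0 ≤ ∑ j, ϑ j ^ 2 := fun ϑ => Finset.sum_nonneg fun j _ => sq_nonneg _
  refine ⟨fun _ _ => aemeasurable_const, fun t s j k => ?_, fun t s ϑ => ?_, fun t s ϑ => ?_⟩
  · simp [Matrix.one_apply, eq_comm]
  · rw [e]; nlinarith [h0 ϑ]
  · rw [e]
    have : 1 ≤ δ⁻¹ := (one_le_inv₀ hδ0).2 hδ1.le
    nlinarith [h0 ϑ]

theorem isAdmissible_segment {δ : ℝ} {a b : ℝ → ℝ → Matrix (Fin d) (Fin d) ℝ}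
    (ha : IsAdmissible δ a) (hb : IsAdmissible δ b) {r : ℝ} (hr : r ∈ Set.Icc (0 : ℝ) 1) :
    IsAdmissible δ fun t s => (1 - r) • a t s + r • b t s := by
  have e : ∀ t s (ϑ : Fin d → ℝ),
      ∑ j, ∑ k, ((1 - r) • a t s + r • b t s) j k * ϑ j * ϑ k
        = (1 - r) * ∑ j, ∑ k, a t s j k * ϑ j * ϑ k + r * ∑ j, ∑ k, b t s j k * ϑ j * ϑ k :=
    fun t s ϑ => by
      simp only [Finset.mul_sum, ← Finset.sum_add_distrib]
      refine Finset.sum_congr rfl fun j _ => Finset.sum_congr rfl fun k _ => ?_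
      simp only [Matrix.add_apply, Matrix.smul_apply, smul_eq_mul]
      ring
  have h1 : 0 ≤ 1 - r := sub_nonneg.2 hr.2
  refine ⟨fun j k => ?_, fun t s j k => ?_, fun t s ϑ => ?_, fun t s ϑ => ?_⟩
  · exact ((ha.measurable j k).const_mul (1 - r)).add ((hb.measurable j k).const_mul r)
  · simp only [Matrix.add_apply, Matrix.smul_apply, ha.symmetric t s j k, hb.symmetric t s j k]
  · rw [e]
    have t1 := mul_le_mul_of_nonneg_left (ha.lower t s ϑ) h1
    have t2 := mul_le_mul_of_nonneg_left (hb.lower t s ϑ) hr.1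
    linarith
  · rw [e]
    have t1 := mul_le_mul_of_nonneg_left (ha.upper t s ϑ) h1
    have t2 := mul_le_mul_of_nonneg_left (hb.upper t s ϑ) hr.1
    linarith

theorem dirDeriv_comp_sub {k : SpaceTime d → ℝ} (hk : ContDiff ℝ ∞ k) (z v : SpaceTime d) :
    dirDeriv v (fun w => k (z - w)) = fun w => -dirDeriv v k (z - w) := by
  ext w
  have h1 : HasFDerivAt (fun w : SpaceTime d => z - w) (-ContinuousLinearMap.id ℝ _) w := by
    simpa using (hasFDerivAt_id w).const_sub z
  have h2 := ((hk.differentiable (by simp) (z - w)).hasFDerivAt.comp w h1).fderiv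
  change fderiv ℝ (k ∘ fun w => z - w) w v = _
  rw [h2]
  simp [dirDeriv]

theorem dirDeriv_dirDeriv_comp_sub {k : SpaceTime d → ℝ} (hk : ContDiff ℝ ∞ k)
    (z v w : SpaceTime d) :
    dirDeriv w (dirDeriv v fun y => k (z - y)) = fun y => dirDeriv w (dirDeriv v k) (z - y) := by
  have h : (fun y => -dirDeriv v k (z - y)) = fun y => (fun x => -dirDeriv v k x) (z - y) := rfl
  rw [dirDeriv_comp_sub hk, h, dirDeriv_comp_sub (hk.dirDeriv v).neg]
  ext y
  have : dirDeriv w (fun x => -dirDeriv v k x) (z - y) = -dirDeriv w (dirDeriv v k) (z - y) := by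
    simp only [dirDeriv]
    rw [fderiv_fun_neg]
    rfl
  rw [this, neg_neg]

variable [NeZero d]

theorem parabolicOp_one (lam : ℝ) (u ut : L2 d) (uxx : Fin d → Fin d → L2 d) (z : SpaceTime d) :
    parabolicOp (fun _ _ => 1) lam u ut uxx z = ut z + ∑ j, uxx j j z - lam * u z := by
  simp [parabolicOp, Matrix.one_apply]

/-- The mollifications of a function orthogonal to the range of the heat operator satisfy the
adjoint equation. -/
theorem adjoint_equation_mollify {δ : ℝ} (hδ : 0 < δ)
    (h1 : IsAdmissible δ fun _ _ => (1 : Matrix (Fin d) (Fin d) ℝ)) {lam : ℝ} {y : L2 d}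
    (hy : ∀ q, inner ℝ (parabolicCLM hδ h1 lam q) y = (0 : ℝ)) {k : SpaceTime d → ℝ}
    (hk : ContDiff ℝ ∞ k) (hs : HasCompactSupport k) (z : SpaceTime d) :
    -mollify (dirDeriv (timeDir d) k) y z
      + ∑ j, mollify (dirDeriv (spaceDir j) (dirDeriv (spaceDir j) k)) y z
      - lam * mollify k y z = 0 := by
  have hφ : ContDiff ℝ ∞ fun w => k (z - w) := hk.comp (contDiff_const.sub contDiff_id)
  have hφs : HasCompactSupport fun w => k (z - w) := hs.comp_homeomorph (Homeomorph.subLeft z)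
  -- Orthogonality is tested on `w ↦ k(z - w)`. The reflection flips the sign of the time derivative
  -- and leaves the second derivatives unchanged, which produces the adjoint equation.
  have key := hy (smoothJet hφ hφs)
  have i : ∀ {m : SpaceTime d → ℝ}, Continuous m → HasCompactSupport m →
      Integrable fun w => m (z - w) * y w := fun hm hms =>
    ((hm.comp (continuous_const.sub continuous_id)).memLp_two
      (hms.comp_homeomorph (Homeomorph.subLeft z))).integrable_mul (Lp.memLp y)
  have i0 := i hk.continuous hs
  have it := i (hk.dirDeriv (timeDir d)).continuous (hs.dirDeriv _)
  have itn : Integrable fun w => -(dirDeriv (timeDir d) k (z - w) * y w) := it.neg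
  have ij := fun j : Fin d => i ((hk.dirDeriv (spaceDir j)).dirDeriv (spaceDir j)).continuous
    ((hs.dirDeriv _).dirDeriv _)
  have itj : Integrable fun w => -(dirDeriv (timeDir d) k (z - w) * y w)
      + ∑ j, dirDeriv (spaceDir j) (dirDeriv (spaceDir j) k) (z - w) * y w :=
    itn.add (integrable_finsetSum _ fun j _ => ij j)
  simp only [mollify_eq_swap]
  rw [← integral_neg, ← integral_finsetSum _ fun j _ => ij j, ← integral_const_mul,
    ← integral_add itn (integrable_finsetSum _ fun j _ => ij j),
    ← integral_sub itj (i0.const_mul lam),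
    ← key, L2.inner_def]
  refine integral_congr_ae ?_
  filter_upwards [coeFn_smoothJet hφ hφs, (parabolicCLM_eq_iff hδ h1 lam (smoothJet hφ hφs) _).1 rfl]
    with w ⟨e3, e2, e1⟩ e4
  rw [← e4, parabolicOp_one, e2, e3]
  simp only [e1, dirDeriv_dirDeriv_comp_sub hk, RCLike.inner_apply, conj_trivial]
  rw [dirDeriv_comp_sub hk]
  rw [← Finset.sum_mul]
  ring

/-- The mollification `G` is smooth and solves `-G_t + ΔG - λG = 0`. Multiplied by `G` and
integrated, the time term vanishes and the Laplacian gives a nonpositive contribution, so `λ‖G‖² ≤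
0`. -/
theorem mollify_eq_zero_of_orthogonal {δ : ℝ} (hδ : 0 < δ)
    (h1 : IsAdmissible δ fun _ _ => (1 : Matrix (Fin d) (Fin d) ℝ)) {lam : ℝ} (hlam : 0 < lam)
    {y : L2 d} (hy : ∀ q, inner ℝ (parabolicCLM hδ h1 lam q) y = (0 : ℝ)) {k : SpaceTime d → ℝ}
    (hk : ContDiff ℝ ∞ k) (hs : HasCompactSupport k) : rnorm volume (mollify k y) = 0 := by
  have hm := Lp.memLp y
  have c : ∀ {m : SpaceTime d → ℝ}, ContDiff ℝ ∞ m → HasCompactSupport m →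
      ContDiff ℝ ∞ (mollify m y) ∧ MemLp (mollify m y) 2 volume := fun hm1 hm2 =>
    have h := contDiff_mollify hm1 hm2 hm
    ⟨h, memLp_mollify hm1.continuous hm2 hm h.continuous.aestronglyMeasurable⟩
  set G := mollify k y with hG
  obtain ⟨G1, G2⟩ : ContDiff ℝ ∞ G ∧ MemLp G 2 volume := c hk hs
  have dt : dirDeriv (timeDir d) G = mollify (dirDeriv (timeDir d) k) y :=
    dirDeriv_mollify hk hs hm _
  have dx : ∀ j, dirDeriv (spaceDir j) G = mollify (dirDeriv (spaceDir j) k) y := fun j =>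
    dirDeriv_mollify hk hs hm _
  have dxx : ∀ j, dirDeriv (spaceDir j) (dirDeriv (spaceDir j) G)
      = mollify (dirDeriv (spaceDir j) (dirDeriv (spaceDir j) k)) y := fun j => by
    rw [dx, dirDeriv_mollify (hk.dirDeriv _) (hs.dirDeriv _) hm]
  have mt : MemLp (dirDeriv (timeDir d) G) 2 volume := by
    rw [dt]; exact (c (hk.dirDeriv _) (hs.dirDeriv _)).2
  have mx : ∀ j, MemLp (dirDeriv (spaceDir j) G) 2 volume := fun j => by
    rw [dx]; exact (c (hk.dirDeriv _) (hs.dirDeriv _)).2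
  have mxx : ∀ j, MemLp (dirDeriv (spaceDir j) (dirDeriv (spaceDir j) G)) 2 volume := fun j => by
    rw [dxx]; exact (c ((hk.dirDeriv _).dirDeriv _) ((hs.dirDeriv _).dirDeriv _)).2
  have e : ∀ z, -dirDeriv (timeDir d) G z
      + ∑ j, dirDeriv (spaceDir j) (dirDeriv (spaceDir j) G) z - lam * G z = 0 := fun z => by
    have := adjoint_equation_mollify hδ h1 hy hk hs z
    simpa only [dt, dxx] using this
  have it : ∫ z, G z * dirDeriv (timeDir d) G z = 0 := by
    have := integral_mul_dirDeriv (v := timeDir d) G1 G1 G2 G2 mt mt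
    simp only [mul_comm (dirDeriv (timeDir d) G _)] at this
    linarith
  have ij : ∀ j, ∫ z, G z * dirDeriv (spaceDir j) (dirDeriv (spaceDir j) G) z ≤ 0 := fun j => by
    rw [integral_mul_dirDeriv (v := spaceDir j) G1 (G1.dirDeriv _) G2 (mx j) (mx j) (mxx j)]
    exact neg_nonpos.2 (integral_nonneg fun z => mul_self_nonneg _)
  have nt : Integrable fun z => G z * dirDeriv (timeDir d) G z := G2.integrable_mul mt
  have ntn : Integrable fun z => -(G z * dirDeriv (timeDir d) G z) := nt.neg
  have nj : ∀ j, Integrable fun z => G z * dirDeriv (spaceDir j) (dirDeriv (spaceDir j) G) z :=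
    fun j => G2.integrable_mul (mxx j)
  have main : lam * rnorm volume G ^ 2
      = -(∫ z, G z * dirDeriv (timeDir d) G z)
        + ∑ j, ∫ z, G z * dirDeriv (spaceDir j) (dirDeriv (spaceDir j) G) z := by
    rw [rnorm_sq_eq_integral G2, ← integral_const_mul, ← integral_neg,
      ← integral_finsetSum _ fun j _ => nj j,
      ← integral_add ntn (integrable_finsetSum _ fun j _ => nj j)]
    refine integral_congr_ae (Eventually.of_forall fun z => ?_)
    simp only [← Finset.mul_sum]
    linear_combination (-G z) * e z
  have hsum := Finset.sum_nonpos fun j (_ : j ∈ Finset.univ) => ij j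
  have h2 : rnorm volume G ^ 2 ≤ 0 := by
    rw [it] at main
    have : lam * rnorm volume G ^ 2 ≤ lam * 0 := by rw [main, mul_zero]; linarith
    exact le_of_mul_le_mul_left this hlam
  exact pow_eq_zero_iff two_ne_zero |>.1 (le_antisymm h2 (sq_nonneg _))

theorem surjective_parabolicCLM_one {δ : ℝ} (hδ : 0 < δ)
    (h1 : IsAdmissible δ fun _ _ => (1 : Matrix (Fin d) (Fin d) ℝ)) {lam : ℝ} (hlam : 0 < lam) :
    Function.Surjective (parabolicCLM hδ h1 lam) := by
  obtain ⟨K, -, hK⟩ := exists_parabolicCLM_bound hδ d hlam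
  refine surjective_of_bound_of_orthogonal (hK _ h1) fun y hy => ?_
  have hm := Lp.memLp y
  have hconv : ConvL2 volume (fun n => mollify (mollifier d n) y) y :=
    ⟨fun n => memLp_mollify (contDiff_mollifier n).continuous (hasCompactSupport_mollifier n) hm
      (contDiff_mollify (contDiff_mollifier n) (hasCompactSupport_mollifier n)
        hm).continuous.aestronglyMeasurable, hm, tendsto_mollify hm⟩
  have hz := hconv.rnorm_tendsto
  simp only [mollify_eq_zero_of_orthogonal hδ h1 hlam hy (contDiff_mollifier _)
    (hasCompactSupport_mollifier _)] at hz
  have : rnorm volume y = 0 := (tendsto_nhds_unique hz tendsto_const_nhds)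
  exact norm_eq_zero.1 ((Lp.norm_def y).trans this)

/-- Continuity along the segment from the identity matrix to `a`. The identity is admissible because
`δ < 1`, and the lower bound is uniform because it depends on `δ`, `d` and `λ` but not on the
admissible coefficients. -/
theorem surjective_parabolicCLM {δ : ℝ} (hδ0 : 0 < δ) (hδ1 : δ < 1)
    {a : ℝ → ℝ → Matrix (Fin d) (Fin d) ℝ} (ha : IsAdmissible δ a) {lam : ℝ} (hlam : 0 < lam) :
    Function.Surjective (parabolicCLM hδ0 ha lam) := by
  have h1 := isAdmissible_one (d := d) hδ0 hδ1
  obtain ⟨K, -, hK⟩ := exists_parabolicCLM_bound hδ0 d hlam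
  have hseg : ∀ r (hr : r ∈ Set.Icc (0 : ℝ) 1),
      parabolicCLM hδ0 h1 lam + r • (parabolicCLM hδ0 ha lam - parabolicCLM hδ0 h1 lam)
        = parabolicCLM hδ0 (isAdmissible_segment h1 ha hr) lam := fun r hr => by
    ext1 q
    symm
    rw [parabolicCLM_eq_iff, _root_.add_apply, _root_.smul_apply,
      _root_.sub_apply]
    filter_upwards [Lp.coeFn_add (parabolicCLM hδ0 h1 lam q)
      (r • (parabolicCLM hδ0 ha lam q - parabolicCLM hδ0 h1 lam q)),
      Lp.coeFn_smul r (parabolicCLM hδ0 ha lam q - parabolicCLM hδ0 h1 lam q),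
      Lp.coeFn_sub (parabolicCLM hδ0 ha lam q) (parabolicCLM hδ0 h1 lam q),
      (parabolicCLM_eq_iff hδ0 ha lam q _).1 rfl, (parabolicCLM_eq_iff hδ0 h1 lam q _).1 rfl]
      with z e1 e2 e3 e4 e5
    rw [e1, Pi.add_apply, e2, Pi.smul_apply, e3, Pi.sub_apply, ← e4, ← e5, smul_eq_mul]
    have : ∑ j, ∑ k, ((1 - r) • (1 : Matrix (Fin d) (Fin d) ℝ) + r • a z.1 (z.2 0)) j k
          * q.1.2.2.2 j k z
        = (1 - r) * (∑ j, ∑ k, (1 : Matrix (Fin d) (Fin d) ℝ) j k * q.1.2.2.2 j k z)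
          + r * ∑ j, ∑ k, a z.1 (z.2 0) j k * q.1.2.2.2 j k z := by
      simp only [Finset.mul_sum, ← Finset.sum_add_distrib]
      refine Finset.sum_congr rfl fun j _ => Finset.sum_congr rfl fun k _ => ?_
      simp only [Matrix.add_apply, Matrix.smul_apply, smul_eq_mul]
      ring
    simp only [parabolicOp]
    rw [this]
    ring
  have := surjective_of_continuity_method (X := parabolicSobolev d) (Y := L2 d) (K := K)
    (T := parabolicCLM hδ0 h1 lam) (D := parabolicCLM hδ0 ha lam - parabolicCLM hδ0 h1 lam)
    (fun r hr x => by rw [hseg r hr]; exact hK _ _ x) (surjective_parabolicCLM_one hδ0 h1 hlam)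
  rwa [add_sub_cancel] at this

end Heat

/-! ### The main theorem. -/

theorem theorem3p10p2 (δ : ℝ) (hδ0 : 0 < δ) (hδ1 : δ < 1) :
    ∃ N : ℝ≥0, ∀ (d : ℕ) [NeZero d] (a : ℝ → ℝ → Matrix (Fin d) (Fin d) ℝ), IsAdmissible δ a →
      (∀ lam : ℝ, 0 < lam → ∀ f : L2 d, ∃! u : L2 d, IsSolution a lam f u) ∧
      (∀ lam : ℝ, 0 ≤ lam →
        ∀ (u ut : L2 d) (ux : Fin d → L2 d) (uxx : Fin d → Fin d → L2 d),
          IsW12With u ut ux uxx →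
          normL2 ut + normL2 (fun z => √(∑ j, ∑ k, uxx j k z ^ 2)) +
              ENNReal.ofReal √lam * normL2 (fun z => √(∑ k, ux k z ^ 2)) +
              ENNReal.ofReal lam * normL2 u
            ≤ N * normL2 (parabolicOp a lam u ut uxx)) := by
  obtain ⟨C, hC0, hC⟩ := exists_weak_estimate hδ0
  refine ⟨(4 * √C).toNNReal, fun d _ a ha => ⟨fun lam hlam f => ?_, fun lam hlam u ut ux uxx h =>
    normL2_estimate hδ0 ha hlam hC0 (hC d a ha lam hlam u ut ux uxx h)⟩⟩
  obtain ⟨q, hq⟩ := surjective_parabolicCLM hδ0 hδ1 ha hlam f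
  obtain ⟨K, -, hK⟩ := exists_parabolicCLM_bound hδ0 d hlam
  refine ⟨q.1.1, (isSolution_iff hδ0 ha lam f _).2 ⟨q, rfl, hq⟩, fun u hu => ?_⟩
  obtain ⟨p, rfl, hp⟩ := (isSolution_iff hδ0 ha lam f u).1 hu
  -- Two solutions give jets with the same image; the bound forces the jets, and so the functions,
  -- to coincide.
  have h := hK a ha (p - q)
  rw [map_sub, hp, hq, sub_self, norm_zero, mul_zero] at h
  rw [sub_eq_zero.1 (norm_le_zero_iff.1 h)]
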